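/- **Setting.** Let $d\ge 1$, $s\in(0,1)$ and $2\le p<\frac{2}{1-s}$. Write $B_R=\{x\in\mathbb R^d:|x|<R\}$. For $u:\mathbb R^d\to\mathbb R$ and $q,\alpha,R>0$ let $$\mathrm{Tail}_{q,\alpha}(u;R)=\Big(\int_{\mathbb R^d\setminus B_R}\frac{|u(y)|^q}{|y|^{d+\alpha}}\,dy\Big)^{1/q},\qquad L^{q}_{\alpha}(\mathbb R^d)=\Big\{u\in L^q_{loc}(\mathbb R^d):\int_{\mathbb R^d}\frac{|u(y)|^q}{(1+|y|)^{d+\alpha}}\,dy<\infty\Big\}.$$ For $\sigma\in(0,1)$ and an open set $\Omega\subset\mathbb R^d$, $W^{\sigma,q}(\Omega)$ is the space of $v\in L^q(\Omega)$ with $\iint_{\Omega\times\Omega}\frac{|v(x)-v(y)|^q}{|x-y|^{d+\sigma q}}\,dx\,dy<\infty$, $H^\sigma=W^{\sigma,2}$, and the subscript $loc$ means membership on every open set compactly contained in $\Omega$. A weak solution of $(-\Delta_p)^su=0$ in $\Omega$ is a function $u\in W^{s,p}_{loc}(\Omega)\cap L^{p-1}_{sp}(\mathbb R^d)$ such that,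 for every nonnegative $\varphi\in C_c^\infty(\Omega)$, $$\iint_{\mathbb R^d\times\mathbb R^d}\frac{|u(x)-u(y)|^{p-2}(u(x)-u(y))(\varphi(x)-\varphi(y))}{|x-y|^{d+sp}}\,dx\,dy=0 .$$ **Lemma.** For all $r,\mu>0$ there exist $\delta\in(0,1)$ and $\varepsilon_1>0$, which can be taken as small as desired, and a positive integer $K_0$, which can be taken as large as desired (that is, for every $\tau>0$ there are such $\delta,\varepsilon_1<\tau$ and $K_0>1/\tau$), depending only on $r,\mu,d,s,p$ (and on the prescribed threshold $\tau$), such that the following holds. Let $u:\mathbb R^d\to\mathbb R$ have the qualitative regularity $u\in C^1(B_{2^{K_0+1}})$ and $\nabla u\in H^{\gamma}_{loc}(B_{2^{K_0+1}})$ with $\gamma=1-\frac{p(1-s)}{2}$, and assume that 1. $u$ is a weak solution of $(-\Delta_p)^su=0$ in $B_{2^{K_0+1}}$, 2. $u(0)=0$, 3. $\|\nabla u\|_{L^\infty(B_{2^n})}\le(1-\delta)^{-n}$ for $n=0,1,\dots,K_0$, 4. $\mathrm{Tail}_{p-1,sp+1}(u;2^{K_0})\le\varepsilon_1$. Then at least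 one of the following holds. - There is a nonnegative integer $N$ such that $\|\nabla u\|_{L^\infty(B_{2^{-n}})}\le(1-\delta)^n$ for $n=0,1,\dots,N$, and there is a unit vector $e\in\mathbb R^d$ such that $$\big|\{x\in B_{2^{-N}}:|\nabla u(x)-(1-\delta)^Ne|\le r(1-\delta)^N\}\big|\ge(1-\mu)\,|B_{2^{-N}}| .$$ - For $\alpha_0>0$ defined by $2^{-\alpha_0}=1-\delta$ and $C_0=(1-\delta)^{-1}$, one has $|\nabla u(x)|\le C_0|x|^{\alpha_0}$ for all $x\in B_1$. -/

import Mathlib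

open MeasureTheory Metric Set
open scoped ContDiff

noncomputable section

/-- The (`p`-th power of the) Gagliardo seminorm on `Ω ⊆ ℝ^d`, as an extended nonnegative number:
`∫_Ω ∫_Ω |v(x) - v(y)|^p / |x - y|^(d + s p) dy dx`, for scalar or vector valued `v`. -/
def gagliardoEnergy {d : ℕ} {F : Type*} [NormedAddCommGroup F] (s p : ℝ)
    (Ω : Set (EuclideanSpace ℝ (Fin d))) (v : EuclideanSpace ℝ (Fin d) → F) : ENNReal :=
  ∫⁻ x in Ω, ∫⁻ y in Ω, ENNReal.ofReal (‖v x - v y‖ ^ p / ‖x - y‖ ^ ((d : ℝ) + s * p))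

/-- `v ∈ W^{s,p}(Ω)`. -/
def MemFracSobolev {d : ℕ} {F : Type*} [NormedAddCommGroup F] (s p : ℝ)
    (Ω : Set (EuclideanSpace ℝ (Fin d))) (v : EuclideanSpace ℝ (Fin d) → F) : Prop :=
  MemLp v (ENNReal.ofReal p) (volume.restrict Ω) ∧ gagliardoEnergy s p Ω v < ⊤

/-- `v ∈ W^{s,p}_loc(Ω)`: `v ∈ W^{s,p}(Ω')` for every open `Ω'` compactly contained in `Ω`. -/
def MemFracSobolevLoc {d : ℕ} {F : Type*} [NormedAddCommGroup F] (s p : ℝ)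
    (Ω : Set (EuclideanSpace ℝ (Fin d))) (v : EuclideanSpace ℝ (Fin d) → F) : Prop :=
  ∀ Ω' : Set (EuclideanSpace ℝ (Fin d)), IsOpen Ω' → IsCompact (closure Ω') → closure Ω' ⊆ Ω →
    MemFracSobolev s p Ω' v

/-- The tail space `L^q_α(ℝ^d)`: functions in `L^q_loc(ℝ^d)` with
`∫ |u(y)|^q / (1 + |y|)^(d + α) dy < ∞`. -/
def MemTailSpace {d : ℕ} (q α : ℝ) (u : EuclideanSpace ℝ (Fin d) → ℝ) : Prop :=
  (∀ K : Set (EuclideanSpace ℝ (Fin d)), IsCompact K →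
    MemLp u (ENNReal.ofReal q) (volume.restrict K)) ∧
  ∫⁻ y, ENNReal.ofReal (|u y| ^ q / (1 + ‖y‖) ^ ((d : ℝ) + α)) < ⊤

/-- The tail `Tail_{q,α}(u; R) = (∫_{|y| ≥ R} |u(y)|^q / |y|^(d + α) dy)^(1/q)`, centered at the
origin, as an extended nonnegative number. -/
def tailFun {d : ℕ} (q α : ℝ) (u : EuclideanSpace ℝ (Fin d) → ℝ) (R : ℝ) : ENNReal :=
  (∫⁻ y in (ball 0 R)ᶜ, ENNReal.ofReal (|u y| ^ q / ‖y‖ ^ ((d : ℝ) + α))) ^ (1 / q)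

/-- The weak form of the fractional `p`-Laplacian,
`∬ |u(x) - u(y)|^(p-2) (u(x) - u(y)) (φ(x) - φ(y)) |x - y|^(-d - s p) dx dy`.
For `u ∈ W^{s,p}_loc(Ω) ∩ L^{p-1}_{sp}(ℝ^d)` and `φ ∈ C_c^∞(Ω)` it converges absolutely. -/
def fracPLapForm {d : ℕ} (s p : ℝ) (u φ : EuclideanSpace ℝ (Fin d) → ℝ) : ℝ :=
  ∫ z : EuclideanSpace ℝ (Fin d) × EuclideanSpace ℝ (Fin d),
    |u z.1 - u z.2| ^ (p - 2) * (u z.1 - u z.2) * (φ z.1 - φ z.2)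
      / ‖z.1 - z.2‖ ^ ((d : ℝ) + s * p) ∂(volume.prod volume)

/-- Nonnegative test functions in `C_c^∞(Ω)`. -/
def IsNonnegTest {d : ℕ} (Ω : Set (EuclideanSpace ℝ (Fin d)))
    (φ : EuclideanSpace ℝ (Fin d) → ℝ) : Prop :=
  ContDiff ℝ ∞ φ ∧ HasCompactSupport φ ∧ tsupport φ ⊆ Ω ∧ ∀ x, 0 ≤ φ x

/-- Weak subsolutions of `(-Δ_p)^s u = 0` in `Ω`. -/
def IsWeakSubsolution {d : ℕ} (s p : ℝ) (Ω : Set (EuclideanSpace ℝ (Fin d)))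
    (u : EuclideanSpace ℝ (Fin d) → ℝ) : Prop :=
  MemFracSobolevLoc s p Ω u ∧ MemTailSpace (p - 1) (s * p) u ∧
    ∀ φ, IsNonnegTest Ω φ → fracPLapForm s p u φ ≤ 0

/-- Weak supersolutions of `(-Δ_p)^s u = 0` in `Ω`. -/
def IsWeakSupersolution {d : ℕ} (s p : ℝ) (Ω : Set (EuclideanSpace ℝ (Fin d)))
    (u : EuclideanSpace ℝ (Fin d) → ℝ) : Prop :=
  MemFracSobolevLoc s p Ω u ∧ MemTailSpace (p - 1) (s * p) u ∧
    ∀ φ, IsNonnegTest Ω φ → 0 ≤ fracPLapForm s p u φ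

/-- Weak solutions of `(-Δ_p)^s u = 0` in `Ω`. -/
def IsWeakSolution {d : ℕ} (s p : ℝ) (Ω : Set (EuclideanSpace ℝ (Fin d)))
    (u : EuclideanSpace ℝ (Fin d) → ℝ) : Prop :=
  IsWeakSubsolution s p Ω u ∧ IsWeakSupersolution s p Ω u

/-- The qualitative regularity `u ∈ C^1(Ω) ∩ H^{1+γ}_loc(Ω)` with `γ = 1 - p (1 - s) / 2`.
(For `u ∈ C^1(Ω)` the second condition says that `∇u ∈ W^{γ,2}(Ω') = H^γ(Ω')` for all open `Ω'`
compactly contained in `Ω`.) -/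
def IsQualitativelyRegular {d : ℕ} (s p : ℝ) (Ω : Set (EuclideanSpace ℝ (Fin d)))
    (u : EuclideanSpace ℝ (Fin d) → ℝ) : Prop :=
  ContDiffOn ℝ 1 u Ω ∧ MemFracSobolevLoc (1 - p * (1 - s) / 2) 2 Ω (gradient u)

/-- The norm `‖∇u‖_{L^∞(B_R)}` on the ball of radius `R` centered at the origin. -/
def gradSupNorm {d : ℕ} (u : EuclideanSpace ℝ (Fin d) → ℝ) (R : ℝ) : ENNReal :=
  eLpNorm (gradient u) ⊤ (volume.restrict (ball 0 R))

end

/-! Put `γ = 2 - p(1-s)`, positive because `p < 2/(1-s)` (twice the exponent of the statement), and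
`q = 1 - δ`. At each dyadic scale `u` is rescaled so that its gradient is at most one on a ball of
large radius `2^m`. If the rescaled gradient stays below `1 - 2^(-m)` on the unit ball, the bound
improves by the factor `q` at the next scale. Otherwise the slope is almost maximal at some point,
and then the gradient is close to one unit vector on most of the unit ball, which is the first
alternative (`gradient_close_or_decay`). If this never happens, decay at all scales is the Hölder
bound.

The core is `exists_gradient_close`, proved by contradiction and compactness. Solutions `u m` on
balls of radius `2^m`, with slopes tending to one at some points, converge along an ultrafilter to a
1-Lipschitz function `U`. Neither gradients nor the equation are passed to the limit. Instead, an
estimate is extracted from each `u m`. The defect `w = 1 - (u(x+he) - u(x))/h` is nonnegative and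
satisfies, up to a small long range error, a linear nonlocal equation with kernel comparable from
below to `|u(x)-u(y)|^(p-2) |x-y|^(-d-sp)` at short range. A De Giorgi iteration under a cone-shaped
barrier is run on it (`CoreSol.energy`, `CoreSol.crossMass_ge`, `exists_density`), using only the
cross term `∬ K (w - cone)₊(x) (cone - w)₊(y)`.

The kernel degenerates where `u` is flat. But if `w` is small at `y` and `u` is flat around `y` at
scale `ρ`, there is a smaller scale at which `u` does oscillate while twice that scale is still
flat. At that scale `u` cannot keep growing along `e`, so the defect is large on a set where the
kernel is nondegenerate, and the smaller scale only makes the contribution larger.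

The outcome (`exists_evaluation`) is a point `y` near the point of almost maximal slope at which the
weighted mass of `(w - cone)₊` is small. In the limit, `U` has slope one in a fixed direction off
the single level set `{U = U y}` (`exists_slope_point`). Following rays away from this level and
repeating the argument there gives a second, different level, so the slope is one everywhere and `U`
is affine (`ultralimit_linear`). Unit increments of `u m` are then uniformly close to one, which
controls the integral of `1 - ∂ₑu`; as `‖∇u‖ ≤ 1`, this controls `‖∇u - e‖²`. -/

open Filter Topology
open scoped Convolution

/-! ### The nonlinearity and its difference quotient. -/

/-- The power nonlinearity `t ↦ |t|^(p-2) t`. -/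
noncomputable def signPow (p t : ℝ) : ℝ := |t| ^ (p - 2) * t

lemma signPow_neg (p t : ℝ) : signPow p (-t) = -signPow p t := by simp [signPow]

lemma signPow_sub_comm (p a b : ℝ) : signPow p (a - b) = -signPow p (b - a) := by
  rw [← signPow_neg, neg_sub]

lemma measurable_signPow (p : ℝ) : Measurable (signPow p) := by
  unfold signPow; fun_prop

lemma abs_signPow {p : ℝ} (hp : 2 ≤ p) (t : ℝ) : |signPow p t| = |t| ^ (p - 1) := by
  unfold signPow
  rw [abs_mul, abs_of_nonneg (Real.rpow_nonneg (abs_nonneg _) _)]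
  rcases eq_or_ne t 0 with rfl | h
  · simp [Real.zero_rpow (by linarith : p - 1 ≠ 0)]
  · have := Real.rpow_add_one (abs_ne_zero.2 h) (p - 2)
    rw [← this]; congr 1; ring

lemma signPow_mul {c : ℝ} (hc : 0 ≤ c) {p : ℝ} (hp : 2 ≤ p) (t : ℝ) :
    signPow p (c * t) = c ^ (p - 1) * signPow p t := by
  unfold signPow
  rcases hc.eq_or_lt with rfl | h
  · simp [Real.zero_rpow (by linarith : p - 1 ≠ 0)]
  · rw [abs_mul, abs_of_pos h, Real.mul_rpow hc (abs_nonneg t)]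
    have := Real.rpow_add_one h.ne' (p - 2)
    rw [show p - 1 = p - 2 + 1 by ring, this]; ring

/-- Difference quotient of `signPow`. -/
noncomputable def signPowSlope (p a b : ℝ) : ℝ :=
  if a = b then |a| ^ (p - 2) else (signPow p b - signPow p a) / (b - a)

lemma signPow_sub_eq (p a b : ℝ) :
    signPow p b - signPow p a = signPowSlope p a b * (b - a) := by
  unfold signPowSlope
  split_ifs with h
  · simp [h]
  · rw [div_mul_cancel₀]; exact sub_ne_zero.2 (Ne.symm h)

/-- The right side minus the left side is `1/2 (|b|^(p-2) - |a|^(p-2)) (b² - a²)`, a product of two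
factors of the same sign. -/
lemma signPow_sub_mul_sub (p a b : ℝ) (hp : 2 ≤ p) :
    1 / 2 * (|a| ^ (p - 2) + |b| ^ (p - 2)) * (b - a) ^ 2
      ≤ (signPow p b - signPow p a) * (b - a) := by
  have key : 0 ≤ (|b| ^ (p - 2) - |a| ^ (p - 2)) * (b ^ 2 - a ^ 2) := by
    rcases le_total |a| |b| with h | h
    · exact mul_nonneg (sub_nonneg.2 (Real.rpow_le_rpow (abs_nonneg _) h (by linarith)))
        (sub_nonneg.2 (sq_le_sq.2 h))
    · exact mul_nonneg_of_nonpos_of_nonpos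
        (sub_nonpos.2 (Real.rpow_le_rpow (abs_nonneg _) h (by linarith)))
        (sub_nonpos.2 (sq_le_sq.2 h))
  unfold signPow
  nlinarith [key]

/-- Only one endpoint enters. With `a = u x - u y`, the ellipticity of the linearized kernel is read
off `u` itself and not off its translate. -/
lemma signPowSlope_ge {p : ℝ} (hp : 2 ≤ p) (a b : ℝ) :
    1 / 2 * |a| ^ (p - 2) ≤ signPowSlope p a b := by
  have ha := Real.rpow_nonneg (abs_nonneg a) (p - 2)
  have hb := Real.rpow_nonneg (abs_nonneg b) (p - 2)
  unfold signPowSlope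
  split_ifs with h
  · linarith
  · have h0 : b - a ≠ 0 := sub_ne_zero.2 (Ne.symm h)
    have h2 : 0 < (b - a) ^ 2 := by positivity
    have := signPow_sub_mul_sub p a b hp
    have e : (signPow p b - signPow p a) / (b - a)
        = (signPow p b - signPow p a) * (b - a) / (b - a) ^ 2 := by
      field_simp
    rw [e, le_div_iff₀ h2]
    refine le_trans (mul_le_mul_of_nonneg_right ?_ h2.le) this
    nlinarith

lemma signPowSlope_nonneg {p : ℝ} (hp : 2 ≤ p) (a b : ℝ) : 0 ≤ signPowSlope p a b :=
  le_trans (mul_nonneg (by norm_num) (Real.rpow_nonneg (abs_nonneg a) _)) (signPowSlope_ge hp a b)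

lemma abs_signPow_sub_le {p : ℝ} (hp : 2 ≤ p) {a b m : ℝ} (ha : |a| ≤ m) (hb : |b| ≤ m) :
    |signPow p b - signPow p a| ≤ (p - 1) * m ^ (p - 2) * |b - a| := by
  have hm : 0 ≤ m := (abs_nonneg a).trans ha
  have aux : ∀ x y : ℝ, 0 ≤ x → x ≤ y → y ≤ m →
      y ^ (p - 1) - x ^ (p - 1) ≤ (p - 1) * m ^ (p - 2) * (y - x) := by
    intro x y hx hxy hy
    have hd : ∀ t ∈ Icc 0 m, HasDerivWithinAt (fun t : ℝ => t ^ (p - 1))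
        ((p - 1) * t ^ (p - 1 - 1)) (Icc 0 m) t := fun t _ =>
      (Real.hasDerivAt_rpow_const (Or.inr (by linarith))).hasDerivWithinAt
    have := (convex_Icc (0 : ℝ) m).norm_image_sub_le_of_norm_hasDerivWithin_le hd
      (C := (p - 1) * m ^ (p - 2)) (fun t ht => by
        rw [Real.norm_eq_abs, abs_of_nonneg (mul_nonneg (by linarith) (Real.rpow_nonneg ht.1 _))]
        rw [show p - 1 - 1 = p - 2 by ring]
        exact mul_le_mul_of_nonneg_left (Real.rpow_le_rpow ht.1 ht.2 (by linarith))
          (by linarith)) (x := x) (y := y) ⟨hx, hxy.trans hy⟩ ⟨hx.trans hxy, hy⟩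
    rw [Real.norm_eq_abs, Real.norm_eq_abs, abs_of_nonneg (sub_nonneg.2 hxy)] at this
    exact (le_abs_self _).trans this
  have pos : ∀ t : ℝ, 0 ≤ t → signPow p t = t ^ (p - 1) := by
    intro t ht
    have h1 := abs_signPow hp t
    have h2 : 0 ≤ signPow p t := mul_nonneg (Real.rpow_nonneg (abs_nonneg _) _) ht
    rwa [abs_of_nonneg h2, abs_of_nonneg ht] at h1
  have main : ∀ x y : ℝ, |x| ≤ m → |y| ≤ m → x ≤ y →
      |signPow p y - signPow p x| ≤ (p - 1) * m ^ (p - 2) * |y - x| := by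
    intro x y hx hy hxy
    have hx' := abs_le.1 hx
    have hy' := abs_le.1 hy
    have h0 : 0 ≤ signPow p y - signPow p x := by
      rw [signPow_sub_eq]
      exact mul_nonneg (signPowSlope_nonneg hp _ _) (sub_nonneg.2 hxy)
    rw [abs_of_nonneg h0, abs_of_nonneg (sub_nonneg.2 hxy)]
    rcases le_total 0 x with h | h
    · rw [pos x h, pos y (h.trans hxy)]
      exact aux x y h hxy hy'.2
    · have ex : signPow p x = -((-x) ^ (p - 1)) := by
        rw [← pos (-x) (by linarith), signPow_neg, neg_neg]
      rcases le_total 0 y with h' | h'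
      · have a1 := aux 0 y le_rfl h' hy'.2
        have a2 := aux 0 (-x) le_rfl (by linarith) (by linarith)
        rw [Real.zero_rpow (by linarith)] at a1 a2
        rw [ex, pos y h']
        linarith
      · have ey : signPow p y = -((-y) ^ (p - 1)) := by
          rw [← pos (-y) (by linarith), signPow_neg, neg_neg]
        have a2 := aux (-y) (-x) (by linarith) (by linarith) (by linarith)
        rw [ex, ey]
        linarith
  rcases le_total a b with h | h
  · exact main a b ha hb h
  · rw [abs_sub_comm, abs_sub_comm b a]; exact main b a hb ha h

lemma signPowSlope_le {p : ℝ} (hp : 2 ≤ p) {a b m : ℝ} (ha : |a| ≤ m) (hb : |b| ≤ m) :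
    signPowSlope p a b ≤ (p - 1) * m ^ (p - 2) := by
  have hm : 0 ≤ m := (abs_nonneg a).trans ha
  have h1 : |a| ^ (p - 2) ≤ m ^ (p - 2) :=
    Real.rpow_le_rpow (abs_nonneg _) ha (by linarith)
  have h2 : 0 ≤ m ^ (p - 2) := Real.rpow_nonneg hm _
  unfold signPowSlope
  split_ifs with h
  · nlinarith
  · have h0 : 0 < |b - a| := abs_pos.2 (sub_ne_zero.2 (Ne.symm h))
    refine (le_abs_self _).trans ?_
    rw [abs_div, div_le_iff₀ h0]
    exact abs_signPow_sub_le hp ha hb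

lemma measurable_signPowSlope (p : ℝ) :
    Measurable (fun z : ℝ × ℝ => signPowSlope p z.1 z.2) := by
  unfold signPowSlope
  have := measurable_signPow p
  refine Measurable.ite (measurableSet_eq_fun measurable_fst measurable_snd) ?_ ?_
  · fun_prop
  · fun_prop

/-! ### Splitting the kernel into a short range and a bounded long range part. -/

/-- The short range part of the kernel `‖z‖^(-D)`. -/
noncomputable def nearKer {d : ℕ} (D r : ℝ) (z : EuclideanSpace ℝ (Fin d)) : ℝ :=
  (‖z‖ ^ D)⁻¹ * (1 - (min 1 (‖z‖ / r)) ^ D)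

/-- The long range part of the kernel `‖z‖^(-D)`. -/
noncomputable def farKer {d : ℕ} (D r : ℝ) (z : EuclideanSpace ℝ (Fin d)) : ℝ :=
  ((max ‖z‖ r) ^ D)⁻¹

section ker
variable {d : ℕ} {D r : ℝ} (z : EuclideanSpace ℝ (Fin d))

lemma nearKer_add_farKer (hr : 0 < r) (hz : z ≠ 0) :
    nearKer D r z + farKer D r z = (‖z‖ ^ D)⁻¹ := by
  have h0 : 0 < ‖z‖ := norm_pos_iff.2 hz
  unfold nearKer farKer
  rcases le_total ‖z‖ r with h | h
  · rw [max_eq_right h, min_eq_right ((div_le_one hr).2 h), Real.div_rpow h0.le hr.le]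
    have := (Real.rpow_pos_of_pos h0 D).ne'
    field_simp
    ring
  · rw [max_eq_left h, min_eq_left ((one_le_div hr).2 h)]
    simp

lemma nearKer_nonneg (hD : 0 ≤ D) (hr : 0 < r) : 0 ≤ nearKer D r z := by
  unfold nearKer
  refine mul_nonneg (inv_nonneg.2 (Real.rpow_nonneg (norm_nonneg _) _)) (sub_nonneg.2 ?_)
  exact Real.rpow_le_one (le_min zero_le_one (by positivity)) (min_le_left _ _) hD

lemma nearKer_le (hr : 0 < r) : nearKer D r z ≤ (‖z‖ ^ D)⁻¹ := by
  unfold nearKer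
  refine mul_le_of_le_one_right (inv_nonneg.2 (Real.rpow_nonneg (norm_nonneg _) _)) ?_
  have := Real.rpow_nonneg (le_min zero_le_one (by positivity) : 0 ≤ min 1 (‖z‖ / r)) D
  linarith

lemma nearKer_eq_zero (hr : 0 < r) (h : r ≤ ‖z‖) : nearKer D r z = 0 := by
  unfold nearKer
  rw [min_eq_left ((one_le_div hr).2 h)]
  simp

lemma nearKer_ge (hD : 1 ≤ D) (hr : 0 < r) (h : ‖z‖ ≤ r / 2) :
    1 / 2 * (‖z‖ ^ D)⁻¹ ≤ nearKer D r z := by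
  unfold nearKer
  rw [mul_comm]
  refine mul_le_mul_of_nonneg_left ?_ (inv_nonneg.2 (Real.rpow_nonneg (norm_nonneg _) _))
  have h0 : 0 ≤ min 1 (‖z‖ / r) := le_min zero_le_one (by positivity)
  have h1 : min 1 (‖z‖ / r) ≤ 1 / 2 := (min_le_right _ _).trans (by
    rw [div_le_iff₀ hr]; linarith)
  have : (min 1 (‖z‖ / r)) ^ D ≤ 1 / 2 := by
    calc (min 1 (‖z‖ / r)) ^ D ≤ (min 1 (‖z‖ / r)) ^ (1 : ℝ) :=
          Real.rpow_le_rpow_of_exponent_ge' h0 (min_le_left _ _) zero_le_one hD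
      _ ≤ 1 / 2 := by rwa [Real.rpow_one]
  linarith

lemma nearKer_neg : nearKer D r (-z) = nearKer D r z := by simp [nearKer]
lemma farKer_neg : farKer D r (-z) = farKer D r z := by simp [farKer]

lemma farKer_nonneg (hr : 0 < r) : 0 ≤ farKer D r z := by
  unfold farKer
  exact inv_nonneg.2 (Real.rpow_nonneg (hr.le.trans (le_max_right _ _)) _)

lemma measurable_nearKer : Measurable (nearKer D r : EuclideanSpace ℝ (Fin d) → ℝ) := by
  unfold nearKer; fun_prop

lemma measurable_farKer : Measurable (farKer D r : EuclideanSpace ℝ (Fin d) → ℝ) := by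
  unfold farKer; fun_prop

end ker

/-! ### Normalized solutions and Lipschitz test functions. -/

/-- Normalized solutions: 1-Lipschitz in `ball 0 R`, vanishing at the origin, with controlled
tail, and satisfying the weak form of the equation in `ball 0 R`. -/
structure CoreSol {d : ℕ} (s p R β : ℝ) (u : EuclideanSpace ℝ (Fin d) → ℝ) : Prop where
  meas : Measurable u
  diff : ContDiffOn ℝ 1 u (ball 0 R)
  lip : ∀ x ∈ ball (0 : EuclideanSpace ℝ (Fin d)) R, ∀ y ∈ ball (0 : EuclideanSpace ℝ (Fin d)) R,
    |u x - u y| ≤ ‖x - y‖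
  zero : u 0 = 0
  tailspace : ∫⁻ y, ENNReal.ofReal (|u y| ^ (p - 1) / (1 + ‖y‖) ^ ((d : ℝ) + s * p)) < ⊤
  tail : ∫⁻ y in (ball 0 R)ᶜ, ENNReal.ofReal (|u y| ^ (p - 1) / ‖y‖ ^ ((d : ℝ) + s * p + 1))
    ≤ ENNReal.ofReal β
  weak : ∀ φ, IsNonnegTest (ball 0 R) φ → fracPLapForm s p u φ = 0

/-- Lipschitz functions bounded by `b` and supported in `ball 0 ρ`. -/
structure LipTest {d : ℕ} (L b ρ : ℝ) (φ : EuclideanSpace ℝ (Fin d) → ℝ) : Prop where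
  lip : ∀ x y, |φ x - φ y| ≤ L * ‖x - y‖
  bdd : ∀ x, |φ x| ≤ b
  supp : ∀ x, ρ ≤ ‖x‖ → φ x = 0

lemma add_rpow_le {a b q : ℝ} (ha : 0 ≤ a) (hb : 0 ≤ b) (hq : 0 ≤ q) :
    (a + b) ^ q ≤ 2 ^ q * (a ^ q + b ^ q) := by
  have h1 : a + b ≤ 2 * max a b := by
    have := le_max_left a b; have := le_max_right a b; linarith
  have hm : 0 ≤ max a b := ha.trans (le_max_left _ _)
  calc (a + b) ^ q ≤ (2 * max a b) ^ q := Real.rpow_le_rpow (by positivity) h1 hq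
    _ = 2 ^ q * (max a b) ^ q := Real.mul_rpow (by norm_num) hm
    _ ≤ 2 ^ q * (a ^ q + b ^ q) := by
      refine mul_le_mul_of_nonneg_left ?_ (by positivity)
      rcases le_total a b with h | h
      · rw [max_eq_right h]; have := Real.rpow_nonneg ha q; linarith
      · rw [max_eq_left h]; have := Real.rpow_nonneg hb q; linarith

section
variable {d : ℕ} {s p R β : ℝ} {u : EuclideanSpace ℝ (Fin d) → ℝ}

lemma CoreSol.abs_le_norm (hu : CoreSol s p R β u) {x : EuclideanSpace ℝ (Fin d)}
    (hx : ‖x‖ < R) : |u x| ≤ ‖x‖ := by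
  have := hu.lip x (by simpa using hx) 0 (by simpa using (norm_nonneg x).trans_lt hx)
  simpa [hu.zero] using this

lemma LipTest.nonneg_L {L b ρ : ℝ} {φ : EuclideanSpace ℝ (Fin d) → ℝ} (hd : 1 ≤ d)
    (h : LipTest L b ρ φ) : 0 ≤ L := by
  have := h.lip (EuclideanSpace.single ⟨0, hd⟩ 1) 0
  have h2 := (abs_nonneg _).trans this
  simpa using h2

lemma LipTest.nonneg_b {L b ρ : ℝ} {φ : EuclideanSpace ℝ (Fin d) → ℝ}
    (h : LipTest L b ρ φ) : 0 ≤ b := (abs_nonneg _).trans (h.bdd 0)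

lemma LipTest.continuous {L b ρ : ℝ} {φ : EuclideanSpace ℝ (Fin d) → ℝ} (hd : 1 ≤ d)
    (h : LipTest L b ρ φ) : Continuous φ := by
  have : LipschitzWith (Real.toNNReal L) φ := LipschitzWith.of_dist_le_mul fun x y => by
    rw [Real.dist_eq, dist_eq_norm, Real.coe_toNNReal _ (h.nonneg_L hd)]
    exact h.lip x y
  exact this.continuous

lemma integrable_one_add_norm_rpow_neg (hs : 0 < s * p) :
    Integrable (fun y : EuclideanSpace ℝ (Fin d) => ((1 + ‖y‖) ^ ((d : ℝ) + s * p))⁻¹) := by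
  have := integrable_one_add_norm (μ := (volume : Measure (EuclideanSpace ℝ (Fin d))))
    (r := (d : ℝ) + s * p) (by simp [hs])
  refine this.congr (ae_of_all _ fun y => ?_)
  exact Real.rpow_neg (by positivity) _

lemma CoreSol.integrable_tailspace (hu : CoreSol s p R β u) :
    Integrable (fun y => |u y| ^ (p - 1) * ((1 + ‖y‖) ^ ((d : ℝ) + s * p))⁻¹) := by
  refine ⟨?_, ?_⟩
  · have := hu.meas
    exact Measurable.aestronglyMeasurable (by fun_prop)
  · rw [hasFiniteIntegral_iff_ofReal (ae_of_all _ fun y => by positivity)]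
    exact hu.tailspace

/-- Near the diagonal the Lipschitz bounds leave `‖x - y‖^(p - D)`, integrable because `D - p = d -
p(1-s) < d`. Away from it one point lies in `ball 0 ρ`, and the kernel is comparable to the tail
weight at the other. The majorant depends on `φ` only through `L`, `b`, `ρ`, so it serves a whole
mollified sequence. -/
lemma CoreSol.exists_dominating (hu : CoreSol s p R β u) (hd : 1 ≤ d) (hs0 : 0 < s) (hs1 : s < 1)
    (hp2 : 2 ≤ p) {L b ρ : ℝ} (hL : 0 ≤ L) (hb : 0 ≤ b) (hρ0 : 0 ≤ ρ) (hρ : ρ + 1 ≤ R) :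
    ∃ g : EuclideanSpace ℝ (Fin d) × EuclideanSpace ℝ (Fin d) → ℝ,
      Integrable g (volume.prod volume) ∧
      ∀ φ, LipTest L b ρ φ → ∀ z,
        |signPow p (u z.1 - u z.2) * (φ z.1 - φ z.2)| * (‖z.1 - z.2‖ ^ ((d : ℝ) + s * p))⁻¹
          ≤ g z := by
  set D : ℝ := (d : ℝ) + s * p with hDdef
  have hsp : 0 < s * p := mul_pos hs0 (by linarith)
  have hD0 : 0 ≤ D := by positivity
  set f : EuclideanSpace ℝ (Fin d) → ℝ := indicator (ball 0 1) (fun z => ‖z‖ ^ (-(D - p))) with hf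
  have hfi : Integrable f := by
    rw [hf, integrable_indicator_iff measurableSet_ball]
    refine integrableOn_ball_of_norm_le_rpow (C := 1) (α := D - p) (by simpa using hd) ?_ ?_ ?_
    · simp only [finrank_euclideanSpace, Fintype.card_fin]; nlinarith
    · refine ae_of_all _ fun x => ?_
      rw [one_mul, Real.norm_of_nonneg (by positivity)]
    · exact Measurable.aestronglyMeasurable (by fun_prop)
  set n : EuclideanSpace ℝ (Fin d) → ℝ := fun y =>
    b * (2 ^ (p - 1) * ((ρ ^ (p - 1) + |u y| ^ (p - 1)) * ((2 + ρ) ^ D * ((1 + ‖y‖) ^ D)⁻¹)))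
    with hn
  have hni : Integrable n := by
    have h1 := (integrable_one_add_norm_rpow_neg (d := d) hsp).const_mul
      (b * 2 ^ (p - 1) * ρ ^ (p - 1) * (2 + ρ) ^ D)
    have h2 := hu.integrable_tailspace.const_mul (b * 2 ^ (p - 1) * (2 + ρ) ^ D)
    refine (h1.add h2).congr (ae_of_all _ fun y => ?_)
    simp only [hn, Pi.add_apply, ← hDdef]
    ring
  have hn0 : ∀ y, 0 ≤ n y := fun y => by positivity
  have hBi : ∀ a : ℝ, Integrable (indicator (ball (0 : EuclideanSpace ℝ (Fin d)) a)
      (fun _ => (1 : ℝ))) := fun a => by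
    rw [integrable_indicator_iff measurableSet_ball]
    exact integrableOn_const measure_ball_lt_top.ne
  have hB0 : ∀ (a : ℝ) (x : EuclideanSpace ℝ (Fin d)),
      0 ≤ indicator (ball (0 : EuclideanSpace ℝ (Fin d)) a) (fun _ => (1 : ℝ)) x :=
    fun a x => indicator_nonneg (fun _ _ => zero_le_one) x
  have hf0 : ∀ z, 0 ≤ f z := fun z => indicator_nonneg (fun z _ => by positivity) z
  refine ⟨fun z => L * (indicator (ball 0 (ρ + 1)) (fun _ => (1 : ℝ)) z.2 * f (z.1 - z.2))
      + (indicator (ball 0 ρ) (fun _ => (1 : ℝ)) z.1 * n z.2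
        + n z.1 * indicator (ball 0 ρ) (fun _ => (1 : ℝ)) z.2), ?_, ?_⟩
  · have h1 := (hBi (ρ + 1)).convolution_integrand (μ := volume) (ν := volume)
      (ContinuousLinearMap.mul ℝ ℝ) hfi
    exact (h1.const_mul L).add (((hBi ρ).mul_prod hni).add (hni.mul_prod (hBi ρ)))
  · rintro φ hφ ⟨x, y⟩
    simp only
    have t1 := mul_nonneg hL (mul_nonneg (hB0 (ρ + 1) y) (hf0 (x - y)))
    have t2 := mul_nonneg (hB0 ρ x) (hn0 y)
    have t3 := mul_nonneg (hn0 x) (hB0 ρ y)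
    by_cases hout : ρ ≤ ‖x‖ ∧ ρ ≤ ‖y‖
    · rw [hφ.supp x hout.1, hφ.supp y hout.2]
      simp only [sub_self, mul_zero, abs_zero, zero_mul]
      linarith
    have hin : ‖x‖ < ρ ∨ ‖y‖ < ρ := by
      by_contra hc; push Not at hc; exact hout hc
    rcases lt_or_ge ‖x - y‖ 1 with h1 | h1
    · refine le_trans ?_ (le_add_of_nonneg_right (add_nonneg t2 t3))
      have hxy : ‖x‖ ≤ ‖y‖ + ‖x - y‖ := by
        have := norm_add_le y (x - y); simpa using this
      have hyx : ‖y‖ ≤ ‖x‖ + ‖x - y‖ := by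
        have := norm_sub_le x (x - y); simpa using this
      have hx : ‖x‖ < ρ + 1 := by rcases hin with h | h <;> linarith
      have hy : ‖y‖ < ρ + 1 := by rcases hin with h | h <;> linarith
      rcases eq_or_ne x y with rfl | hne
      · simpa using t1
      have hz : 0 < ‖x - y‖ := norm_pos_iff.2 (sub_ne_zero.2 hne)
      rw [indicator_of_mem (by simpa using hy), one_mul, hf,
        indicator_of_mem (by simpa using h1), abs_mul, abs_signPow hp2]
      have e : ‖x - y‖ ^ (-(D - p)) = ‖x - y‖ ^ (p - 1) * ‖x - y‖ * (‖x - y‖ ^ D)⁻¹ := by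
        rw [← Real.rpow_neg hz.le, ← Real.rpow_add_one hz.ne', ← Real.rpow_add hz]
        congr 1; ring
      rw [e]
      have a1 : |u x - u y| ^ (p - 1) ≤ ‖x - y‖ ^ (p - 1) :=
        Real.rpow_le_rpow (abs_nonneg _)
          (hu.lip x (by simpa using hx.trans_le hρ) y (by simpa using hy.trans_le hρ)) (by linarith)
      have a2 := hφ.lip x y
      have a3 : 0 ≤ (‖x - y‖ ^ D)⁻¹ := by positivity
      calc _ ≤ (‖x - y‖ ^ (p - 1) * (L * ‖x - y‖)) * (‖x - y‖ ^ D)⁻¹ := by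
            gcongr
        _ = _ := by ring
    · refine le_trans ?_ (le_add_of_nonneg_left t1)
      have key : ∀ v w : EuclideanSpace ℝ (Fin d), ‖v‖ < ρ → 1 ≤ ‖v - w‖ →
          |u v - u w| ^ (p - 1) * b * (‖v - w‖ ^ D)⁻¹ ≤ n w := by
        intro v w hv hvw
        have b1 : |u v - u w| ^ (p - 1) ≤ 2 ^ (p - 1) * (ρ ^ (p - 1) + |u w| ^ (p - 1)) := by
          refine le_trans ?_ (add_rpow_le hρ0 (abs_nonneg (u w)) (by linarith : 0 ≤ p - 1))
          refine Real.rpow_le_rpow (abs_nonneg _) ?_ (by linarith)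
          have := hu.abs_le_norm (x := v) (by linarith)
          exact (abs_sub _ _).trans (by linarith)
        have b2 : (‖v - w‖ ^ D)⁻¹ ≤ (2 + ρ) ^ D * ((1 + ‖w‖) ^ D)⁻¹ := by
          rw [← div_eq_mul_inv, le_div_iff₀ (by positivity), inv_mul_le_iff₀ (by positivity),
            ← Real.mul_rpow (by positivity) (by positivity)]
          refine Real.rpow_le_rpow (by positivity) ?_ hD0
          have : ‖w‖ ≤ ‖v‖ + ‖v - w‖ := by
            have := norm_sub_le v (v - w); simpa using this
          nlinarith
        calc |u v - u w| ^ (p - 1) * b * (‖v - w‖ ^ D)⁻¹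
            ≤ (2 ^ (p - 1) * (ρ ^ (p - 1) + |u w| ^ (p - 1))) * b
                * ((2 + ρ) ^ D * ((1 + ‖w‖) ^ D)⁻¹) := by gcongr
          _ = n w := by simp only [hn]; ring
      have hφb : |φ x - φ y| ≤ b * indicator (ball (0 : EuclideanSpace ℝ (Fin d)) ρ)
            (fun _ => (1 : ℝ)) x
          + b * indicator (ball (0 : EuclideanSpace ℝ (Fin d)) ρ) (fun _ => (1 : ℝ)) y := by
        have aux : ∀ v, |φ v| ≤ b * indicator (ball (0 : EuclideanSpace ℝ (Fin d)) ρ)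
            (fun _ => (1 : ℝ)) v := by
          intro v
          rcases lt_or_ge ‖v‖ ρ with h | h
          · rw [indicator_of_mem (by simpa using h), mul_one]; exact hφ.bdd v
          · rw [hφ.supp v h, abs_zero]; exact mul_nonneg hb (hB0 _ _)
        exact (abs_sub _ _).trans (add_le_add (aux x) (aux y))
      rw [abs_mul, abs_signPow hp2]
      have a0 : 0 ≤ |u x - u y| ^ (p - 1) := by positivity
      have a3 : 0 ≤ (‖x - y‖ ^ D)⁻¹ := by positivity
      have i1 : (|u x - u y| ^ (p - 1) * b * (‖x - y‖ ^ D)⁻¹)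
          * indicator (ball (0 : EuclideanSpace ℝ (Fin d)) ρ) (fun _ => (1 : ℝ)) x
          ≤ indicator (ball (0 : EuclideanSpace ℝ (Fin d)) ρ) (fun _ => (1 : ℝ)) x * n y := by
        rcases lt_or_ge ‖x‖ ρ with h | h
        · rw [indicator_of_mem (by simpa using h), mul_one, one_mul]; exact key x y h h1
        · rw [indicator_of_notMem (by simpa using h)]; simp
      have i2 : (|u x - u y| ^ (p - 1) * b * (‖x - y‖ ^ D)⁻¹)
          * indicator (ball (0 : EuclideanSpace ℝ (Fin d)) ρ) (fun _ => (1 : ℝ)) y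
          ≤ n x * indicator (ball (0 : EuclideanSpace ℝ (Fin d)) ρ) (fun _ => (1 : ℝ)) y := by
        rcases lt_or_ge ‖y‖ ρ with h | h
        · rw [indicator_of_mem (by simpa using h), mul_one, mul_one, abs_sub_comm,
            norm_sub_rev]
          exact key y x h (by rwa [norm_sub_rev])
        · rw [indicator_of_notMem (by simpa using h)]; simp
      calc _ ≤ (|u x - u y| ^ (p - 1) * (b * indicator (ball (0 : EuclideanSpace ℝ (Fin d)) ρ)
            (fun _ => (1 : ℝ)) x
          + b * indicator (ball (0 : EuclideanSpace ℝ (Fin d)) ρ) (fun _ => (1 : ℝ)) y))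
            * (‖x - y‖ ^ D)⁻¹ := by gcongr
        _ ≤ _ := by linarith
end

section
variable {d : ℕ} {s p R β : ℝ} {u : EuclideanSpace ℝ (Fin d) → ℝ}

/-- The integrand of the bilinear form with a general kernel `k`. -/
noncomputable def formInt (p : ℝ) (k : EuclideanSpace ℝ (Fin d) → ℝ)
    (u φ : EuclideanSpace ℝ (Fin d) → ℝ)
    (z : EuclideanSpace ℝ (Fin d) × EuclideanSpace ℝ (Fin d)) : ℝ :=
  k (z.1 - z.2) * (signPow p (u z.1 - u z.2) * (φ z.1 - φ z.2))

/-- The kernel `‖z‖^(-D)`. -/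
noncomputable def fullKer {d : ℕ} (D : ℝ) (z : EuclideanSpace ℝ (Fin d)) : ℝ := (‖z‖ ^ D)⁻¹

lemma fracPLapForm_eq (φ : EuclideanSpace ℝ (Fin d) → ℝ) :
    fracPLapForm s p u φ
      = ∫ z, formInt p (fullKer ((d : ℝ) + s * p)) u φ z ∂(volume.prod volume) := by
  unfold fracPLapForm formInt fullKer signPow
  congr 1; ext z; rw [div_eq_mul_inv]; ring

lemma measurable_fullKer (D : ℝ) : Measurable (fullKer D : EuclideanSpace ℝ (Fin d) → ℝ) := by
  unfold fullKer; fun_prop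

lemma measurable_formInt {k φ : EuclideanSpace ℝ (Fin d) → ℝ} (hk : Measurable k)
    (hu : Measurable u) (hφ : Measurable φ) : Measurable (formInt p k u φ) := by
  unfold formInt
  have := measurable_signPow p
  fun_prop

lemma CoreSol.integrable_formInt (hu : CoreSol s p R β u) (hd : 1 ≤ d) (hs0 : 0 < s) (hs1 : s < 1)
    (hp2 : 2 ≤ p) {L b ρ : ℝ} (hρ0 : 0 ≤ ρ) (hρ : ρ + 1 ≤ R)
    {k φ : EuclideanSpace ℝ (Fin d) → ℝ} (hk : Measurable k)
    (hkb : ∀ z, |k z| ≤ (‖z‖ ^ ((d : ℝ) + s * p))⁻¹) (hφ : LipTest L b ρ φ) :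
    Integrable (formInt p k u φ) (volume.prod volume) := by
  obtain ⟨g, hg, hgb⟩ := hu.exists_dominating hd hs0 hs1 hp2 (hφ.nonneg_L hd) hφ.nonneg_b hρ0 hρ
  refine hg.mono' (measurable_formInt hk hu.meas
    (hφ.continuous hd).measurable).aestronglyMeasurable (ae_of_all _ fun z => ?_)
  refine le_trans ?_ (hgb φ hφ z)
  rw [formInt, Real.norm_eq_abs, abs_mul, mul_comm]
  exact mul_le_mul_of_nonneg_left (hkb _) (abs_nonneg _)

/-- Mollification is an average of translates: it keeps both bounds and enlarges the support by the
radius of the bump. -/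
lemma ContDiffBump.normed_convolution_lipTest (hd : 1 ≤ d) {L b ρ : ℝ}
    {φ : EuclideanSpace ℝ (Fin d) → ℝ}
    (hφ : LipTest L b ρ φ) (f : ContDiffBump (0 : EuclideanSpace ℝ (Fin d)))
    (hf : f.rOut ≤ 1) :
    LipTest L b (ρ + 1) (f.normed volume ⋆[ContinuousLinearMap.lsmul ℝ ℝ, volume] φ) := by
  have hc := hφ.continuous hd
  have hb : ∀ x, Integrable (fun t => f.normed volume t * φ (x - t)) := fun x =>
    ((f.continuous_normed).mul (by fun_prop)).integrable_of_hasCompactSupport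
      (f.hasCompactSupport_normed.mul_right)
  have hn := fun t => f.nonneg_normed (μ := volume) t
  have h1 : ∫ t, f.normed volume t = 1 := f.integral_normed
  have hi : Integrable (f.normed volume) :=
    f.continuous_normed.integrable_of_hasCompactSupport f.hasCompactSupport_normed
  refine ⟨fun x y => ?_, fun x => ?_, fun x hx => ?_⟩
  · rw [convolution_lsmul, convolution_lsmul]
    simp only [smul_eq_mul]
    rw [← integral_sub (hb x) (hb y), ← Real.norm_eq_abs]
    calc _ ≤ ∫ t, f.normed volume t * (L * ‖x - y‖) := by
          refine norm_integral_le_of_norm_le (hi.mul_const _) (ae_of_all _ fun t => ?_)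
          rw [← mul_sub, Real.norm_eq_abs, abs_mul, abs_of_nonneg (hn t)]
          refine mul_le_mul_of_nonneg_left ?_ (hn t)
          simpa using hφ.lip (x - t) (y - t)
      _ = L * ‖x - y‖ := by rw [integral_mul_const, h1, one_mul]
  · rw [convolution_lsmul]
    simp only [smul_eq_mul]
    rw [← Real.norm_eq_abs]
    calc _ ≤ ∫ t, f.normed volume t * b := by
          refine norm_integral_le_of_norm_le (hi.mul_const _) (ae_of_all _ fun t => ?_)
          rw [Real.norm_eq_abs, abs_mul, abs_of_nonneg (hn t)]
          exact mul_le_mul_of_nonneg_left (hφ.bdd _) (hn t)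
      _ = b := by rw [integral_mul_const, h1, one_mul]
  · rw [convolution_lsmul]
    refine integral_eq_zero_of_ae (ae_of_all _ fun t => ?_)
    simp only [smul_eq_mul, Pi.zero_apply]
    by_cases ht : t ∈ ball (0 : EuclideanSpace ℝ (Fin d)) f.rOut
    · rw [hφ.supp, mul_zero]
      have h2 : ‖t‖ < f.rOut := by simpa using ht
      have := norm_sub_norm_le x t
      linarith
    · rw [← f.support_normed_eq (μ := volume)] at ht
      rw [Function.notMem_support.1 ht, zero_mul]

/-- The weak formulation extends to nonnegative Lipschitz test functions. -/
lemma CoreSol.integral_formInt_eq_zero (hu : CoreSol s p R β u) (hd : 1 ≤ d) (hs0 : 0 < s)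
    (hs1 : s < 1) (hp2 : 2 ≤ p) {L b ρ : ℝ} (hρ0 : 0 ≤ ρ) (hρ : ρ + 2 ≤ R)
    {φ : EuclideanSpace ℝ (Fin d) → ℝ} (hφ : LipTest L b ρ φ) (hφ0 : ∀ x, 0 ≤ φ x) :
    ∫ z, formInt p (fullKer ((d : ℝ) + s * p)) u φ z ∂(volume.prod volume) = 0 := by
  have hc := hφ.continuous hd
  let f : ℕ → ContDiffBump (0 : EuclideanSpace ℝ (Fin d)) := fun n =>
    ⟨1 / (n + 1) / 2, 1 / (n + 1), by positivity, half_lt_self (by positivity)⟩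
  have hf1 : ∀ n, (f n).rOut ≤ 1 := fun n => by
    simp only [f]
    rw [div_le_one (by positivity)]
    linarith [(n.cast_nonneg : (0 : ℝ) ≤ n)]
  have hft : Tendsto (fun n => (f n).rOut) atTop (𝓝 0) := tendsto_one_div_add_atTop_nhds_zero_nat
  set φn : ℕ → EuclideanSpace ℝ (Fin d) → ℝ := fun n =>
    (f n).normed volume ⋆[ContinuousLinearMap.lsmul ℝ ℝ, volume] φ with hφn
  have hL : ∀ n, LipTest L b (ρ + 1) (φn n) := fun n =>
    ContDiffBump.normed_convolution_lipTest hd hφ (f n) (hf1 n)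
  have hlim : ∀ x, Tendsto (fun n => φn n x) atTop (𝓝 (φ x)) := fun x =>
    ContDiffBump.convolution_tendsto_right_of_continuous hft hc x
  have hzero : ∀ n, ∫ z, formInt p (fullKer ((d : ℝ) + s * p)) u (φn n) z
      ∂(volume.prod volume) = 0 := by
    intro n
    rw [← fracPLapForm_eq]
    have hts : tsupport (φn n) ⊆ closedBall 0 (ρ + 1) := by
      refine closure_minimal (fun x hx => ?_) isClosed_closedBall
      by_contra h
      have h' : ρ + 1 < ‖x‖ := by simpa using h
      exact hx ((hL n).supp x h'.le)
    refine hu.weak _ ⟨?_, ?_, ?_, fun x => ?_⟩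
    · exact (f n).hasCompactSupport_normed.contDiff_convolution_left _ (f n).contDiff_normed
        hc.locallyIntegrable
    · exact HasCompactSupport.of_support_subset_isCompact (isCompact_closedBall 0 (ρ + 1))
        ((subset_tsupport _).trans hts)
    · exact hts.trans (closedBall_subset_ball (by linarith))
    · simp only [hφn, convolution_lsmul, smul_eq_mul]
      exact integral_nonneg fun t => mul_nonneg ((f n).nonneg_normed t) (hφ0 _)
  obtain ⟨g, hg, hgb⟩ := hu.exists_dominating hd hs0 hs1 hp2 (hφ.nonneg_L hd) hφ.nonneg_b
    (by linarith : 0 ≤ ρ + 1) (by linarith)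
  have := tendsto_integral_of_dominated_convergence (μ := volume.prod volume)
    (F := fun n => formInt p (fullKer ((d : ℝ) + s * p)) u (φn n))
    (f := formInt p (fullKer ((d : ℝ) + s * p)) u φ) g
    (fun n => (measurable_formInt (measurable_fullKer _) hu.meas
      ((hL n).continuous hd).measurable).aestronglyMeasurable) hg
    (fun n => ae_of_all _ fun z => by
      refine le_trans (le_of_eq ?_) (hgb _ (hL n) z)
      rw [formInt, fullKer, Real.norm_eq_abs, abs_mul, mul_comm,
        abs_of_nonneg (a := (_)⁻¹) (by positivity)])
    (ae_of_all _ fun z => by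
      simp only [formInt]
      exact ((((hlim z.1).sub (hlim z.2)).const_mul _).const_mul _))
  simp only [hzero] at this
  exact tendsto_nhds_unique this tendsto_const_nhds
end

/-! ### The long range part of the equation. -/

section
variable {d : ℕ} {s p R β : ℝ} {u : EuclideanSpace ℝ (Fin d) → ℝ}

/-- The mass `∫ max(‖y‖, r)^(-(d+γ)) dy`. -/
noncomputable def farMass (d : ℕ) (γ r : ℝ) : ℝ :=
  ∫ y : EuclideanSpace ℝ (Fin d), ((max ‖y‖ r) ^ ((d : ℝ) + γ))⁻¹

lemma half_one_add_le_max {t r : ℝ} (hr : 1 ≤ r) : (1 + t) / 2 ≤ max t r := by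
  rcases le_total t r with h | h
  · rw [max_eq_right h]; linarith
  · rw [max_eq_left h]; linarith

lemma integrable_max_rpow {γ r : ℝ} (hγ : 0 < γ) (hr : 1 ≤ r) :
    Integrable fun y : EuclideanSpace ℝ (Fin d) => ((max ‖y‖ r) ^ ((d : ℝ) + γ))⁻¹ := by
  have := (integrable_one_add_norm (μ := (volume : Measure (EuclideanSpace ℝ (Fin d))))
    (r := (d : ℝ) + γ) (by simp [hγ])).const_mul (2 ^ ((d : ℝ) + γ))
  refine this.mono' (Measurable.aestronglyMeasurable (by fun_prop)) (ae_of_all _ fun y => ?_)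
  have h0 : 0 < max ‖y‖ r := lt_of_lt_of_le (by linarith) (le_max_right _ _)
  have h1 := half_one_add_le_max (t := ‖y‖) hr
  rw [Real.norm_of_nonneg (by positivity), Real.rpow_neg (by positivity), ← div_eq_mul_inv,
    inv_le_comm₀ (by positivity) (by positivity), inv_div,
    ← Real.div_rpow (by positivity) (by positivity)]
  exact Real.rpow_le_rpow (by positivity) h1 (by positivity)

lemma tendsto_farMass {γ : ℝ} (hγ : 0 < γ) :
    Tendsto (farMass d γ) atTop (𝓝 0) := by
  have h0 : ∫ y : EuclideanSpace ℝ (Fin d), (0 : ℝ) = 0 := by simp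
  rw [← h0]
  unfold farMass
  refine tendsto_integral_filter_of_dominated_convergence
    (fun y : EuclideanSpace ℝ (Fin d) => ((max ‖y‖ 1) ^ ((d : ℝ) + γ))⁻¹) ?_ ?_
    (integrable_max_rpow hγ le_rfl) ?_
  · exact Eventually.of_forall fun r => Measurable.aestronglyMeasurable (by fun_prop)
  · filter_upwards [eventually_ge_atTop 1] with r hr
    refine ae_of_all _ fun y => ?_
    have h1 : 0 < max ‖y‖ 1 := lt_of_lt_of_le one_pos (le_max_right _ _)
    have h2 : max ‖y‖ 1 ≤ max ‖y‖ r := max_le_max le_rfl hr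
    rw [Real.norm_of_nonneg (by have := h1.trans_le h2; positivity)]
    exact inv_anti₀ (by positivity) (Real.rpow_le_rpow h1.le h2 (by positivity))
  · refine ae_of_all _ fun y => ?_
    have h1 : Tendsto (fun r : ℝ => max ‖y‖ r) atTop atTop :=
      tendsto_atTop_mono (fun r => le_max_right _ _) tendsto_id
    exact ((tendsto_rpow_atTop (by positivity : 0 < (d : ℝ) + γ)).comp h1).inv_tendsto_atTop

lemma LipTest.translate {L b ρ h : ℝ} {e : EuclideanSpace ℝ (Fin d)} (he : ‖e‖ = 1) (hh0 : 0 ≤ h)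
    (hh1 : h ≤ 1) {φ : EuclideanSpace ℝ (Fin d) → ℝ} (hφ : LipTest L b ρ φ) :
    LipTest L b (ρ + 1) (fun x => φ (x - h • e)) := by
  refine ⟨fun x y => by simpa using hφ.lip (x - h • e) (y - h • e), fun x => hφ.bdd _,
    fun x hx => hφ.supp _ ?_⟩
  have := norm_sub_norm_le x (h • e)
  rw [norm_smul, he, mul_one, Real.norm_of_nonneg hh0] at this
  linarith

lemma half_max_le {x y : EuclideanSpace ℝ (Fin d)} {ρ r : ℝ} (hx : ‖x‖ ≤ ρ) (hr : 2 * ρ ≤ r)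
    (hr0 : 0 ≤ r) : max ‖y‖ r / 2 ≤ max ‖x - y‖ r := by
  rcases le_total ‖y‖ r with h | h
  · rw [max_eq_right h]; exact le_trans (by linarith) (le_max_right _ _)
  · rw [max_eq_left h]
    have := norm_sub_norm_le y x
    rw [norm_sub_rev] at this
    exact le_trans (by linarith) (le_max_left _ _)

lemma abs_inv_rpow_sub_le {D m M N : ℝ} (hD : 0 < D) (hm : 0 < m) (hM : m ≤ M) (hN : m ≤ N) :
    |(M ^ D)⁻¹ - (N ^ D)⁻¹| ≤ D * (m ^ (D + 1))⁻¹ * |M - N| := by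
  have hd : ∀ t ∈ Ici m, HasDerivWithinAt (fun t : ℝ => t ^ (-D)) (-D * t ^ (-D - 1)) (Ici m) t :=
    fun t ht => (Real.hasDerivAt_rpow_const (Or.inl (hm.trans_le ht).ne')).hasDerivWithinAt
  have := (convex_Ici m).norm_image_sub_le_of_norm_hasDerivWithin_le hd
    (C := D * (m ^ (D + 1))⁻¹) (fun t ht => by
      have ht' : 0 < t := hm.trans_le ht
      rw [norm_mul, norm_neg, Real.norm_of_nonneg hD.le, Real.norm_of_nonneg (by positivity),
        show -D - 1 = -(D + 1) by ring, Real.rpow_neg ht'.le]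
      refine mul_le_mul_of_nonneg_left ?_ hD.le
      exact inv_anti₀ (by positivity) (Real.rpow_le_rpow hm.le ht (by positivity)))
    (x := N) (y := M) hN hM
  rw [Real.norm_eq_abs, Real.norm_eq_abs] at this
  rwa [Real.rpow_neg (hm.le.trans hM), Real.rpow_neg (hm.le.trans hN)] at this

/-- One half of the long range part of the form. -/
noncomputable def farInt (p D r : ℝ) (u φ : EuclideanSpace ℝ (Fin d) → ℝ)
    (z : EuclideanSpace ℝ (Fin d) × EuclideanSpace ℝ (Fin d)) : ℝ :=
  φ z.1 * (farKer D r (z.1 - z.2) * signPow p (u z.1 - u z.2))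

lemma CoreSol.integrable_farInt (hu : CoreSol s p R β u) (hd : 1 ≤ d) (hs0 : 0 < s)
    (hp2 : 2 ≤ p) {L b ρ r : ℝ} (hρ0 : 0 ≤ ρ) (hρ : ρ ≤ R) (hr : 2 * ρ ≤ r) (hr1 : 1 ≤ r)
    {φ : EuclideanSpace ℝ (Fin d) → ℝ} (hφ : LipTest L b ρ φ) :
    Integrable (farInt p ((d : ℝ) + s * p) r u φ) (volume.prod volume) := by
  set D : ℝ := (d : ℝ) + s * p with hDdef
  have hsp : 0 < s * p := mul_pos hs0 (by linarith)
  have hD0 : 0 ≤ D := by positivity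
  have hφm := (hφ.continuous hd).measurable
  have h1 := (integrable_one_add_norm_rpow_neg (d := d) hsp).const_mul
      (2 ^ (p - 1) * ρ ^ (p - 1) * 4 ^ D)
  have h2 := hu.integrable_tailspace.const_mul (2 ^ (p - 1) * 4 ^ D)
  have hφi : Integrable φ := (hφ.continuous hd).integrable_of_hasCompactSupport
    (HasCompactSupport.intro (isCompact_closedBall 0 ρ) fun x hx => hφ.supp x (by
      have : ρ < ‖x‖ := by simpa using hx
      exact this.le))
  refine (hφi.norm.mul_prod (h1.add h2)).mono' ?_ (ae_of_all _ ?_)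
  · have := measurable_signPow p
    have hm := hu.meas
    have := measurable_farKer (d := d) (D := D) (r := r)
    unfold farInt
    exact Measurable.aestronglyMeasurable (by fun_prop)
  · rintro ⟨x, y⟩
    simp only [farInt, Pi.add_apply, ← hDdef]
    rw [norm_mul]
    rcases lt_or_ge ‖x‖ ρ with hx | hx
    swap
    · rw [hφ.supp x hx]; simp
    refine mul_le_mul_of_nonneg_left ?_ (norm_nonneg _)
    have k0 : 0 ≤ farKer D r (x - y) := farKer_nonneg _ (by linarith)
    rw [norm_mul, Real.norm_of_nonneg k0, Real.norm_eq_abs, abs_signPow hp2]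
    have b1 : |u x - u y| ^ (p - 1) ≤ 2 ^ (p - 1) * (ρ ^ (p - 1) + |u y| ^ (p - 1)) := by
      refine le_trans ?_ (add_rpow_le hρ0 (abs_nonneg (u y)) (by linarith : 0 ≤ p - 1))
      refine Real.rpow_le_rpow (abs_nonneg _) ?_ (by linarith)
      have := hu.abs_le_norm (x := x) (by linarith)
      exact (abs_sub _ _).trans (by linarith)
    have b2 : farKer D r (x - y) ≤ 4 ^ D * ((1 + ‖y‖) ^ D)⁻¹ := by
      have a1 := half_max_le (y := y) hx.le hr (by linarith)
      have a2 := half_one_add_le_max (t := ‖y‖) hr1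
      have a3 : 0 < max ‖x - y‖ r := lt_of_lt_of_le (by linarith) (le_max_right _ _)
      unfold farKer
      rw [← div_eq_mul_inv, inv_le_comm₀ (by positivity) (by positivity), inv_div,
        ← Real.div_rpow (by positivity) (by positivity)]
      exact Real.rpow_le_rpow (by positivity) (by linarith) hD0
    calc farKer D r (x - y) * |u x - u y| ^ (p - 1)
        ≤ (4 ^ D * ((1 + ‖y‖) ^ D)⁻¹) * (2 ^ (p - 1) * (ρ ^ (p - 1) + |u y| ^ (p - 1))) := by
          gcongr
      _ = _ := by ring

/-- Pointwise bound for the increment of the long range part. -/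
lemma CoreSol.abs_farInt_sub_le (hu : CoreSol s p R β u) (hs0 : 0 < s)
    (hp2 : 2 ≤ p) {ρ r h : ℝ} (hρ0 : 0 ≤ ρ) (hρ : ρ + 1 < R) (hr : 2 * (ρ + 1) ≤ r)
    {e x y : EuclideanSpace ℝ (Fin d)} (he : ‖e‖ = 1) (hh0 : 0 ≤ h) (hh1 : h ≤ 1)
    (hx : ‖x‖ ≤ ρ) :
    |farKer ((d : ℝ) + s * p) r (x + h • e - y) * signPow p (u (x + h • e) - u y)
      - farKer ((d : ℝ) + s * p) r (x - y) * signPow p (u x - u y)|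
    ≤ h * (((p - 1) * 2 ^ ((d : ℝ) + s * p)
        + ((d : ℝ) + s * p) * 2 ^ ((d : ℝ) + s * p + 1)) *
        ((max ‖y‖ r + |u y|) ^ (p - 1) * ((max ‖y‖ r) ^ ((d : ℝ) + s * p + 1))⁻¹)) := by
  have hsp : 0 < s * p := mul_pos hs0 (by linarith)
  set D : ℝ := (d : ℝ) + s * p with hDdef
  have hD0 : 0 < D := by positivity
  set m : ℝ := max ‖y‖ r with hm
  have hrm : r ≤ m := le_max_right _ _
  have hm0 : 0 < m := by linarith
  set q : ℝ := m + |u y| with hq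
  have hmq : m ≤ q := by have := abs_nonneg (u y); linarith
  have hhe : ‖h • e‖ = h := by rw [norm_smul, he, mul_one, Real.norm_of_nonneg hh0]
  have hx' : ‖x + h • e‖ ≤ ρ + 1 := (norm_add_le _ _).trans (by rw [hhe]; linarith)
  have ux := hu.abs_le_norm (x := x) (by linarith)
  have ux' := hu.abs_le_norm (x := x + h • e) (by linarith)
  have c1 : |u x - u y| ≤ q := (abs_sub _ _).trans (by linarith)
  have c2 : |u (x + h • e) - u y| ≤ q := (abs_sub _ _).trans (by linarith)
  have c3 : |u (x + h • e) - u y - (u x - u y)| ≤ h := by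
    have := hu.lip (x + h • e) (by simpa using hx'.trans_lt hρ) x
      (by simpa using hx.trans_lt (by linarith))
    rw [add_sub_cancel_left, hhe] at this
    rwa [sub_sub_sub_cancel_right]
  have j1 := abs_signPow_sub_le hp2 c1 c2
  have j2 : |signPow p (u (x + h • e) - u y)| ≤ q ^ (p - 1) := by
    rw [abs_signPow hp2]; exact Real.rpow_le_rpow (abs_nonneg _) c2 (by linarith)
  have m1 : m / 2 ≤ max ‖x - y‖ r := half_max_le hx (by linarith) (by linarith)
  have m2 : m / 2 ≤ max ‖x + h • e - y‖ r := half_max_le hx' (by linarith) (by linarith)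
  have k1 : |farKer D r (x + h • e - y) - farKer D r (x - y)| ≤ D * ((m / 2) ^ (D + 1))⁻¹ * h := by
    unfold farKer
    refine (abs_inv_rpow_sub_le hD0 (by linarith) m2 m1).trans ?_
    refine mul_le_mul_of_nonneg_left ?_ (by positivity)
    refine (abs_max_sub_max_le_abs _ _ _).trans ((abs_norm_sub_norm_le _ _).trans ?_)
    rw [show x + h • e - y - (x - y) = h • e by abel, hhe]
  have k2 : |farKer D r (x - y)| ≤ ((m / 2) ^ D)⁻¹ := by
    rw [abs_of_nonneg (farKer_nonneg _ (by linarith))]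
    exact inv_anti₀ (by positivity) (Real.rpow_le_rpow (by positivity) m1 hD0.le)
  have e1 : ((m / 2) ^ (D + 1))⁻¹ = 2 ^ (D + 1) * (m ^ (D + 1))⁻¹ := by
    rw [Real.div_rpow hm0.le (by norm_num), inv_div, div_eq_mul_inv]
  have e2 : ((m / 2) ^ D)⁻¹ = 2 ^ D * (m * (m ^ (D + 1))⁻¹) := by
    rw [Real.div_rpow hm0.le (by norm_num), inv_div, div_eq_mul_inv, Real.rpow_add_one hm0.ne']
    field_simp
  have e3 : q ^ (p - 1) = q ^ (p - 2) * q := by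
    rw [← Real.rpow_add_one (by linarith)]; congr 1; ring
  have hq0 : 0 ≤ q ^ (p - 2) := Real.rpow_nonneg (by linarith) _
  have split : farKer D r (x + h • e - y) * signPow p (u (x + h • e) - u y)
      - farKer D r (x - y) * signPow p (u x - u y)
      = (farKer D r (x + h • e - y) - farKer D r (x - y)) * signPow p (u (x + h • e) - u y)
        + farKer D r (x - y) * (signPow p (u (x + h • e) - u y) - signPow p (u x - u y)) := by ring
  rw [split]
  refine (abs_add_le _ _).trans ?_
  rw [abs_mul, abs_mul]
  have f1 : |farKer D r (x + h • e - y) - farKer D r (x - y)| * |signPow p (u (x + h • e) - u y)|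
      ≤ (D * ((m / 2) ^ (D + 1))⁻¹ * h) * q ^ (p - 1) := by gcongr
  have f2 : |farKer D r (x - y)| * |signPow p (u (x + h • e) - u y) - signPow p (u x - u y)|
      ≤ ((m / 2) ^ D)⁻¹ * ((p - 1) * q ^ (p - 2) * h) := by
    refine mul_le_mul k2 (j1.trans ?_) (abs_nonneg _) (by positivity)
    exact mul_le_mul_of_nonneg_left c3 (mul_nonneg (by linarith) hq0)
  have f3 : ((m / 2) ^ D)⁻¹ * ((p - 1) * q ^ (p - 2) * h)
      ≤ (2 ^ D * (m ^ (D + 1))⁻¹) * ((p - 1) * q ^ (p - 1) * h) := by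
    rw [e2, e3]
    have : q ^ (p - 2) * m ≤ q ^ (p - 2) * q := mul_le_mul_of_nonneg_left hmq hq0
    have g0 : 0 ≤ 2 ^ D * (m ^ (D + 1))⁻¹ * (p - 1) * h :=
      mul_nonneg (mul_nonneg (by positivity) (by linarith)) hh0
    nlinarith [mul_le_mul_of_nonneg_left this g0]
  rw [e1] at f1
  calc _ ≤ _ := add_le_add f1 (f2.trans f3)
    _ = _ := by ring

/-- Inside `ball 0 R` one has `|u y| ≤ ‖y‖`, so the integrand is at most a multiple of `max(‖y‖,
r)^(-(d+γ))`, whose exponent is `D + 1 - (p - 1)`. Outside, the tail hypothesis controls the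
contribution of `u`. -/
lemma CoreSol.farWeight (hu : CoreSol s p R β u) (hs0 : 0 < s) (hp2 : 2 ≤ p) (hβ : 0 ≤ β)
    (hγ : 0 < 2 - p * (1 - s)) {r : ℝ} (hr : 1 ≤ r) (hrR : r ≤ R) :
    Integrable (fun y => (max ‖y‖ r + |u y|) ^ (p - 1)
      * ((max ‖y‖ r) ^ ((d : ℝ) + s * p + 1))⁻¹) ∧
    ∫ y, (max ‖y‖ r + |u y|) ^ (p - 1) * ((max ‖y‖ r) ^ ((d : ℝ) + s * p + 1))⁻¹
      ≤ 2 ^ p * (farMass d (2 - p * (1 - s)) r + β) := by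
  have hsp : 0 < s * p := mul_pos hs0 (by linarith)
  set D : ℝ := (d : ℝ) + s * p with hDdef
  have hum := hu.meas
  set t : EuclideanSpace ℝ (Fin d) → ℝ :=
    indicator (ball 0 R)ᶜ (fun y => |u y| ^ (p - 1) / ‖y‖ ^ (D + 1)) with ht
  have hti0 : IntegrableOn (fun y => |u y| ^ (p - 1) / ‖y‖ ^ (D + 1)) (ball 0 R)ᶜ := by
    refine ⟨Measurable.aestronglyMeasurable (by fun_prop), ?_⟩
    rw [hasFiniteIntegral_iff_ofReal (ae_of_all _ fun y => by positivity)]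
    exact hu.tail.trans_lt ENNReal.ofReal_lt_top
  have hti : Integrable t := by
    rwa [ht, integrable_indicator_iff measurableSet_ball.compl]
  have htv : ∫ y, t y ≤ β := by
    rw [ht, integral_indicator measurableSet_ball.compl,
      integral_eq_lintegral_of_nonneg_ae (ae_of_all _ fun y => by positivity)
        hti0.aestronglyMeasurable]
    exact ENNReal.toReal_le_of_le_ofReal hβ hu.tail
  have hmi := integrable_max_rpow (d := d) hγ hr
  have hpt : ∀ y, (max ‖y‖ r + |u y|) ^ (p - 1) * ((max ‖y‖ r) ^ (D + 1))⁻¹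
      ≤ 2 ^ p * (((max ‖y‖ r) ^ ((d : ℝ) + (2 - p * (1 - s))))⁻¹ + t y) := by
    intro y
    set m : ℝ := max ‖y‖ r with hm
    have hrm : r ≤ m := le_max_right _ _
    have hm0 : 0 < m := by linarith
    have e1 : (m ^ ((d : ℝ) + (2 - p * (1 - s))))⁻¹ = m ^ (p - 1) * (m ^ (D + 1))⁻¹ := by
      rw [← Real.rpow_neg hm0.le, ← Real.rpow_neg hm0.le, ← Real.rpow_add hm0, hDdef]
      congr 1; ring
    have e2 : (2 : ℝ) ^ p = 2 ^ (p - 1) * 2 := by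
      rw [← Real.rpow_add_one (by norm_num)]; congr 1; ring
    rw [e1, e2]
    have h1 := add_rpow_le hm0.le (abs_nonneg (u y)) (by linarith : 0 ≤ p - 1)
    have hmm : 0 ≤ m ^ (p - 1) := by positivity
    have hA : 0 ≤ (m ^ (D + 1))⁻¹ := by positivity
    rcases lt_or_ge ‖y‖ R with hy | hy
    · have h2 : |u y| ^ (p - 1) ≤ m ^ (p - 1) :=
        Real.rpow_le_rpow (abs_nonneg _) ((hu.abs_le_norm hy).trans (le_max_left _ _)) (by linarith)
      have t0 : 0 ≤ t y := indicator_nonneg (fun y _ => by positivity) y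
      calc _ ≤ (2 ^ (p - 1) * (m ^ (p - 1) + m ^ (p - 1))) * (m ^ (D + 1))⁻¹ := by
            refine mul_le_mul_of_nonneg_right (h1.trans ?_) hA
            gcongr
        _ = 2 ^ (p - 1) * 2 * (m ^ (p - 1) * (m ^ (D + 1))⁻¹ + 0) := by ring
        _ ≤ _ := by gcongr
    · have hmy : m = ‖y‖ := max_eq_left (hrR.trans hy)
      have ty : t y = |u y| ^ (p - 1) * (m ^ (D + 1))⁻¹ := by
        rw [ht, indicator_of_mem (by simpa using hy), hmy, div_eq_mul_inv]
      rw [ty, ← add_mul, ← mul_assoc]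
      refine mul_le_mul_of_nonneg_right ?_ hA
      refine h1.trans ?_
      have : 0 ≤ 2 ^ (p - 1) * (m ^ (p - 1) + |u y| ^ (p - 1)) := by positivity
      linarith
  have hbig := (hmi.add hti).const_mul (2 ^ p)
  have hint : Integrable (fun y => (max ‖y‖ r + |u y|) ^ (p - 1)
      * ((max ‖y‖ r) ^ (D + 1))⁻¹) := by
    refine hbig.mono' (Measurable.aestronglyMeasurable (by fun_prop)) (ae_of_all _ fun y => ?_)
    have : 0 < max ‖y‖ r := lt_of_lt_of_le (by linarith) (le_max_right _ _)
    rw [Real.norm_of_nonneg (by positivity)]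
    exact hpt y
  refine ⟨hint, ?_⟩
  calc _ ≤ ∫ y, 2 ^ p * (((max ‖y‖ r) ^ ((d : ℝ) + (2 - p * (1 - s))))⁻¹ + t y) :=
        integral_mono hint hbig hpt
    _ = 2 ^ p * (farMass d (2 - p * (1 - s)) r + ∫ y, t y) := by
        rw [integral_const_mul, integral_add hmi hti]; rfl
    _ ≤ _ := by gcongr

end

section
variable {d : ℕ} {s p R β : ℝ} {u : EuclideanSpace ℝ (Fin d) → ℝ}

/-- The short range part of the form for the increment of `u`. -/
noncomputable def nearIncr (p D r h : ℝ) (e : EuclideanSpace ℝ (Fin d))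
    (u φ : EuclideanSpace ℝ (Fin d) → ℝ)
    (z : EuclideanSpace ℝ (Fin d) × EuclideanSpace ℝ (Fin d)) : ℝ :=
  nearKer D r (z.1 - z.2) *
    ((signPow p (u (z.1 + h • e) - u (z.2 + h • e)) - signPow p (u z.1 - u z.2))
      * (φ z.1 - φ z.2))

/-- Constant in the estimate of the long range part. -/
noncomputable def farConst (d : ℕ) (s p : ℝ) : ℝ :=
  2 * (((p - 1) * 2 ^ ((d : ℝ) + s * p)
    + ((d : ℝ) + s * p) * 2 ^ ((d : ℝ) + s * p + 1)) * 2 ^ p)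

lemma integral_shift_prod (F : EuclideanSpace ℝ (Fin d) × EuclideanSpace ℝ (Fin d) → ℝ)
    (a b : EuclideanSpace ℝ (Fin d)) :
    ∫ z, F (z.1 + a, z.2 + b) ∂((volume : Measure (EuclideanSpace ℝ (Fin d))).prod volume)
      = ∫ z, F z ∂(volume.prod volume) :=
  integral_add_right_eq_self
    (μ := (volume : Measure (EuclideanSpace ℝ (Fin d))).prod volume) F (a, b)

lemma integrable_shift_prod {F : EuclideanSpace ℝ (Fin d) × EuclideanSpace ℝ (Fin d) → ℝ}
    (a b : EuclideanSpace ℝ (Fin d))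
    (hF : Integrable F ((volume : Measure (EuclideanSpace ℝ (Fin d))).prod volume)) :
    Integrable (fun z => F (z.1 + a, z.2 + b))
      ((volume : Measure (EuclideanSpace ℝ (Fin d))).prod volume) :=
  hF.comp_add_right (a, b)

lemma LipTest.integrable {L b ρ : ℝ} {φ : EuclideanSpace ℝ (Fin d) → ℝ} (hd : 1 ≤ d)
    (hφ : LipTest L b ρ φ) : Integrable φ :=
  (hφ.continuous hd).integrable_of_hasCompactSupport
    (HasCompactSupport.intro (isCompact_closedBall 0 ρ) fun x hx => hφ.supp x (by
      have : ρ < ‖x‖ := by simpa using hx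
      exact this.le))

/-- By antisymmetry the two halves of `φ x - φ y` contribute equally. They can be separated because
the long range kernel has no singularity, so each half is integrable. -/
lemma integral_farInt_symm {D r : ℝ} {v φ : EuclideanSpace ℝ (Fin d) → ℝ}
    (hi : Integrable (farInt p D r v φ)
      ((volume : Measure (EuclideanSpace ℝ (Fin d))).prod volume)) :
    Integrable (formInt p (farKer D r) v φ)
      ((volume : Measure (EuclideanSpace ℝ (Fin d))).prod volume) ∧
    ∫ z, formInt p (farKer D r) v φ z ∂(volume.prod volume)
      = 2 * ∫ z, farInt p D r v φ z ∂(volume.prod volume) := by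
  have e : formInt p (farKer D r) v φ = fun z => farInt p D r v φ z + farInt p D r v φ z.swap := by
    ext z
    simp only [formInt, farInt, Prod.fst_swap, Prod.snd_swap]
    rw [signPow_sub_comm p (v z.2) (v z.1), ← farKer_neg (z.2 - z.1), neg_sub]
    ring
  have hs : Integrable (fun z => farInt p D r v φ z.swap)
      ((volume : Measure (EuclideanSpace ℝ (Fin d))).prod volume) := hi.swap
  rw [e]
  refine ⟨hi.add hs, ?_⟩
  rw [integral_add hi hs, integral_prod_swap (farInt p D r v φ)]
  ring

/-- The equation is tested with `φ` and with its translate, which amounts to testing the equation of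
`u (· + h • e)` with `φ`. Subtracting, the short range increment equals minus the long range one.
The long range kernel is Lipschitz, which gives the factor `h`. The Lipschitz constant of `φ` does
not enter the bound. -/
lemma CoreSol.near_le (hu : CoreSol s p R β u) (hd : 1 ≤ d) (hs0 : 0 < s) (hs1 : s < 1)
    (hp2 : 2 ≤ p) (hβ : 0 ≤ β) (hγ : 0 < 2 - p * (1 - s))
    {L b ρ r h : ℝ} (hρ0 : 0 ≤ ρ) (hρ : ρ + 3 ≤ R) (hr : 2 * (ρ + 1) ≤ r) (hrR : r ≤ R)
    {e : EuclideanSpace ℝ (Fin d)} (he : ‖e‖ = 1) (hh0 : 0 ≤ h) (hh1 : h ≤ 1)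
    {φ : EuclideanSpace ℝ (Fin d) → ℝ} (hφ : LipTest L b ρ φ) (hφ0 : ∀ x, 0 ≤ φ x) :
    Integrable (nearIncr p ((d : ℝ) + s * p) r h e u φ) (volume.prod volume) ∧
    |∫ z, nearIncr p ((d : ℝ) + s * p) r h e u φ z ∂(volume.prod volume)|
      ≤ h * (farConst d s p * (farMass d (2 - p * (1 - s)) r + β)) * ∫ x, φ x := by
  have hsp : 0 < s * p := mul_pos hs0 (by linarith)
  set D : ℝ := (d : ℝ) + s * p with hDdef
  have hD0 : 0 < D := by positivity
  have hr0 : 0 < r := by linarith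
  set φ' : EuclideanSpace ℝ (Fin d) → ℝ := fun x => φ (x - h • e) with hφ'
  have hφ't : LipTest L b (ρ + 1) φ' := hφ.translate he hh0 hh1
  set v : EuclideanSpace ℝ (Fin d) → ℝ := fun x => u (x + h • e) with hv
  have hkn : ∀ z : EuclideanSpace ℝ (Fin d), |nearKer D r z| ≤ (‖z‖ ^ D)⁻¹ := fun z => by
    rw [abs_of_nonneg (nearKer_nonneg z hD0.le hr0)]; exact nearKer_le z hr0
  have nshift : ∀ k : EuclideanSpace ℝ (Fin d) → ℝ, formInt p k v φ
      = fun z => formInt p k u φ' (z.1 + h • e, z.2 + h • e) := by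
    intro k; ext z; simp [formInt, hφ', hv]
  have fshift : farInt p D r v φ
      = fun z => farInt p D r u φ' (z.1 + h • e, z.2 + h • e) := by
    ext z; simp [farInt, hφ', hv]
  have n1 := hu.integrable_formInt hd hs0 hs1 hp2 hρ0 (by linarith) (measurable_nearKer (r := r))
    hkn hφ
  have n2 : Integrable (formInt p (nearKer D r) v φ) (volume.prod volume) := by
    rw [nshift]
    exact integrable_shift_prod _ _ (hu.integrable_formInt hd hs0 hs1 hp2 (by linarith)
      (by linarith) (measurable_nearKer (r := r)) hkn hφ't)
  have t1 := hu.integrable_farInt hd hs0 hp2 hρ0 (by linarith : ρ ≤ R) (by linarith)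
    (by linarith : 1 ≤ r) hφ
  have t2 : Integrable (farInt p D r v φ) (volume.prod volume) := by
    rw [fshift]
    exact integrable_shift_prod _ _ (hu.integrable_farInt hd hs0 hp2 (by linarith)
      (by linarith) (by linarith) (by linarith) hφ't)
  have full : ∀ w : EuclideanSpace ℝ (Fin d) → ℝ, formInt p (fullKer D) w φ
      = fun z => formInt p (nearKer D r) w φ z + formInt p (farKer D r) w φ z := by
    intro w; ext z
    simp only [formInt, fullKer]
    rcases eq_or_ne z.1 z.2 with hz | hz
    · simp [hz]
    · rw [← nearKer_add_farKer (D := D) (z.1 - z.2) hr0 (sub_ne_zero.2 hz)]; ring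
  obtain ⟨f1, f1'⟩ := integral_farInt_symm t1
  obtain ⟨f2, f2'⟩ := integral_farInt_symm t2
  have z1 := hu.integral_formInt_eq_zero hd hs0 hs1 hp2 hρ0 (by linarith) hφ hφ0
  have z2 : ∫ z, formInt p (fullKer D) v φ z ∂(volume.prod volume) = 0 := by
    rw [nshift, integral_shift_prod (formInt p (fullKer D) u φ')]
    exact hu.integral_formInt_eq_zero hd hs0 hs1 hp2 (by linarith) (by linarith) hφ't
      fun x => hφ0 _
  rw [full, integral_add n1 f1, f1'] at z1
  rw [full, integral_add n2 f2, f2'] at z2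
  have eN : nearIncr p D r h e u φ
      = fun z => formInt p (nearKer D r) v φ z - formInt p (nearKer D r) u φ z := by
    ext z; simp only [nearIncr, formInt, hv]; ring
  refine ⟨by rw [eN]; exact n2.sub n1, ?_⟩
  rw [eN, integral_sub n2 n1]
  -- Only the second variable is translated back. Both long range integrands then contain the same
  -- value `u z.2`, so no regularity of `u` outside the ball is needed.
  set G : EuclideanSpace ℝ (Fin d) × EuclideanSpace ℝ (Fin d) → ℝ := fun z =>
    φ z.1 * (farKer D r (z.1 + h • e - z.2) * signPow p (u (z.1 + h • e) - u z.2)) with hG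
  have Gs : farInt p D r v φ = fun z => G (z.1 + 0, z.2 + h • e) := by
    ext z; simp [farInt, hG, hv]
  have iG : ∫ z, farInt p D r v φ z ∂(volume.prod volume) = ∫ z, G z ∂(volume.prod volume) := by
    rw [Gs, integral_shift_prod G]
  have Gi : Integrable G (volume.prod volume) := by
    have : G = fun z => (farInt p D r v φ) (z.1 + 0, z.2 + -(h • e)) := by
      rw [Gs]; ext z; simp
    rw [this]; exact integrable_shift_prod _ _ t2
  obtain ⟨w1, w2⟩ := hu.farWeight hs0 hp2 hβ hγ (by linarith : 1 ≤ r) hrR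
  set C : ℝ := (p - 1) * 2 ^ D + D * 2 ^ (D + 1) with hC
  have hC0 : 0 ≤ C := by
    have : 0 ≤ p - 1 := by linarith
    positivity
  have bound : |∫ z, (G z - farInt p D r u φ z) ∂(volume.prod volume)|
      ≤ ∫ z : EuclideanSpace ℝ (Fin d) × EuclideanSpace ℝ (Fin d), φ z.1 *
        (h * (C * ((max ‖z.2‖ r + |u z.2|) ^ (p - 1)
          * ((max ‖z.2‖ r) ^ (D + 1))⁻¹))) ∂(volume.prod volume) := by
    rw [← Real.norm_eq_abs]
    refine norm_integral_le_of_norm_le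
      ((hφ.integrable hd).mul_prod ((w1.const_mul C).const_mul h)) (ae_of_all _ ?_)
    rintro ⟨x, y⟩
    simp only [hG, farInt]
    rw [← mul_sub, Real.norm_eq_abs, abs_mul, abs_of_nonneg (hφ0 x)]
    rcases lt_or_ge ‖x‖ ρ with hx | hx
    · exact mul_le_mul_of_nonneg_left
        (hu.abs_farInt_sub_le hs0 hp2 hρ0 (by linarith) hr he hh0 hh1 hx.le) (hφ0 x)
    · rw [hφ.supp x hx]; simp
  rw [integral_prod_mul φ fun y => h * (C * ((max ‖y‖ r + |u y|) ^ (p - 1)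
      * ((max ‖y‖ r) ^ (D + 1))⁻¹)),
    integral_const_mul, integral_const_mul, integral_sub Gi t1, ← iG] at bound
  have hI : 0 ≤ ∫ x, φ x := integral_nonneg hφ0
  have e3 : (∫ z, formInt p (nearKer D r) v φ z ∂(volume.prod volume))
      - ∫ z, formInt p (nearKer D r) u φ z ∂(volume.prod volume)
      = -(2 * ((∫ z, farInt p D r v φ z ∂(volume.prod volume))
        - ∫ z, farInt p D r u φ z ∂(volume.prod volume))) := by
    linarith
  rw [e3, abs_neg, abs_mul, abs_two]
  calc _ ≤ 2 * ((∫ x, φ x) * (h * (C * (2 ^ p * (farMass d (2 - p * (1 - s)) r + β))))) := by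
        gcongr
        refine bound.trans ?_
        gcongr
    _ = _ := by rw [farConst, ← hDdef, ← hC]; ring
end

/-! ### The defect, the cone barrier and the test function. -/

section
variable {d : ℕ} {s p R β : ℝ} {u : EuclideanSpace ℝ (Fin d) → ℝ}

/-- The defect `1 - (u(x + h e) - u(x)) / h` of the difference quotient from the maximal slope. -/
noncomputable def defect (h : ℝ) (e : EuclideanSpace ℝ (Fin d)) (u : EuclideanSpace ℝ (Fin d) → ℝ)
    (x : EuclideanSpace ℝ (Fin d)) : ℝ := 1 - (u (x + h • e) - u x) / h

/-- The cone of height `κ` over the unit ball around `x₀`. -/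
noncomputable def cone (κ : ℝ) (x₀ x : EuclideanSpace ℝ (Fin d)) : ℝ := κ * max (1 - ‖x - x₀‖) 0

/-- The set where the defect lies below the cone lowered by `l`. -/
def belowCone (κ l h : ℝ) (x₀ e : EuclideanSpace ℝ (Fin d)) (u : EuclideanSpace ℝ (Fin d) → ℝ) :
    Set (EuclideanSpace ℝ (Fin d)) :=
  {x | x ∈ ball x₀ 1 ∧ defect h e u x < cone κ x₀ x - l}

/-- The test function `(cone - l - defect)₊`. -/
noncomputable def coneTest (κ l h : ℝ) (x₀ e : EuclideanSpace ℝ (Fin d))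
    (u : EuclideanSpace ℝ (Fin d) → ℝ) : EuclideanSpace ℝ (Fin d) → ℝ :=
  indicator (ball x₀ 1) fun x => max (cone κ x₀ x - l - defect h e u x) 0

/-- The kernel of the linearized operator. -/
noncomputable def pairKer (p D r h : ℝ) (e : EuclideanSpace ℝ (Fin d))
    (u : EuclideanSpace ℝ (Fin d) → ℝ) (x y : EuclideanSpace ℝ (Fin d)) : ℝ :=
  nearKer D r (x - y) * signPowSlope p (u x - u y) (u (x + h • e) - u (y + h • e))

/-- The weighted mass of `(defect - cone + l)₊` seen from `y`. -/
noncomputable def crossMass (p D r κ l h : ℝ) (x₀ e : EuclideanSpace ℝ (Fin d))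
    (u : EuclideanSpace ℝ (Fin d) → ℝ) (y : EuclideanSpace ℝ (Fin d)) : ENNReal :=
  ∫⁻ x, ENNReal.ofReal (pairKer p D r h e u x y * max (defect h e u x - cone κ x₀ x + l) 0)

lemma signPowSlope_neg (p a b : ℝ) : signPowSlope p (-a) (-b) = signPowSlope p a b := by
  unfold signPowSlope
  by_cases h : a = b
  · simp [h]
  · rw [if_neg h, if_neg (by simpa using h), signPow_neg, signPow_neg, ← neg_div_neg_eq]
    congr 1 <;> ring

lemma pairKer_symm (p D r h : ℝ) (e x y : EuclideanSpace ℝ (Fin d)) :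
    pairKer p D r h e u x y = pairKer p D r h e u y x := by
  unfold pairKer
  rw [← nearKer_neg, neg_sub, ← signPowSlope_neg, neg_sub, neg_sub]

lemma pairKer_nonneg (hp2 : 2 ≤ p) {D r h : ℝ} (hD : 0 ≤ D) (hr : 0 < r)
    (e x y : EuclideanSpace ℝ (Fin d)) : 0 ≤ pairKer p D r h e u x y :=
  mul_nonneg (nearKer_nonneg _ hD hr) (signPowSlope_nonneg hp2 _ _)

lemma measurable_defect (hu : Measurable u) (h : ℝ) (e : EuclideanSpace ℝ (Fin d)) :
    Measurable (defect h e u) := by unfold defect; fun_prop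

lemma continuous_cone (κ : ℝ) (x₀ : EuclideanSpace ℝ (Fin d)) : Continuous (cone κ x₀) := by
  unfold cone; fun_prop

lemma measurableSet_belowCone (hu : Measurable u) (κ l h : ℝ) (x₀ e : EuclideanSpace ℝ (Fin d)) :
    MeasurableSet (belowCone κ l h x₀ e u) :=
  measurableSet_ball.inter (measurableSet_lt (measurable_defect hu h e)
    ((continuous_cone κ x₀).measurable.sub_const l))

lemma measurable_pairKer (hu : Measurable u) (p D r h : ℝ) (e : EuclideanSpace ℝ (Fin d)) :
    Measurable fun z : EuclideanSpace ℝ (Fin d) × EuclideanSpace ℝ (Fin d) =>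
      pairKer p D r h e u z.1 z.2 := by
  unfold pairKer
  have h1 := measurable_nearKer (d := d) (D := D) (r := r)
  refine Measurable.mul (by fun_prop) ?_
  exact (measurable_signPowSlope p).comp (Measurable.prodMk (by fun_prop) (by fun_prop))

lemma cone_le {κ : ℝ} (hκ : 0 ≤ κ) (x₀ x : EuclideanSpace ℝ (Fin d)) : cone κ x₀ x ≤ κ :=
  mul_le_of_le_one_right hκ (max_le (by linarith [norm_nonneg (x - x₀)]) zero_le_one)

lemma cone_eq_zero {κ : ℝ} {x₀ x : EuclideanSpace ℝ (Fin d)} (hx : x ∉ ball x₀ 1) :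
    cone κ x₀ x = 0 := by
  have : 1 ≤ ‖x - x₀‖ := by simpa [dist_eq_norm] using hx
  rw [cone, max_eq_right (by linarith), mul_zero]

lemma abs_cone_sub_le {κ : ℝ} (hκ : 0 ≤ κ) (x₀ x y : EuclideanSpace ℝ (Fin d)) :
    |cone κ x₀ x - cone κ x₀ y| ≤ κ * min 1 ‖x - y‖ := by
  unfold cone
  rw [← mul_sub, abs_mul, abs_of_nonneg hκ]
  refine mul_le_mul_of_nonneg_left (le_min ?_ ?_) hκ
  · have a1 : max (1 - ‖x - x₀‖) 0 ≤ 1 := max_le (by linarith [norm_nonneg (x - x₀)]) zero_le_one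
    have a2 : max (1 - ‖y - x₀‖) 0 ≤ 1 := max_le (by linarith [norm_nonneg (y - x₀)]) zero_le_one
    have a3 := le_max_right (1 - ‖x - x₀‖) 0
    have a4 := le_max_right (1 - ‖y - x₀‖) 0
    rw [abs_le]; constructor <;> linarith
  · refine (abs_max_sub_max_le_abs _ _ _).trans ?_
    rw [sub_sub_sub_cancel_left, abs_sub_comm]
    refine (abs_norm_sub_norm_le _ _).trans ?_
    simp

lemma CoreSol.defect_mem (hu : CoreSol s p R β u) {h : ℝ} (hh0 : 0 < h) (hh1 : h ≤ 1)
    {e : EuclideanSpace ℝ (Fin d)} (he : ‖e‖ = 1) {x : EuclideanSpace ℝ (Fin d)}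
    (hx : ‖x‖ + 1 < R) : 0 ≤ defect h e u x ∧ defect h e u x ≤ 2 := by
  have hhe : ‖h • e‖ = h := by rw [norm_smul, he, mul_one, Real.norm_of_nonneg hh0.le]
  have hx' : ‖x + h • e‖ < R := (norm_add_le _ _).trans_lt (by rw [hhe]; linarith)
  have := hu.lip (x + h • e) (by simpa using hx') x (by simpa using (by linarith : ‖x‖ < R))
  rw [add_sub_cancel_left, hhe] at this
  have h2 := abs_le.1 this
  unfold defect
  have a1 : (u (x + h • e) - u x) / h ≤ 1 := (div_le_one hh0).2 h2.2
  have a2 : -1 ≤ (u (x + h • e) - u x) / h := by rw [le_div_iff₀ hh0]; linarith [h2.1]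
  constructor <;> linarith

lemma CoreSol.abs_defect_sub_le (hu : CoreSol s p R β u) {h : ℝ} (hh0 : 0 < h) (hh1 : h ≤ 1)
    {e : EuclideanSpace ℝ (Fin d)} (he : ‖e‖ = 1) {x y : EuclideanSpace ℝ (Fin d)}
    (hx : ‖x‖ + 1 < R) (hy : ‖y‖ + 1 < R) :
    |defect h e u x - defect h e u y| ≤ 2 / h * ‖x - y‖ := by
  have hhe : ‖h • e‖ = h := by rw [norm_smul, he, mul_one, Real.norm_of_nonneg hh0.le]
  have hx' : ‖x + h • e‖ < R := (norm_add_le _ _).trans_lt (by rw [hhe]; linarith)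
  have hy' : ‖y + h • e‖ < R := (norm_add_le _ _).trans_lt (by rw [hhe]; linarith)
  have b1 := hu.lip (x + h • e) (by simpa using hx') (y + h • e) (by simpa using hy')
  have b2 := hu.lip x (by simpa using (by linarith : ‖x‖ < R)) y
    (by simpa using (by linarith : ‖y‖ < R))
  rw [add_sub_add_right_eq_sub] at b1
  have e1 : defect h e u x - defect h e u y
      = ((u x - u y) - (u (x + h • e) - u (y + h • e))) / h := by unfold defect; ring
  rw [e1, abs_div, abs_of_pos hh0, div_mul_eq_mul_div]
  gcongr
  exact (abs_sub _ _).trans (by linarith)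

lemma norm_lt_add_one_of_mem_ball {x₀ x : EuclideanSpace ℝ (Fin d)} {M : ℝ} (hx₀ : ‖x₀‖ ≤ M)
    (hx : x ∈ ball x₀ 1) : ‖x‖ < M + 1 := by
  have h1 : ‖x - x₀‖ < 1 := by simpa [dist_eq_norm] using hx
  have := norm_add_le x₀ (x - x₀)
  rw [add_sub_cancel] at this
  linarith

/-- Off the unit ball the cone vanishes and the defect is nonnegative, so the positive part is
already zero and the indicator is redundant. Farther out the sign of the defect is unknown, which is
why `coneTest` carries the indicator. -/
lemma CoreSol.coneTest_eq (hu : CoreSol s p R β u) {h : ℝ} (hh0 : 0 < h) (hh1 : h ≤ 1)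
    {e : EuclideanSpace ℝ (Fin d)} (he : ‖e‖ = 1) {κ l : ℝ} (hl : 0 ≤ l)
    (x₀ : EuclideanSpace ℝ (Fin d)) {x : EuclideanSpace ℝ (Fin d)} (hx : ‖x‖ + 1 < R) :
    coneTest κ l h x₀ e u x = max (cone κ x₀ x - l - defect h e u x) 0 := by
  by_cases hb : x ∈ ball x₀ 1
  · rw [coneTest, indicator_of_mem hb]
  · rw [coneTest, indicator_of_notMem hb, cone_eq_zero hb, max_eq_right]
    linarith [(hu.defect_mem hh0 hh1 he hx).1]

lemma coneTest_nonneg (κ l h : ℝ) (x₀ e x : EuclideanSpace ℝ (Fin d)) :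
    0 ≤ coneTest κ l h x₀ e u x := indicator_nonneg (fun _ _ => le_max_right _ _) x

lemma coneTest_eq_zero {κ l h : ℝ} {x₀ e x : EuclideanSpace ℝ (Fin d)}
    (hx : x ∉ belowCone κ l h x₀ e u) : coneTest κ l h x₀ e u x = 0 := by
  by_cases hb : x ∈ ball x₀ 1
  · rw [coneTest, indicator_of_mem hb, max_eq_right]
    have : ¬ defect h e u x < cone κ x₀ x - l := fun h' => hx ⟨hb, h'⟩
    linarith [not_lt.1 this]
  · rw [coneTest, indicator_of_notMem hb]

lemma CoreSol.coneTest_le (hu : CoreSol s p R β u) {h : ℝ} (hh0 : 0 < h) (hh1 : h ≤ 1)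
    {e : EuclideanSpace ℝ (Fin d)} (he : ‖e‖ = 1) {κ l M : ℝ} (hκ : 0 ≤ κ) (hl : 0 ≤ l)
    {x₀ : EuclideanSpace ℝ (Fin d)} (hx₀ : ‖x₀‖ ≤ M) (hM : M + 2 ≤ R)
    (x : EuclideanSpace ℝ (Fin d)) : coneTest κ l h x₀ e u x ≤ κ := by
  by_cases hb : x ∈ ball x₀ 1
  · rw [coneTest, indicator_of_mem hb]
    have := norm_lt_add_one_of_mem_ball hx₀ hb
    have h1 := (hu.defect_mem hh0 hh1 he (x := x) (by linarith)).1
    have h2 := cone_le hκ x₀ x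
    exact max_le (by linarith) hκ
  · rw [coneTest, indicator_of_notMem hb]; exact hκ

/-- The constant `κ + 2 / h` blows up as `h → 0`. This is harmless, since it serves only to make the
test function admissible. -/
lemma CoreSol.coneTest_lipTest (hu : CoreSol s p R β u) {h : ℝ} (hh0 : 0 < h) (hh1 : h ≤ 1)
    {e : EuclideanSpace ℝ (Fin d)} (he : ‖e‖ = 1) {κ l M : ℝ} (hκ : 0 ≤ κ) (hl : 0 ≤ l)
    {x₀ : EuclideanSpace ℝ (Fin d)} (hx₀ : ‖x₀‖ ≤ M) (hM : M + 3 ≤ R) :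
    LipTest (κ + 2 / h) κ (M + 1) (coneTest κ l h x₀ e u) := by
  have hle := fun x => hu.coneTest_le hh0 hh1 he hκ hl hx₀ (by linarith : M + 2 ≤ R) x
  have h2h : 0 ≤ 2 / h := by positivity
  have key : ∀ x y, x ∈ ball x₀ 1 →
      |coneTest κ l h x₀ e u x - coneTest κ l h x₀ e u y| ≤ (κ + 2 / h) * ‖x - y‖ := by
    intro x y hx
    have hxn := norm_lt_add_one_of_mem_ball hx₀ hx
    rcases lt_or_ge (‖y‖ + 1) R with hy | hy
    · rw [hu.coneTest_eq hh0 hh1 he hl x₀ (by linarith : ‖x‖ + 1 < R),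
        hu.coneTest_eq hh0 hh1 he hl x₀ hy]
      refine (abs_max_sub_max_le_abs _ _ _).trans ?_
      have b1 := abs_cone_sub_le hκ x₀ x y
      have b2 := hu.abs_defect_sub_le hh0 hh1 he (by linarith : ‖x‖ + 1 < R) hy
      have b3 : κ * min 1 ‖x - y‖ ≤ κ * ‖x - y‖ :=
        mul_le_mul_of_nonneg_left (min_le_right _ _) hκ
      rw [show cone κ x₀ x - l - defect h e u x - (cone κ x₀ y - l - defect h e u y)
        = (cone κ x₀ x - cone κ x₀ y) - (defect h e u x - defect h e u y) by ring]
      refine (abs_sub _ _).trans ?_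
      linarith
    · have hyb : y ∉ ball x₀ 1 := fun hy' => by
        have := norm_lt_add_one_of_mem_ball hx₀ hy'; linarith
      have h0 : coneTest κ l h x₀ e u y = 0 := by rw [coneTest, indicator_of_notMem hyb]
      have h1 : 1 ≤ ‖x - y‖ := by
        have := norm_sub_norm_le y x
        rw [norm_sub_rev] at this; linarith
      rw [h0, sub_zero, abs_of_nonneg (coneTest_nonneg _ _ _ _ _ _)]
      nlinarith [hle x]
  refine ⟨fun x y => ?_, fun x => ?_, fun x hx => ?_⟩
  · by_cases hx : x ∈ ball x₀ 1
    · exact key x y hx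
    by_cases hy : y ∈ ball x₀ 1
    · rw [abs_sub_comm, norm_sub_rev]; exact key y x hy
    · rw [coneTest, indicator_of_notMem hx, indicator_of_notMem hy, sub_zero, abs_zero]
      positivity
  · rw [abs_of_nonneg (coneTest_nonneg _ _ _ _ _ _)]; exact hle x
  · rw [coneTest, indicator_of_notMem]
    intro hb
    have := norm_lt_add_one_of_mem_ball hx₀ hb
    linarith

end

/-! ### The energy inequality for the defect. -/

section
variable {d : ℕ} {s p R β : ℝ} {u : EuclideanSpace ℝ (Fin d) → ℝ}

/-- Integrability profile of the kernel against squared increments of a bounded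
Lipschitz function. -/
noncomputable def profile (d : ℕ) (s p : ℝ) (z : EuclideanSpace ℝ (Fin d)) : ℝ :=
  ‖z‖ ^ (p - 2) * (‖z‖ ^ ((d : ℝ) + s * p))⁻¹ * (min 1 ‖z‖) ^ 2

lemma profile_nonneg (d : ℕ) (s p : ℝ) (z : EuclideanSpace ℝ (Fin d)) : 0 ≤ profile d s p z := by
  unfold profile; positivity

/-- At the origin the profile behaves like `‖z‖^(-(d - p(1-s)))` and at infinity like `‖z‖^(-(d +
γ))`; integrability at infinity is where `γ > 0` is used. -/
lemma integrable_profile (hd : 1 ≤ d) (hs1 : s < 1) (hp2 : 2 ≤ p)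
    (hγ : 0 < 2 - p * (1 - s)) : Integrable (profile d s p) := by
  have hm : Measurable (profile d s p) := by unfold profile; fun_prop
  have e : ∀ z : EuclideanSpace ℝ (Fin d), 0 < ‖z‖ →
      ‖z‖ ^ (p - 2) * (‖z‖ ^ ((d : ℝ) + s * p))⁻¹ = ‖z‖ ^ (-((d : ℝ) + (2 - p * (1 - s)))) := by
    intro z hz
    rw [← Real.rpow_neg hz.le, ← Real.rpow_add hz]; congr 1; ring
  have h1 : IntegrableOn (profile d s p) (ball 0 1) := by
    refine integrableOn_ball_of_norm_le_rpow (C := 1) (α := (d : ℝ) - p * (1 - s))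
      (by simpa using hd) ?_ ?_ hm.aestronglyMeasurable
    · simp only [finrank_euclideanSpace, Fintype.card_fin]; nlinarith
    · refine ae_of_all _ fun z => ?_
      rw [Real.norm_of_nonneg (profile_nonneg _ _ _ _), one_mul]
      rcases eq_or_ne z 0 with rfl | hz
      · simp [profile]; positivity
      have hz : 0 < ‖z‖ := norm_pos_iff.2 hz
      rw [profile, e z hz]
      have : (min 1 ‖z‖) ^ 2 ≤ ‖z‖ ^ 2 := by gcongr; exact min_le_right _ _
      calc _ ≤ ‖z‖ ^ (-((d : ℝ) + (2 - p * (1 - s)))) * ‖z‖ ^ 2 := by gcongr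
        _ = ‖z‖ ^ (-((d : ℝ) - p * (1 - s))) := by
          rw [← Real.rpow_natCast, ← Real.rpow_add hz]; congr 1; push_cast; ring
        _ ≤ _ := le_rfl
  have h2 : IntegrableOn (profile d s p) (ball 0 1)ᶜ := by
    refine (integrable_max_rpow (d := d) hγ le_rfl).integrableOn.mono' hm.aestronglyMeasurable ?_
    refine (ae_restrict_iff' measurableSet_ball.compl).2 (ae_of_all _ fun z hz => ?_)
    have hz1 : 1 ≤ ‖z‖ := by simpa using hz
    rw [Real.norm_of_nonneg (profile_nonneg _ _ _ _), profile, e z (by linarith), max_eq_left hz1,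
      Real.rpow_neg (by linarith), min_eq_left hz1]
    simp
  rw [← integrableOn_univ, ← union_compl_self (ball (0 : EuclideanSpace ℝ (Fin d)) 1)]
  exact h1.union h2

/-- Constant in the energy inequality. -/
noncomputable def energyConst (d : ℕ) (s p : ℝ) : ℝ :=
  (p - 1) * (∫ z : EuclideanSpace ℝ (Fin d), profile d s p z) + 1

/-- With `a`, `b` the values of the barrier and `w`, `v` those of the defect at two points, the left
side is the cross term. Writing `w - v` as `a - b` minus the truncations, the square of the
difference of truncations absorbs the term linear in `a - b` by completing the square. What remains
is paid only where `w < a` or `v < b`. -/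
lemma trunc_inequality (a b w v : ℝ) :
    max (w - a) 0 * max (b - v) 0 + max (v - b) 0 * max (a - w) 0
      ≤ (a - b) ^ 2 / 4 * ((if w < a then 1 else 0) + (if v < b then 1 else 0))
        - (w - v) * (max (a - w) 0 - max (b - v) 0) := by
  rcases lt_or_ge w a with h1 | h1 <;> rcases lt_or_ge v b with h2 | h2
  · rw [max_eq_right (by linarith : w - a ≤ 0), max_eq_right (by linarith : v - b ≤ 0),
      max_eq_left (by linarith : 0 ≤ a - w), max_eq_left (by linarith : 0 ≤ b - v),
      if_pos h1, if_pos h2]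
    nlinarith [sq_nonneg ((a - b) / 2 - (a - w - (b - v))), sq_nonneg (a - b)]
  · rw [max_eq_right (by linarith : w - a ≤ 0), max_eq_left (by linarith : 0 ≤ v - b),
      max_eq_left (by linarith : 0 ≤ a - w), max_eq_right (by linarith : b - v ≤ 0),
      if_pos h1, if_neg (not_lt.2 h2)]
    nlinarith [sq_nonneg ((a - b) / 2 - (a - w))]
  · rw [max_eq_left (by linarith : 0 ≤ w - a), max_eq_right (by linarith : v - b ≤ 0),
      max_eq_right (by linarith : a - w ≤ 0), max_eq_left (by linarith : 0 ≤ b - v),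
      if_neg (not_lt.2 h1), if_pos h2]
    nlinarith [sq_nonneg ((a - b) / 2 + (b - v))]
  · rw [max_eq_left (by linarith : 0 ≤ w - a), max_eq_left (by linarith : 0 ≤ v - b),
      max_eq_right (by linarith : a - w ≤ 0), max_eq_right (by linarith : b - v ≤ 0),
      if_neg (not_lt.2 h1), if_neg (not_lt.2 h2)]
    simp

lemma measurable_pairKer_left (hu : Measurable u) (p D r h : ℝ) (e y : EuclideanSpace ℝ (Fin d)) :
    Measurable fun x => pairKer p D r h e u x y := by
  unfold pairKer
  have h1 := measurable_nearKer (d := d) (D := D) (r := r)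
  refine Measurable.mul (by fun_prop) ?_
  exact (measurable_signPowSlope p).comp (Measurable.prodMk (by fun_prop) (by fun_prop))

-- Testing the equation of the increment with `(cone - l - w)₊` and discarding the nonnegative
-- squared increments leaves the cross term. The right side consists of the energy of the cone and
-- the long range error, both of order `κ²` times the measure of the set below the cone. Matching
-- this order is what `hfar` is for.
set_option maxHeartbeats 1000000 in
lemma CoreSol.energy (hu : CoreSol s p R β u) (hd : 1 ≤ d) (hs0 : 0 < s) (hs1 : s < 1)
    (hp2 : 2 ≤ p) (hβ : 0 ≤ β) (hγ : 0 < 2 - p * (1 - s))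
    {M r h : ℝ} (hM : 0 ≤ M) (hr : 2 * (M + 2) ≤ r) (hR : r + M + 3 ≤ R)
    {e x₀ : EuclideanSpace ℝ (Fin d)} (he : ‖e‖ = 1) (hx₀ : ‖x₀‖ ≤ M) (hh0 : 0 < h) (hh1 : h ≤ 1)
    {κ l : ℝ} (hκ : 0 ≤ κ) (hl : 0 ≤ l)
    (hfar : farConst d s p * (farMass d (2 - p * (1 - s)) r + β) ≤ κ) :
    ∫⁻ y, ENNReal.ofReal (coneTest κ l h x₀ e u y)
        * crossMass p ((d : ℝ) + s * p) r κ l h x₀ e u y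
      ≤ ENNReal.ofReal (energyConst d s p * κ ^ 2) * volume (belowCone κ l h x₀ e u) := by
  have hsp : 0 < s * p := mul_pos hs0 (by linarith)
  set D : ℝ := (d : ℝ) + s * p with hDdef
  have hD0 : 0 ≤ D := by positivity
  have hr0 : 0 < r := by linarith
  have hum := hu.meas
  set S := belowCone κ l h x₀ e u with hS
  set φ := coneTest κ l h x₀ e u with hφdef
  have hSm : MeasurableSet S := measurableSet_belowCone hum _ _ _ _ _
  have hφt : LipTest (κ + 2 / h) κ (M + 1) φ :=
    hu.coneTest_lipTest hh0 hh1 he hκ hl hx₀ (by linarith)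
  have hφ0 : ∀ x, 0 ≤ φ x := fun x => coneTest_nonneg _ _ _ _ _ _
  have hφm : Measurable φ := (hφt.continuous hd).measurable
  have hSball : S ⊆ ball x₀ 1 := fun x hx => hx.1
  have hSfin : volume S ≠ ⊤ := measure_ne_top_of_subset hSball measure_ball_lt_top.ne
  obtain ⟨n1, n2⟩ := hu.near_le (r := r) hd hs0 hs1 hp2 hβ hγ (by linarith : 0 ≤ M + 1) (by linarith)
    (by linarith) (by linarith) he hh0.le hh1 hφt hφ0
  set F := nearIncr p D r h e u φ with hF
  set G : EuclideanSpace ℝ (Fin d) → ℝ := fun x => max (defect h e u x - cone κ x₀ x + l) 0 with hG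
  have hGm : Measurable G := by
    have := measurable_defect hum h e
    have := (continuous_cone κ x₀).measurable
    simp only [hG]; fun_prop
  set P : EuclideanSpace ℝ (Fin d) × EuclideanSpace ℝ (Fin d) → ℝ := fun z =>
    pairKer p D r h e u z.1 z.2 * G z.1 * φ z.2 with hP
  set Q : EuclideanSpace ℝ (Fin d) × EuclideanSpace ℝ (Fin d) → ℝ := fun z =>
    indicator S (fun _ => (1 : ℝ)) z.2 * ((p - 1) * κ ^ 2 / 4 * profile d s p (z.1 - z.2)) with hQ
  have hpk := fun x y => pairKer_nonneg (u := u) hp2 hD0 hr0 (h := h) e x y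
  have hP0 : ∀ z, 0 ≤ P z := fun z =>
    mul_nonneg (mul_nonneg (hpk _ _) (le_max_right _ _)) (hφ0 _)
  have hPm : Measurable P := by
    have := measurable_pairKer hum p D r h e
    simp only [hP]; fun_prop
  have hprof : Integrable (fun z => (p - 1) * κ ^ 2 / 4 * profile d s p z) :=
    (integrable_profile hd hs1 hp2 hγ).const_mul _
  have hSi : Integrable (indicator S (fun _ => (1 : ℝ))) := by
    rw [integrable_indicator_iff hSm]; exact integrableOn_const hSfin
  have hQi : Integrable Q (volume.prod volume) :=
    hSi.convolution_integrand (μ := volume) (ν := volume) (ContinuousLinearMap.mul ℝ ℝ) hprof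
  have hQs : Integrable (fun z => Q z.swap) (volume.prod volume) := hQi.swap
  have hQv : ∫ z, Q z ∂(volume.prod volume)
      = (p - 1) * κ ^ 2 / 4 * (∫ z : EuclideanSpace ℝ (Fin d), profile d s p z)
        * volume.real S := by
    rw [integral_prod_symm _ hQi]
    simp only [hQ]
    simp_rw [integral_const_mul, integral_sub_right_eq_self (profile d s p)]
    rw [integral_mul_const, integral_indicator hSm]
    simp
    ring
  have hφint : ∫ x, φ x ≤ κ * volume.real S := by
    have : ∫ x, φ x ≤ ∫ x, κ * indicator S (fun _ => (1 : ℝ)) x := by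
      refine integral_mono (hφt.integrable hd) (hSi.const_mul κ) fun x => ?_
      by_cases hx : x ∈ S
      · simp only [indicator_of_mem hx, mul_one]
        exact (le_abs_self _).trans (hφt.bdd x)
      · simp only [indicator_of_notMem hx, mul_zero]
        exact (coneTest_eq_zero hx).le
    refine this.trans (le_of_eq ?_)
    rw [integral_const_mul, integral_indicator hSm]; simp
  -- The short range kernel confines `x` to the region where the bounds on the defect hold.
  have key : ∀ x y, ‖x - y‖ < r → y ∈ ball x₀ 1 → P (x, y) + P (y, x)
      ≤ Q (x, y) + Q (y, x) + F (x, y) / h := by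
    intro x y hxy hy
    have hyn := norm_lt_add_one_of_mem_ball hx₀ hy
    have hxn : ‖x‖ < M + 1 + r := by
      have := norm_add_le y (x - y)
      rw [add_sub_cancel] at this
      linarith
    have hxR : ‖x‖ + 1 < R := by linarith
    have hyR : ‖y‖ + 1 < R := by linarith
    set A := pairKer p D r h e u x y with hA
    have hA0 : 0 ≤ A := hpk x y
    -- Since both `u` and its translate are 1-Lipschitz here, the slope factor is at most `(p - 1)
    -- ‖x - y‖^(p-2)`; no lower bound for the kernel is needed at this point.
    have hAprof : A * (cone κ x₀ x - cone κ x₀ y) ^ 2 / 4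
        ≤ (p - 1) * κ ^ 2 / 4 * profile d s p (x - y) := by
      have hhe : ‖h • e‖ = h := by rw [norm_smul, he, mul_one, Real.norm_of_nonneg hh0.le]
      have hx' : ‖x + h • e‖ < R := (norm_add_le _ _).trans_lt (by rw [hhe]; linarith)
      have hy' : ‖y + h • e‖ < R := (norm_add_le _ _).trans_lt (by rw [hhe]; linarith)
      have b1 := hu.lip (x + h • e) (by simpa using hx') (y + h • e) (by simpa using hy')
      have b2 := hu.lip x (by simpa using (by linarith : ‖x‖ < R)) y
        (by simpa using (by linarith : ‖y‖ < R))
      rw [add_sub_add_right_eq_sub] at b1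
      have c1 := signPowSlope_le hp2 b2 b1
      have c2 := nearKer_le (D := D) (x - y) hr0
      have c3 : (cone κ x₀ x - cone κ x₀ y) ^ 2 ≤ (κ * min 1 ‖x - y‖) ^ 2 := by
        rw [← sq_abs]
        exact pow_le_pow_left₀ (abs_nonneg _) (abs_cone_sub_le hκ x₀ x y) 2
      have c4 := signPowSlope_nonneg hp2 (u x - u y) (u (x + h • e) - u (y + h • e))
      have c5 : A ≤ (‖x - y‖ ^ D)⁻¹ * ((p - 1) * ‖x - y‖ ^ (p - 2)) :=
        mul_le_mul c2 c1 c4 (by positivity)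
      calc A * (cone κ x₀ x - cone κ x₀ y) ^ 2 / 4
          ≤ ((‖x - y‖ ^ D)⁻¹ * ((p - 1) * ‖x - y‖ ^ (p - 2))) * (κ * min 1 ‖x - y‖) ^ 2 / 4 := by
            gcongr
            exact hA0.trans c5
        _ = _ := by rw [profile, ← hDdef]; ring
    have t := trunc_inequality (cone κ x₀ x - l) (cone κ x₀ y - l) (defect h e u x) (defect h e u y)
    rw [← hu.coneTest_eq hh0 hh1 he hl x₀ hxR, ← hu.coneTest_eq hh0 hh1 he hl x₀ hyR,
      ← hφdef] at t
    have gx : max (defect h e u x - (cone κ x₀ x - l)) 0 = G x := by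
      simp only [hG]; congr 1; ring
    have gy : max (defect h e u y - (cone κ x₀ y - l)) 0 = G y := by
      simp only [hG]; congr 1; ring
    have memS : ∀ v, ‖v‖ + 1 < R → ((if defect h e u v < cone κ x₀ v - l then 1 else 0 : ℝ)
        = indicator S (fun _ => (1 : ℝ)) v) := by
      intro v hv
      by_cases hvS : v ∈ S
      · rw [indicator_of_mem hvS, if_pos hvS.2]
      · rw [indicator_of_notMem hvS, if_neg]
        intro hlt
        by_cases hb : v ∈ ball x₀ 1
        · exact hvS ⟨hb, hlt⟩
        · rw [cone_eq_zero hb] at hlt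
          linarith [(hu.defect_mem hh0 hh1 he hv).1]
    rw [gx, gy, memS x hxR, memS y hyR] at t
    have t2 := mul_le_mul_of_nonneg_left t hA0
    have i1 : 0 ≤ indicator S (fun _ => (1 : ℝ)) x := indicator_nonneg (fun _ _ => zero_le_one) x
    have i2 : 0 ≤ indicator S (fun _ => (1 : ℝ)) y := indicator_nonneg (fun _ _ => zero_le_one) y
    have t3 := mul_le_mul_of_nonneg_right hAprof (add_nonneg i1 i2)
    -- Linearization: the increment of the nonlinearity is its difference quotient times `-h` times
    -- the increment of the defect.
    have eF : F (x, y) / h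
        = -(A * ((defect h e u x - defect h e u y) * (φ x - φ y))) := by
      simp only [hF, nearIncr, hA, pairKer]
      rw [signPow_sub_eq]
      have : u (x + h • e) - u (y + h • e) - (u x - u y)
          = -(h * (defect h e u x - defect h e u y)) := by
        unfold defect; field_simp; ring
      rw [this]; field_simp
    have eP : P (x, y) + P (y, x) = A * (G x * φ y + G y * φ x) := by
      simp only [hP]; rw [pairKer_symm p D r h e y x, ← hA]; ring
    have eQ : Q (x, y) + Q (y, x) = (p - 1) * κ ^ 2 / 4 * profile d s p (x - y)
        * (indicator S (fun _ => (1 : ℝ)) x + indicator S (fun _ => (1 : ℝ)) y) := by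
      simp only [hQ]
      have : profile d s p (y - x) = profile d s p (x - y) := by
        unfold profile; rw [norm_sub_rev]
      rw [this]; ring
    rw [eF, eP, eQ]
    rw [show cone κ x₀ x - l - (cone κ x₀ y - l) = cone κ x₀ x - cone κ x₀ y by ring] at t2
    linarith
  have hle : ∀ z, P z + P z.swap ≤ Q z + Q z.swap + F z / h := by
    rintro ⟨x, y⟩
    simp only [Prod.swap_prod_mk]
    have q0 : ∀ z, 0 ≤ Q z := fun z => by
      have i2 : 0 ≤ indicator S (fun _ => (1 : ℝ)) z.2 :=
        indicator_nonneg (fun _ _ => zero_le_one) _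
      have := profile_nonneg d s p (z.1 - z.2)
      have hp1 : 0 ≤ p - 1 := by linarith
      simp only [hQ]; positivity
    have Fs : F (x, y) = F (y, x) := by
      simp only [hF, nearIncr]
      rw [← nearKer_neg, neg_sub, signPow_sub_comm p (u (x + h • e)), signPow_sub_comm p (u x)]
      ring
    by_cases hxy : ‖x - y‖ < r
    · by_cases hy : y ∈ ball x₀ 1
      · exact key x y hxy hy
      by_cases hx : x ∈ ball x₀ 1
      · have := key y x (by rwa [norm_sub_rev]) hx
        rw [Fs]; linarith
      · have f1 : φ x = 0 := by rw [hφdef, coneTest, indicator_of_notMem hx]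
        have f2 : φ y = 0 := by rw [hφdef, coneTest, indicator_of_notMem hy]
        have : F (x, y) = 0 := by simp [hF, nearIncr, f1, f2]
        have p1 : P (x, y) = 0 := by simp [hP, f2]
        have p2 : P (y, x) = 0 := by simp [hP, f1]
        rw [this, p1, p2]
        have := q0 (x, y); have := q0 (y, x)
        simp only [zero_div]; linarith
    · have k0 : nearKer D r (x - y) = 0 := nearKer_eq_zero _ hr0 (not_lt.1 hxy)
      have k1 : nearKer D r (y - x) = 0 := by rw [← nearKer_neg, neg_sub]; exact k0
      have : F (x, y) = 0 := by simp [hF, nearIncr, k0]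
      have p1 : P (x, y) = 0 := by simp [hP, pairKer, k0]
      have p2 : P (y, x) = 0 := by simp [hP, pairKer, k1]
      rw [this, p1, p2]
      have := q0 (x, y); have := q0 (y, x)
      simp only [zero_div]; linarith
  have hFh : Integrable (fun z => F z / h) (volume.prod volume) := n1.div_const h
  have hQQ : Integrable (fun z => Q z + Q z.swap) (volume.prod volume) := hQi.add hQs
  have hRHS : Integrable (fun z => Q z + Q z.swap + F z / h) (volume.prod volume) := hQQ.add hFh
  -- Integrability of the cross term is not known beforehand; it follows from its nonnegativity and
  -- the pointwise bound `hle`.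
  have hPi : Integrable P (volume.prod volume) := by
    refine hRHS.mono' hPm.aestronglyMeasurable (ae_of_all _ fun z => ?_)
    rw [Real.norm_of_nonneg (hP0 z)]
    linarith [hle z, hP0 z.swap]
  have hPs : Integrable (fun z => P z.swap) (volume.prod volume) := hPi.swap
  have hPint : ∫ z, P z ∂(volume.prod volume) ≤ energyConst d s p * κ ^ 2 * volume.real S := by
    have i1 := integral_mono (hPi.add hPs) hRHS hle
    have i2 : ∫ z, (P z + P z.swap) ∂(volume.prod volume)
        = 2 * ∫ z, P z ∂(volume.prod volume) := by
      rw [integral_add hPi hPs, integral_prod_swap P]; ring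
    have i3 : ∫ z, (Q z + Q z.swap + F z / h) ∂(volume.prod volume)
        = 2 * ∫ z, Q z ∂(volume.prod volume) + (∫ z, F z ∂(volume.prod volume)) / h := by
      rw [integral_add hQQ hFh, integral_add hQi hQs, integral_prod_swap Q, integral_div]; ring
    have i4 : (∫ z, F z ∂(volume.prod volume)) / h ≤ κ * (κ * volume.real S) := by
      rw [div_le_iff₀ hh0]
      refine (le_abs_self _).trans (n2.trans ?_)
      have hI : 0 ≤ ∫ x, φ x := integral_nonneg hφ0
      calc _ ≤ h * κ * (κ * volume.real S) :=
            mul_le_mul (mul_le_mul_of_nonneg_left hfar hh0.le) hφint hI (by positivity)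
        _ = _ := by ring
    have i1' : 2 * ∫ z, P z ∂(volume.prod volume)
        ≤ 2 * ∫ z, Q z ∂(volume.prod volume) + (∫ z, F z ∂(volume.prod volume)) / h := by
      rw [← i2, ← i3]; exact i1
    rw [hQv] at i1'
    have hI : 0 ≤ ∫ z : EuclideanSpace ℝ (Fin d), profile d s p z :=
      integral_nonneg fun z => profile_nonneg _ _ _ _
    have hv : 0 ≤ volume.real S := measureReal_nonneg
    have hpos : 0 ≤ (p - 1) * κ ^ 2 * (∫ z : EuclideanSpace ℝ (Fin d), profile d s p z)
        * volume.real S := by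
      have : 0 ≤ p - 1 := by linarith
      positivity
    have hpos2 : 0 ≤ κ ^ 2 * volume.real S := by positivity
    unfold energyConst
    nlinarith
  have e1 : ∫⁻ y, ENNReal.ofReal (φ y) * crossMass p D r κ l h x₀ e u y
      = ∫⁻ z, ENNReal.ofReal (P z) ∂(volume.prod volume) := by
    rw [lintegral_prod_symm' _ hPm.ennreal_ofReal]
    refine lintegral_congr fun y => ?_
    have hm : Measurable fun x => ENNReal.ofReal (pairKer p D r h e u x y * G x) :=
      ((measurable_pairKer_left hum p D r h e y).mul hGm).ennreal_ofReal
    have ec : crossMass p D r κ l h x₀ e u y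
      = ∫⁻ x, ENNReal.ofReal (pairKer p D r h e u x y * G x) := rfl
    rw [ec, ← lintegral_const_mul _ hm]
    refine lintegral_congr fun x => ?_
    rw [mul_comm, ← ENNReal.ofReal_mul (mul_nonneg (hpk _ _) (le_max_right _ _))]
  rw [e1, ← ofReal_integral_eq_lintegral_ofReal hPi (ae_of_all _ hP0)]
  refine (ENNReal.ofReal_le_ofReal hPint).trans (le_of_eq ?_)
  have hE : 0 ≤ energyConst d s p * κ ^ 2 := by
    have hI : 0 ≤ ∫ z : EuclideanSpace ℝ (Fin d), profile d s p z :=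
      integral_nonneg fun z => profile_nonneg _ _ _ _
    have : 0 ≤ p - 1 := by linarith
    unfold energyConst; positivity
  rw [ENNReal.ofReal_mul hE, ofReal_measureReal hSfin]

end

/-! ### Oscillation of `u` at a critical scale forces a large defect. -/

section
variable {d : ℕ} {s p R β : ℝ} {u : EuclideanSpace ℝ (Fin d) → ℝ}

/-- Up to a time `n` before which `f` stays above `2A`, the sum is at least `3/4 (n h) - (f n - f
0)`. If `f` ever drops below `2A`, take the first such time: `f` has lost at least `A`. If not, run
to the end: `6A` is at least the total rise, at most `5A`, plus `A`. -/
lemma sum_excess_ge {f w : ℕ → ℝ} {A h : ℝ} {m : ℕ} (hh : 0 ≤ h)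
    (hf : ∀ j, j < m → f (j + 1) = f j + h * (1 - w j))
    (h0 : 3 * A ≤ f 0) (hm : f m ≤ 8 * A) (hmh : 8 * A ≤ m * h) :
    A ≤ ∑ j ∈ Finset.range m, h * (if 2 * A ≤ f j then max (w j - 1 / 4) 0 else 0) := by
  have tele : ∀ n, n ≤ m → f n = f 0 + ∑ j ∈ Finset.range n, h * (1 - w j) := by
    intro n
    induction n with
    | zero => simp
    | succ k ih =>
      intro hk
      rw [Finset.sum_range_succ, hf k (by omega), ih (by omega)]; ring
  have nonneg : ∀ j, 0 ≤ h * (if 2 * A ≤ f j then max (w j - 1 / 4) 0 else 0) := by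
    intro j
    refine mul_nonneg hh ?_
    split_ifs
    · exact le_max_right _ _
    · exact le_rfl
  have part : ∀ n, n ≤ m → (∀ j, j < n → 2 * A ≤ f j) →
      (3 / 4 * (n * h) - (f n - f 0))
        ≤ ∑ j ∈ Finset.range m, h * (if 2 * A ≤ f j then max (w j - 1 / 4) 0 else 0) := by
    intro n hn hall
    have h1 : ∑ j ∈ Finset.range n, h * (w j - 1 / 4)
        ≤ ∑ j ∈ Finset.range n, h * (if 2 * A ≤ f j then max (w j - 1 / 4) 0 else 0) := by
      refine Finset.sum_le_sum fun j hj => ?_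
      rw [if_pos (hall j (Finset.mem_range.1 hj))]
      exact mul_le_mul_of_nonneg_left (le_max_left _ _) hh
    have h2 : ∑ j ∈ Finset.range n, h * (if 2 * A ≤ f j then max (w j - 1 / 4) 0 else 0)
        ≤ ∑ j ∈ Finset.range m, h * (if 2 * A ≤ f j then max (w j - 1 / 4) 0 else 0) :=
      Finset.sum_le_sum_of_subset_of_nonneg (Finset.range_mono hn) fun j _ _ => nonneg j
    have h3 : ∑ j ∈ Finset.range n, h * (w j - 1 / 4) = 3 / 4 * (n * h) - (f n - f 0) := by
      rw [tele n hn, add_sub_cancel_left]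
      have : ∀ j ∈ Finset.range n, h * (w j - 1 / 4) = 3 / 4 * h - h * (1 - w j) := by
        intro j _; ring
      rw [Finset.sum_congr rfl this, Finset.sum_sub_distrib, Finset.sum_const, Finset.card_range,
        nsmul_eq_mul]
      ring
    linarith
  by_cases hdip : ∃ j, j ≤ m ∧ f j < 2 * A
  · classical
    obtain ⟨hn1, hn2⟩ := Nat.find_spec hdip
    have := part (Nat.find hdip) hn1 fun j hj => by
      by_contra hc
      exact Nat.find_min hdip hj ⟨by omega, not_le.1 hc⟩
    have h5 : 0 ≤ ((Nat.find hdip : ℕ) : ℝ) * h := by positivity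
    linarith
  · push Not at hdip
    have := part m le_rfl fun j hj => hdip j hj.le
    linarith

/-- The defect above `1/4`, restricted to points where `u` differs from `u y` by at least `A`. -/
noncomputable def excess (A h : ℝ) (e y : EuclideanSpace ℝ (Fin d))
    (u : EuclideanSpace ℝ (Fin d) → ℝ) (x : EuclideanSpace ℝ (Fin d)) : ℝ :=
  if A ≤ |u x - u y| then max (defect h e u x - 1 / 4) 0 else 0

lemma excess_nonneg (A h : ℝ) (e y x : EuclideanSpace ℝ (Fin d)) : 0 ≤ excess A h e y u x := by
  unfold excess; split_ifs
  · exact le_max_right _ _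
  · exact le_rfl

lemma measurable_excess (hu : Measurable u) (A h : ℝ) (e y : EuclideanSpace ℝ (Fin d)) :
    Measurable (excess A h e y u) := by
  have := measurable_defect hu h e
  unfold excess
  refine Measurable.ite (measurableSet_le measurable_const (by fun_prop)) (by fun_prop) (by fun_prop)

lemma norm_smul_unit {e : EuclideanSpace ℝ (Fin d)} (he : ‖e‖ = 1) (t : ℝ) : ‖t • e‖ = |t| := by
  rw [norm_smul, he, mul_one, Real.norm_eq_abs]

/-- If `u - u y` is of size `4A` at `x₁` but remains below `8A` in `ball y (128A)`, the defect
has to be large in average in this ball. -/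
lemma CoreSol.exists_shifts (hu : CoreSol s p R β u) {A h : ℝ} (hA : 0 < A) (hh0 : 0 < h)
    (hhA : h ≤ A) {e x₁ y : EuclideanSpace ℝ (Fin d)} (he : ‖e‖ = 1)
    (hx₁ : ‖x₁ - y‖ ≤ 64 * A) (hbig : 4 * A ≤ |u x₁ - u y|)
    (hsmall : ∀ z, ‖z - y‖ ≤ 128 * A → |u z - u y| < 8 * A) (hyR : ‖y‖ + 128 * A < R) :
    ∃ (m : ℕ) (v : ℕ → EuclideanSpace ℝ (Fin d)), m * h ≤ 9 * A ∧ (∀ j, j < m → ‖v j‖ ≤ 9 * A) ∧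
      ∀ x ∈ ball x₁ A, A ≤ ∑ j ∈ Finset.range m, h * excess A h e y u (x + v j) := by
  have hball : ∀ z : EuclideanSpace ℝ (Fin d), ‖z - y‖ ≤ 128 * A → z ∈ ball 0 R := by
    intro z hz
    have := norm_add_le y (z - y)
    rw [add_sub_cancel] at this
    simp only [mem_ball_zero_iff]; linarith
  have hhe : ‖h • e‖ = h := by rw [norm_smul_unit he, abs_of_pos hh0]
  -- Steps of length `h ≤ A` covering a length between `8A` and `9A`.
  set m := ⌈8 * A / h⌉₊ with hm
  have m1 : 8 * A ≤ m * h := by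
    have := Nat.le_ceil (8 * A / h)
    rwa [div_le_iff₀ hh0] at this
  have m2 : m * h ≤ 9 * A := by
    have := (Nat.ceil_lt_add_one (by positivity : 0 ≤ 8 * A / h)).le
    have h3 := mul_le_mul_of_nonneg_right this hh0.le
    rw [add_mul, div_mul_cancel₀ _ hh0.ne'] at h3
    linarith
  have jm : ∀ j : ℕ, j ≤ m → (j : ℝ) * h ≤ 9 * A := fun j hj =>
    (mul_le_mul_of_nonneg_right (Nat.cast_le.2 hj) hh0.le).trans m2
  have dist' : ∀ x ∈ ball x₁ A, ∀ w : EuclideanSpace ℝ (Fin d), ‖w‖ ≤ 9 * A →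
      ‖x + w - y‖ ≤ 128 * A := by
    intro x hx w hw
    have hx' : ‖x - x₁‖ < A := by simpa [dist_eq_norm] using hx
    have : x + w - y = (x - x₁) + (x₁ - y) + w := by abel
    rw [this]
    have := norm_add_le ((x - x₁) + (x₁ - y)) w
    have := norm_add_le (x - x₁) (x₁ - y)
    linarith
  have start : ∀ x ∈ ball x₁ A, |u x - u x₁| ≤ A := by
    intro x hx
    have hx' : ‖x - x₁‖ < A := by simpa [dist_eq_norm] using hx
    have b1 := hball x (by simpa using dist' x hx 0 (by simpa using hA.le))
    have b2 := hball x₁ (by linarith)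
    exact (hu.lip x b1 x₁ b2).trans hx'.le
  rcases le_or_gt (4 * A) (u x₁ - u y) with hs | hs
  · refine ⟨m, fun j => ((j : ℝ) * h) • e, m2, fun j hj => ?_, fun x hx => ?_⟩
    · rw [norm_smul_unit he, abs_of_nonneg (by positivity)]; exact jm j hj.le
    · have h3 := abs_le.1 (start x hx)
      have hw : ∀ j : ℕ, j ≤ m → ‖((j : ℝ) * h) • e‖ ≤ 9 * A := fun j hj => by
        rw [norm_smul_unit he, abs_of_nonneg (by positivity)]; exact jm j hj
      refine (sum_excess_ge (f := fun j => u (x + ((j : ℝ) * h) • e) - u y)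
        (w := fun j => defect h e u (x + ((j : ℝ) * h) • e)) hh0.le ?_ ?_ ?_ m1).trans ?_
      · intro j hj
        simp only [defect]
        rw [show x + (((j + 1 : ℕ) : ℝ) * h) • e = x + ((j : ℝ) * h) • e + h • e by
          push_cast; module]
        field_simp; ring
      · simp; linarith
      · exact ((le_abs_self _).trans_lt (hsmall _ (dist' x hx _ (hw m le_rfl)))).le
      · refine Finset.sum_le_sum fun j hj => mul_le_mul_of_nonneg_left ?_ hh0.le
        split_ifs with hc
        · rw [excess, if_pos]
          exact le_trans (by linarith) (le_abs_self _)
        · exact excess_nonneg _ _ _ _ _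
  · have hs' : 4 * A ≤ u y - u x₁ := by
      rcases abs_cases (u x₁ - u y) with h | h <;> linarith
    -- When `u` lies below `u y`, the walk goes backward along `e`, so that `u y - u` is the
    -- quantity that grows. A backward step starting at index `j` uses the defect at its far end,
    -- hence the shift by `j + 1`.
    refine ⟨m, fun j => (-(((j : ℝ) + 1) * h)) • e, m2, fun j hj => ?_, fun x hx => ?_⟩
    · rw [norm_smul_unit he, abs_neg, abs_of_nonneg (by positivity)]
      have := jm (j + 1) hj; push_cast at this; exact this
    · have h3 := abs_le.1 (start x hx)
      have hw : ∀ j : ℕ, j ≤ m → ‖(-((j : ℝ) * h)) • e‖ ≤ 9 * A := fun j hj => by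
        rw [norm_smul_unit he, abs_neg, abs_of_nonneg (by positivity)]; exact jm j hj
      refine (sum_excess_ge (f := fun j => u y - u (x + (-((j : ℝ) * h)) • e))
        (w := fun j => defect h e u (x + (-(((j : ℝ) + 1) * h)) • e)) hh0.le
          ?_ ?_ ?_ m1).trans ?_
      · intro j hj
        simp only [defect]
        rw [show x + (-(((j : ℝ) + 1) * h)) • e + h • e = x + (-((j : ℝ) * h)) • e by module]
        push_cast
        field_simp; ring
      · simp; linarith
      · have := (hsmall _ (dist' x hx _ (hw m le_rfl)))
        rw [abs_sub_comm] at this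
        exact ((le_abs_self _).trans_lt this).le
      · refine Finset.sum_le_sum fun j hj => mul_le_mul_of_nonneg_left ?_ hh0.le
        split_ifs with hc
        · rw [excess, if_pos]
          have hj' := Finset.mem_range.1 hj
          have b1 := hball _ (dist' x hx _ (hw j hj'.le))
          have b2 := hball _ (dist' x hx _ (hw (j + 1) hj'))
          -- The excess is evaluated one step later than the threshold `2 * A` is checked. A step
          -- changes `u` by at most `h ≤ A`, so the threshold `A` still holds.
          have b3 := hu.lip _ b1 _ b2
          rw [show x + (-((j : ℝ) * h)) • e - (x + (-(((j + 1 : ℕ) : ℝ) * h)) • e) = h • e by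
            push_cast; module, hhe] at b3
          push_cast at b3
          have b4 := abs_le.1 b3
          rw [abs_sub_comm]
          exact le_trans (by linarith [b4.1, b4.2]) (le_abs_self _)
        · exact excess_nonneg _ _ _ _ _

/-- The sums of `CoreSol.exists_shifts` are integrated over `ball x₁ A`. Each translate of this ball
stays in `ball y (128 * A)` since `1 + 64 + 9 < 128`, and `9` comes from `m * h ≤ 9 * A`. -/
lemma CoreSol.lintegral_excess_ge (hu : CoreSol s p R β u) {A h : ℝ} (hA : 0 < A) (hh0 : 0 < h)
    (hhA : h ≤ A) {e x₁ y : EuclideanSpace ℝ (Fin d)} (he : ‖e‖ = 1)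
    (hx₁ : ‖x₁ - y‖ ≤ 64 * A) (hbig : 4 * A ≤ |u x₁ - u y|)
    (hsmall : ∀ z, ‖z - y‖ ≤ 128 * A → |u z - u y| < 8 * A) (hyR : ‖y‖ + 128 * A < R) :
    volume (ball (0 : EuclideanSpace ℝ (Fin d)) A) ≤
      9 * ∫⁻ x in ball y (128 * A), ENNReal.ofReal (excess A h e y u x) := by
  obtain ⟨m, v, hm, hv, hsum⟩ := hu.exists_shifts hA hh0 hhA he hx₁ hbig hsmall hyR
  set I := ∫⁻ x in ball y (128 * A), ENNReal.ofReal (excess A h e y u x) with hI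
  have hem := (measurable_excess hu.meas A h e y).ennreal_ofReal
  have each : ∀ j, j < m → ∫⁻ x in ball x₁ A, ENNReal.ofReal (excess A h e y u (x + v j)) ≤ I := by
    intro j hj
    have : ∫⁻ x in ball x₁ A, ENNReal.ofReal (excess A h e y u (x + v j))
        ≤ ∫⁻ x, indicator (ball y (128 * A))
          (fun x => ENNReal.ofReal (excess A h e y u x)) (x + v j) := by
      rw [← lintegral_indicator measurableSet_ball]
      refine lintegral_mono fun x => ?_
      by_cases hx : x ∈ ball x₁ A
      · rw [indicator_of_mem hx, indicator_of_mem]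
        have hx' : ‖x - x₁‖ < A := by simpa [dist_eq_norm] using hx
        rw [mem_ball, dist_eq_norm, show x + v j - y = (x - x₁) + (x₁ - y) + v j by abel]
        have := norm_add_le ((x - x₁) + (x₁ - y)) (v j)
        have := norm_add_le (x - x₁) (x₁ - y)
        have := hv j hj
        linarith
      · rw [indicator_of_notMem hx]; exact zero_le
    refine this.trans (le_of_eq ?_)
    rw [lintegral_add_right_eq_self (fun x => indicator (ball y (128 * A))
          (fun x => ENNReal.ofReal (excess A h e y u x)) x), lintegral_indicator measurableSet_ball]
  have h1 : ENNReal.ofReal A * volume (ball x₁ A)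
      ≤ ∑ j ∈ Finset.range m, ENNReal.ofReal h * I := by
    calc ENNReal.ofReal A * volume (ball x₁ A)
        = ∫⁻ x in ball x₁ A, ENNReal.ofReal A := by rw [setLIntegral_const]
      _ ≤ ∫⁻ x in ball x₁ A, ∑ j ∈ Finset.range m,
          ENNReal.ofReal h * ENNReal.ofReal (excess A h e y u (x + v j)) := by
        refine setLIntegral_mono' measurableSet_ball fun x hx => ?_
        refine (ENNReal.ofReal_le_ofReal (hsum x hx)).trans (le_of_eq ?_)
        rw [ENNReal.ofReal_sum_of_nonneg fun j _ => mul_nonneg hh0.le (excess_nonneg _ _ _ _ _)]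
        exact Finset.sum_congr rfl fun j _ => ENNReal.ofReal_mul hh0.le
      _ = ∑ j ∈ Finset.range m, ENNReal.ofReal h *
          ∫⁻ x in ball x₁ A, ENNReal.ofReal (excess A h e y u (x + v j)) := by
        rw [lintegral_finsetSum]
        · refine Finset.sum_congr rfl fun j _ => ?_
          rw [lintegral_const_mul]
          exact hem.comp (measurable_add_const (v j))
        · exact fun j _ => (hem.comp (measurable_add_const (v j))).const_mul _
      _ ≤ _ := Finset.sum_le_sum fun j hj =>
          mul_le_mul_right (each j (Finset.mem_range.1 hj)) _
  rw [Finset.sum_const, Finset.card_range, nsmul_eq_mul, ← mul_assoc,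
    Measure.addHaar_ball_center] at h1
  have h2 : (m : ENNReal) * ENNReal.ofReal h ≤ ENNReal.ofReal A * 9 := by
    rw [← ENNReal.ofReal_natCast, ← ENNReal.ofReal_mul (by positivity),
      show (9 : ENNReal) = ENNReal.ofReal 9 by norm_num, ← ENNReal.ofReal_mul hA.le]
    exact ENNReal.ofReal_le_ofReal (by linarith)
  have h3 : ENNReal.ofReal A * volume (ball (0 : EuclideanSpace ℝ (Fin d)) A)
      ≤ ENNReal.ofReal A * (9 * I) := by
    rw [← mul_assoc]; exact h1.trans (mul_le_mul_left h2 _)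
  exact (ENNReal.mul_le_mul_iff_right (by simpa using hA) ENNReal.ofReal_ne_top).1 h3

end

/-! ### Lower bounds for the cross mass in spite of the degenerate kernel. -/

section
variable {d : ℕ} {s p R β : ℝ} {u : EuclideanSpace ℝ (Fin d) → ℝ}

/-- The volume of the unit ball. -/
noncomputable def unitVol (d : ℕ) : ℝ := volume.real (ball (0 : EuclideanSpace ℝ (Fin d)) 1)

lemma unitVol_pos (d : ℕ) : 0 < unitVol d :=
  ENNReal.toReal_pos (measure_ball_pos _ _ one_pos).ne' measure_ball_lt_top.ne

lemma volume_ball_eq (x : EuclideanSpace ℝ (Fin d)) {t : ℝ} (ht : 0 < t) :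
    volume (ball x t) = ENNReal.ofReal (t ^ d * unitVol d) := by
  rw [Measure.addHaar_ball_of_pos volume x ht, finrank_euclideanSpace, Fintype.card_fin,
    ENNReal.ofReal_mul (by positivity), unitVol, ofReal_measureReal measure_ball_lt_top.ne]

/-- Density threshold in the nondegeneracy estimate. -/
noncomputable def densConst (d : ℕ) : ℝ := 1 / 2 * (1 / 32) ^ d * unitVol d

/-- Constant in the nondegeneracy estimate at a flat scale. -/
noncomputable def flatConst (d : ℕ) (s p : ℝ) : ℝ :=
  unitVol d / 36 * (128 ^ ((d : ℝ) + s * p))⁻¹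

/-- Constant in the nondegeneracy estimate. -/
noncomputable def massConst (d : ℕ) (s p : ℝ) : ℝ :=
  min (flatConst d s p)
    (1 / 4 * (32 ^ (p - 2))⁻¹ * (2 ^ ((d : ℝ) + s * p))⁻¹ * densConst d)

lemma densConst_pos (d : ℕ) : 0 < densConst d := by
  have := unitVol_pos d; unfold densConst; positivity

lemma flatConst_pos (d : ℕ) (s p : ℝ) : 0 < flatConst d s p := by
  have := unitVol_pos d; unfold flatConst; positivity

lemma massConst_pos (d : ℕ) (s p : ℝ) : 0 < massConst d s p := by
  have := densConst_pos d
  have := flatConst_pos d s p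
  exact lt_min this (by positivity)

lemma pairKer_ge (hp2 : 2 ≤ p) {D r : ℝ} (hD : 1 ≤ D) (hr : 0 < r) (h : ℝ)
    {e x y : EuclideanSpace ℝ (Fin d)} (hxy : ‖x - y‖ ≤ r / 2) :
    1 / 4 * |u x - u y| ^ (p - 2) * (‖x - y‖ ^ D)⁻¹ ≤ pairKer p D r h e u x y := by
  have h1 := nearKer_ge (x - y) hD hr hxy
  have h2 := signPowSlope_ge hp2 (u x - u y) (u (x + h • e) - u (y + h • e))
  have := mul_le_mul h1 h2 (by positivity) (nearKer_nonneg _ (by linarith) hr)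
  refine le_trans (le_of_eq ?_) this
  ring

lemma pairKer_ge_of_le (hp2 : 2 ≤ p) {D r : ℝ} (hD : 1 ≤ D) (hr : 0 < r) (h : ℝ)
    {e x y : EuclideanSpace ℝ (Fin d)} {A B : ℝ} (hA : 0 < A) (hAu : A ≤ |u x - u y|)
    (hB : ‖x - y‖ ≤ B) (hBr : B ≤ r / 2) :
    1 / 4 * A ^ (p - 2) * (B ^ D)⁻¹ ≤ pairKer p D r h e u x y := by
  refine le_trans ?_ (pairKer_ge hp2 hD hr h (hB.trans hBr))
  have hne : x ≠ y := by
    rintro rfl; simp at hAu; linarith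
  have h0 : 0 < ‖x - y‖ := norm_pos_iff.2 (sub_ne_zero.2 hne)
  have hB0 : 0 < B := h0.trans_le hB
  gcongr

/-- Nondegeneracy at flat scales. -/
lemma CoreSol.crossMass_ge_of_flat (hu : CoreSol s p R β u) (hd : 1 ≤ d) (hs0 : 0 < s)
    (hp2 : 2 ≤ p) (hγ : 0 < 2 - p * (1 - s))
    {M r h h₀ : ℝ} (hM : 0 ≤ M) (hr : 2 * (M + 2) ≤ r) (hR : r + M + 3 ≤ R)
    {e x₀ y : EuclideanSpace ℝ (Fin d)} (he : ‖e‖ = 1) (hx₀ : ‖x₀‖ ≤ M)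
    (hh0 : 0 < h) (hhh : 128 * h ≤ h₀)
    {κ l ρ : ℝ} (hκ : 0 ≤ κ) (hκ4 : κ ≤ 1 / 4) (hl : 0 ≤ l) (hρ0 : 0 < ρ) (hρ1 : ρ ≤ 1)
    (hy : y ∈ ball x₀ 1)
    (hN : ∀ t, 0 < t → t ≤ h₀ → ∃ z, ‖z - y‖ ≤ t ∧ t / 16 ≤ |u z - u y|)
    (hflat : ∀ z, ‖z - y‖ ≤ ρ → |u z - u y| < ρ / 16) :
    ENNReal.ofReal (flatConst d s p * ρ ^ (-(2 - p * (1 - s))))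
      ≤ crossMass p ((d : ℝ) + s * p) r κ l h x₀ e u y := by
  have hsp : 0 < s * p := mul_pos hs0 (by linarith)
  have hd' : (1 : ℝ) ≤ d := by exact_mod_cast hd
  set D : ℝ := (d : ℝ) + s * p with hDdef
  clear_value D
  have hD1 : 1 ≤ D := by linarith
  have hr0 : 0 < r := by linarith
  have hyn := norm_lt_add_one_of_mem_ball hx₀ hy
  have hex : ∃ i : ℕ, ∃ z, ‖z - y‖ ≤ ρ / 2 ^ i ∧ ρ / 2 ^ i / 16 ≤ |u z - u y| := by
    have hh₀ : 0 < h₀ := by linarith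
    obtain ⟨i, hi⟩ := exists_pow_lt_of_lt_one (show 0 < h₀ / ρ by positivity)
      (by norm_num : (1 / 2 : ℝ) < 1)
    refine ⟨i, hN _ (by positivity) ?_⟩
    rw [lt_div_iff₀ hρ0, one_div, inv_pow, inv_mul_eq_div] at hi
    exact hi.le
  classical
  obtain ⟨x₁, hx₁, hbig⟩ := Nat.find_spec hex
  -- The largest dyadic fraction of `ρ` at which the oscillation reaches a sixteenth of the radius.
  -- It exists because `u` is nondegenerate below `h₀`, and it is not `ρ` itself because `u` is flat
  -- there.
  set i := Nat.find hex with hi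
  have hi0 : i ≠ 0 := by
    intro h0
    rw [h0, pow_zero, div_one] at hx₁ hbig
    linarith [hflat x₁ hx₁]
  obtain ⟨k, hk⟩ := Nat.exists_eq_succ_of_ne_zero hi0
  have hmin : ¬ ∃ z, ‖z - y‖ ≤ ρ / 2 ^ k ∧ ρ / 2 ^ k / 16 ≤ |u z - u y| :=
    Nat.find_min hex (by omega)
  -- With this unit the critical radius is `64A` with oscillation at least `4A`, whereas at radius
  -- `128A` the deviation is below `8A`.
  set A : ℝ := ρ / 2 ^ i / 64 with hA
  have hA0 : 0 < A := by positivity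
  have hk2 : ρ / 2 ^ k = 128 * A := by
    rw [hA, hk, pow_succ]; field_simp; norm_num
  rw [hk2] at hmin
  have hsmall : ∀ z, ‖z - y‖ ≤ 128 * A → |u z - u y| < 8 * A := by
    intro z hz
    by_contra hc
    exact hmin ⟨z, hz, by linarith [not_lt.1 hc]⟩
  -- Otherwise `128A ≤ 128h ≤ h₀`, and nondegeneracy at scale `128A` contradicts the choice of `i`.
  have hhA : h ≤ A := by
    by_contra hc
    have : 128 * A ≤ h₀ := by linarith [not_le.1 hc]
    exact hmin (hN _ (by positivity) this)
  have hAρ : 128 * A ≤ ρ := by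
    rw [← hk2]; exact div_le_self hρ0.le (one_le_pow₀ (by norm_num))
  have hvol := hu.lintegral_excess_ge hA0 hh0 hhA he (x₁ := x₁) (y := y)
    (by rw [hA]; linarith) (by rw [hA]; linarith) hsmall (by linarith)
  rw [volume_ball_eq _ hA0] at hvol
  set I := ∫⁻ x in ball y (128 * A), ENNReal.ofReal (excess A h e y u x) with hI
  set k0 : ℝ := 1 / 4 * A ^ (p - 2) * ((128 * A) ^ D)⁻¹ with hk0
  have hk0' : 0 ≤ k0 := by positivity
  have lower : ENNReal.ofReal k0 * I ≤ crossMass p D r κ l h x₀ e u y := by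
    rw [hI, ← lintegral_const_mul _ (measurable_excess hu.meas A h e y).ennreal_ofReal]
    unfold crossMass
    refine le_trans ?_ (setLIntegral_le_lintegral (ball y (128 * A)) _)
    refine setLIntegral_mono' measurableSet_ball fun x hx => ?_
    have hxy : ‖x - y‖ ≤ 128 * A := by
      have : ‖x - y‖ < 128 * A := by simpa [dist_eq_norm] using hx
      exact this.le
    rw [← ENNReal.ofReal_mul hk0']
    refine ENNReal.ofReal_le_ofReal ?_
    rw [excess]
    split_ifs with hc
    · refine mul_le_mul (pairKer_ge_of_le hp2 hD1 hr0 h hA0 hc hxy (by linarith)) ?_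
        (le_max_right _ _) (pairKer_nonneg hp2 (by linarith) hr0 _ _ _)
      have := cone_le hκ x₀ x
      exact max_le_max (by linarith) le_rfl
    · rw [mul_zero]
      exact mul_nonneg (pairKer_nonneg hp2 (by linarith) hr0 _ _ _) (le_max_right _ _)
  -- The powers of `A` add up to `(p - 2) - D + d = -γ`; since `A ≤ ρ`, a smaller critical scale
  -- only helps.
  have val : flatConst d s p * ρ ^ (-(2 - p * (1 - s))) ≤ k0 * (A ^ d * unitVol d) / 9 := by
    have e1 : k0 * (A ^ d * unitVol d) / 9 = flatConst d s p * A ^ (-(2 - p * (1 - s))) := by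
      rw [hk0, flatConst, ← hDdef, Real.mul_rpow (by norm_num) hA0.le, ← Real.rpow_natCast A d,
        show -(2 - p * (1 - s)) = (p - 2) + (-D) + d by rw [hDdef]; ring,
        Real.rpow_add hA0, Real.rpow_add hA0, Real.rpow_neg hA0.le, mul_inv]
      ring
    rw [e1]
    refine mul_le_mul_of_nonneg_left ?_ (flatConst_pos d s p).le
    exact Real.rpow_le_rpow_of_nonpos hA0 (by linarith) (by linarith)
  refine (ENNReal.ofReal_le_ofReal val).trans (le_trans ?_ lower)
  rw [ENNReal.ofReal_div_of_pos (by norm_num), ENNReal.ofReal_mul hk0']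
  refine ENNReal.div_le_of_le_mul ?_
  rw [mul_assoc]
  refine mul_le_mul_right (hvol.trans (le_of_eq ?_)) _
  rw [mul_comm]; norm_num

/-- Nondegeneracy: where the lower level sets are small in measure, the cross mass is large. -/
lemma CoreSol.crossMass_ge (hu : CoreSol s p R β u) (hd : 1 ≤ d) (hs0 : 0 < s)
    (hp2 : 2 ≤ p) (hγ : 0 < 2 - p * (1 - s))
    {M r h h₀ : ℝ} (hM : 0 ≤ M) (hr : 2 * (M + 2) ≤ r) (hR : r + M + 3 ≤ R)
    {e x₀ y : EuclideanSpace ℝ (Fin d)} (he : ‖e‖ = 1) (hx₀ : ‖x₀‖ ≤ M)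
    (hh0 : 0 < h) (hh1 : h ≤ 1) (hhh : 128 * h ≤ h₀)
    {κ l l' ρ : ℝ} (hκ : 0 ≤ κ) (hκ4 : κ ≤ 1 / 4) (hl' : 0 ≤ l') (hll : l' ≤ l) (hlκ : l ≤ κ)
    (hρ0 : 0 < ρ) (hρ1 : ρ ≤ 1) (hy : y ∈ ball x₀ 1)
    (hN : ∀ t, 0 < t → t ≤ h₀ → ∃ z, ‖z - y‖ ≤ t ∧ t / 16 ≤ |u z - u y|)
    (hvol : volume (belowCone κ l' h x₀ e u) ≤ ENNReal.ofReal (densConst d * ρ ^ d)) :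
    ENNReal.ofReal (massConst d s p * (l - l') * ρ ^ (-(2 - p * (1 - s))))
      ≤ crossMass p ((d : ℝ) + s * p) r κ l h x₀ e u y := by
  have hsp : 0 < s * p := mul_pos hs0 (by linarith)
  have hd' : (1 : ℝ) ≤ d := by exact_mod_cast hd
  by_cases hflat : ∀ z, ‖z - y‖ ≤ ρ → |u z - u y| < ρ / 16
  · refine le_trans (ENNReal.ofReal_le_ofReal ?_)
      (hu.crossMass_ge_of_flat hd hs0 hp2 hγ hM hr hR he hx₀ hh0 hhh hκ hκ4 (hl'.trans hll)
        hρ0 hρ1 hy hN hflat)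
    have h1 : massConst d s p * (l - l') ≤ flatConst d s p :=
      (mul_le_of_le_one_right (massConst_pos d s p).le (by linarith)).trans (min_le_left _ _)
    exact mul_le_mul_of_nonneg_right h1 (by positivity)
  push Not at hflat
  obtain ⟨x₁, hx₁, hbig⟩ := hflat
  set D : ℝ := (d : ℝ) + s * p with hDdef
  clear_value D
  have hD1 : 1 ≤ D := by linarith
  have hr0 : 0 < r := by linarith
  have hyn := norm_lt_add_one_of_mem_ball hx₀ hy
  set S := belowCone κ l' h x₀ e u with hS
  have hSm : MeasurableSet S := measurableSet_belowCone hu.meas _ _ _ _ _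
  set X := ball x₁ (ρ / 32) \ S with hX
  have hXm : MeasurableSet X := measurableSet_ball.diff hSm
  -- The ball of radius `ρ / 32` has twice the volume allowed for `S`, so at least half of it is
  -- left. On it `u` still differs from `u y` by `ρ / 32`, since `u` is 1-Lipschitz.
  have hXv : ENNReal.ofReal (densConst d * ρ ^ d) ≤ volume X := by
    have h1 : volume (ball x₁ (ρ / 32)) = ENNReal.ofReal (densConst d * ρ ^ d)
        + ENNReal.ofReal (densConst d * ρ ^ d) := by
      have hc := densConst_pos d
      rw [volume_ball_eq _ (by positivity), ← ENNReal.ofReal_add (by positivity) (by positivity)]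
      congr 1; rw [densConst, div_pow, div_pow]; ring
    have h2 := le_measure_sdiff (μ := volume) (s₁ := ball x₁ (ρ / 32)) (s₂ := S)
    rw [h1] at h2
    refine le_trans ?_ h2
    refine ENNReal.le_sub_of_add_le_right ?_ (add_le_add_right hvol _)
    exact (hvol.trans_lt ENNReal.ofReal_lt_top).ne
  set k0 : ℝ := 1 / 4 * (ρ / 32) ^ (p - 2) * ((2 * ρ) ^ D)⁻¹ with hk0
  have hk0' : 0 ≤ k0 := by positivity
  have hll' : 0 ≤ l - l' := by linarith
  have lower : ENNReal.ofReal (k0 * (l - l')) * volume X ≤ crossMass p D r κ l h x₀ e u y := by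
    rw [← setLIntegral_const]
    unfold crossMass
    refine le_trans ?_ (setLIntegral_le_lintegral X _)
    refine setLIntegral_mono' hXm fun x hx => ENNReal.ofReal_le_ofReal ?_
    have hxx : ‖x - x₁‖ < ρ / 32 := by simpa [dist_eq_norm] using hx.1
    have hxy : ‖x - y‖ ≤ 2 * ρ := by
      have := norm_add_le (x - x₁) (x₁ - y)
      rw [sub_add_sub_cancel] at this
      linarith
    have hxn : ‖x‖ + 1 < R := by
      have := norm_add_le y (x - y)
      rw [add_sub_cancel] at this
      linarith
    have hx1n : ‖x₁‖ < R := by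
      have := norm_add_le y (x₁ - y)
      rw [add_sub_cancel] at this
      linarith
    have hux : ρ / 32 ≤ |u x - u y| := by
      have h1 := hu.lip x (by simpa using (by linarith : ‖x‖ < R)) x₁ (by simpa using hx1n)
      have h2 := abs_sub_abs_le_abs_sub (u x₁ - u y) (u x₁ - u x)
      rw [sub_sub_sub_cancel_left, abs_sub_comm (u x₁) (u x)] at h2
      linarith
    refine mul_le_mul (pairKer_ge_of_le hp2 hD1 hr0 h (by positivity) hux hxy (by linarith)) ?_
      hll' (pairKer_nonneg hp2 (by linarith) hr0 _ _ _)
    refine le_trans ?_ (le_max_left _ _)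
    -- Outside `S` the defect is at least the cone lowered by `l'`, so the truncation at level `l`
    -- is at least `l - l'`.
    by_cases hb : x ∈ ball x₀ 1
    · have : ¬ defect h e u x < cone κ x₀ x - l' := fun h' => hx.2 ⟨hb, h'⟩
      linarith [not_lt.1 this]
    · rw [cone_eq_zero hb]
      have := (hu.defect_mem hh0 hh1 he hxn).1
      linarith
  refine le_trans ?_ lower
  refine le_trans ?_ (mul_le_mul_right hXv _)
  rw [← ENNReal.ofReal_mul (by positivity)]
  refine ENNReal.ofReal_le_ofReal ?_
  have e1 : k0 * (l - l') * (densConst d * ρ ^ d)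
      = (1 / 4 * (32 ^ (p - 2))⁻¹ * (2 ^ D)⁻¹ * densConst d) * (l - l')
        * ρ ^ (-(2 - p * (1 - s))) := by
    rw [hk0, Real.mul_rpow (by norm_num) hρ0.le, Real.div_rpow hρ0.le (by norm_num),
      ← Real.rpow_natCast ρ d,
      show -(2 - p * (1 - s)) = (p - 2) + (-D) + d by rw [hDdef]; ring,
      Real.rpow_add hρ0, Real.rpow_add hρ0, Real.rpow_neg hρ0.le, mul_inv]
    ring
  rw [e1, hDdef]
  exact mul_le_mul_of_nonneg_right (mul_le_mul_of_nonneg_right (min_le_right _ _) hll')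
    (by positivity)

end

/-! ### De Giorgi iteration below the cone. -/

section
variable {d : ℕ} {s p R β : ℝ} {u : EuclideanSpace ℝ (Fin d) → ℝ}

lemma CoreSol.differentiableAt (hu : CoreSol s p R β u) {x : EuclideanSpace ℝ (Fin d)}
    (hx : ‖x‖ < R) : DifferentiableAt ℝ u x :=
  (hu.diff.contDiffAt (isOpen_ball.mem_nhds (by simpa using hx))).differentiableAt (by norm_num)

lemma CoreSol.continuousOn_fderiv (hu : CoreSol s p R β u) :
    ContinuousOn (fderiv ℝ u) (ball 0 R) :=
  hu.diff.continuousOn_fderiv_of_isOpen isOpen_ball le_rfl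

/-- Uniform first order Taylor expansion. -/
lemma CoreSol.exists_taylor (hu : CoreSol s p R β u) {M ε : ℝ} (hM : M + 1 < R) (hε : 0 < ε) :
    ∃ η, 0 < η ∧ η ≤ 1 ∧ ∀ x y, ‖x‖ ≤ M → ‖y - x‖ ≤ η →
      |u y - u x - fderiv ℝ u x (y - x)| ≤ ε * ‖y - x‖ := by
  have hc : IsCompact (closedBall (0 : EuclideanSpace ℝ (Fin d)) (M + 1)) := isCompact_closedBall _ _
  have huc := hc.uniformContinuousOn_of_continuous
    (hu.continuousOn_fderiv.mono (closedBall_subset_ball hM))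
  obtain ⟨η, hη0, hη⟩ := Metric.uniformContinuousOn_iff_le.1 huc ε hε
  refine ⟨min η 1, by positivity, min_le_right _ _, fun x y hx hxy => ?_⟩
  have key := (convex_closedBall x (min η 1)).norm_image_sub_le_of_norm_fderiv_le'
    (f := u) (φ := fderiv ℝ u x) (C := ε) (x := x) (y := y) ?_ ?_ ?_ ?_
  · exact key
  · intro z hz
    have hz' : ‖z - x‖ ≤ min η 1 := by simpa [dist_eq_norm] using hz
    have := norm_add_le x (z - x)
    rw [add_sub_cancel] at this
    exact hu.differentiableAt (by linarith [min_le_right η 1])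
  · intro z hz
    have hz' : ‖z - x‖ ≤ min η 1 := by simpa [dist_eq_norm] using hz
    have := norm_add_le x (z - x)
    rw [add_sub_cancel] at this
    have := hη z (by simp; linarith [min_le_right η 1]) x (by simp; linarith)
      (by rw [dist_eq_norm]; exact hz'.trans (min_le_left _ _))
    rwa [dist_eq_norm] at this
  · exact mem_closedBall_self (by positivity)
  · simpa [dist_eq_norm] using hxy

/-- A small defect at one small step `h` gives a difference quotient at least `3/4`, hence a
derivative at least `5/8` along `e`, hence growth at rate at least `1/2` for all steps up to `h₀`.
The scale `h₀` depends on the modulus of continuity of `∇u`, but no constant of the final estimates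
depends on it. -/
lemma CoreSol.exists_nondegenerate_scale (hu : CoreSol s p R β u) {M : ℝ} (hM : M + 1 < R) :
    ∃ h₀, 0 < h₀ ∧ ∀ h, 0 < h → h ≤ h₀ → ∀ e : EuclideanSpace ℝ (Fin d), ‖e‖ = 1 →
      ∀ y, ‖y‖ ≤ M → defect h e u y ≤ 1 / 4 →
      ∀ t, 0 < t → t ≤ h₀ → ∃ z, ‖z - y‖ ≤ t ∧ t / 16 ≤ |u z - u y| := by
  obtain ⟨η, hη0, -, hη⟩ := hu.exists_taylor hM (by norm_num : (0 : ℝ) < 1 / 8)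
  refine ⟨η, hη0, fun h hh0 hh e he y hy hdef t ht0 ht => ⟨y + t • e, ?_, ?_⟩⟩
  · rw [add_sub_cancel_left, norm_smul_unit he, abs_of_pos ht0]
  have step : ∀ t, 0 < t → t ≤ η →
      |u (y + t • e) - u y - t * fderiv ℝ u y e| ≤ 1 / 8 * t := by
    intro t ht0 ht
    have := hη y (y + t • e) hy
      (by rwa [add_sub_cancel_left, norm_smul_unit he, abs_of_pos ht0])
    rwa [add_sub_cancel_left, norm_smul_unit he, abs_of_pos ht0, map_smul, smul_eq_mul] at this
  have h1 := (abs_le.1 (step h hh0 hh)).2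
  have h2 := (abs_le.1 (step t ht0 ht)).1
  have h3 : 3 / 4 * h ≤ u (y + h • e) - u y := by
    rw [← le_div_iff₀ hh0]; unfold defect at hdef; linarith
  have h4 : 5 / 8 ≤ fderiv ℝ u y e := by
    by_contra hc
    have := mul_lt_mul_of_pos_left (not_le.1 hc) hh0
    linarith
  have h5 := mul_le_mul_of_nonneg_left h4 ht0.le
  exact le_trans (by linarith) (le_abs_self _)

lemma belowCone_subset {κ l l' h : ℝ} (hll : l ≤ l') (x₀ e : EuclideanSpace ℝ (Fin d)) :
    belowCone κ l' h x₀ e u ⊆ belowCone κ l h x₀ e u :=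
  fun _ hx => ⟨hx.1, hx.2.trans_le (by linarith)⟩

/-- One step of the level set iteration. -/
lemma CoreSol.volume_belowCone_step (hu : CoreSol s p R β u) (hd : 1 ≤ d) (hs0 : 0 < s)
    (hs1 : s < 1) (hp2 : 2 ≤ p) (hβ : 0 ≤ β) (hγ : 0 < 2 - p * (1 - s))
    {M r h h₀ : ℝ} (hM : 0 ≤ M) (hr : 2 * (M + 2) ≤ r) (hR : r + M + 3 ≤ R)
    {e x₀ : EuclideanSpace ℝ (Fin d)} (he : ‖e‖ = 1) (hx₀ : ‖x₀‖ ≤ M)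
    (hh0 : 0 < h) (hh1 : h ≤ 1) (hhh : 128 * h ≤ h₀)
    {κ : ℝ} (hκ : 0 ≤ κ) (hκ4 : κ ≤ 1 / 4)
    (hfar : farConst d s p * (farMass d (2 - p * (1 - s)) r + β) ≤ κ)
    (hN : ∀ y ∈ ball x₀ 1, defect h e u y ≤ 1 / 4 →
      ∀ t, 0 < t → t ≤ h₀ → ∃ z, ‖z - y‖ ≤ t ∧ t / 16 ≤ |u z - u y|)
    {l Δ ρ : ℝ} (hl : 0 ≤ l) (hΔ : 0 < Δ) (hlκ : l + Δ ≤ κ) (hρ0 : 0 < ρ) (hρ1 : ρ ≤ 1)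
    (hvol : volume (belowCone κ l h x₀ e u) ≤ ENNReal.ofReal (densConst d * ρ ^ d)) :
    ENNReal.ofReal (Δ ^ 2 * massConst d s p * ρ ^ (-(2 - p * (1 - s))))
        * volume (belowCone κ (l + 2 * Δ) h x₀ e u)
      ≤ ENNReal.ofReal (energyConst d s p * κ ^ 2) * volume (belowCone κ l h x₀ e u) := by
  -- The energy inequality is used at the intermediate level `l + Δ`: the test function is at least
  -- `Δ` on the set of level `l + 2Δ`, and the gap `Δ` above level `l` enters the lower bound for
  -- the cross mass. Hence the factor `Δ ^ 2`.
  refine le_trans ?_ (mul_le_mul_right (measure_mono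
    (belowCone_subset (by linarith : l ≤ l + Δ) x₀ e)) _)
  refine le_trans ?_ (hu.energy hd hs0 hs1 hp2 hβ hγ hM hr hR he hx₀ hh0 hh1 hκ
    (by linarith : 0 ≤ l + Δ) hfar)
  have hSm := measurableSet_belowCone hu.meas κ (l + 2 * Δ) h x₀ e
  rw [← setLIntegral_const]
  refine le_trans ?_ (setLIntegral_le_lintegral (belowCone κ (l + 2 * Δ) h x₀ e u) _)
  refine setLIntegral_mono' hSm fun y hy => ?_
  have hdef : defect h e u y ≤ 1 / 4 := by linarith [cone_le hκ x₀ y, hy.2]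
  have h1 := hu.crossMass_ge hd hs0 hp2 hγ hM hr hR he hx₀ hh0 hh1 hhh hκ hκ4 hl
    (by linarith : l ≤ l + Δ) hlκ hρ0 hρ1 hy.1 (hN y hy.1 hdef) hvol
  have h2 : Δ ≤ coneTest κ (l + Δ) h x₀ e u y := by
    rw [coneTest, indicator_of_mem hy.1]
    exact le_trans (by linarith [hy.2]) (le_max_left _ _)
  refine le_trans ?_ (mul_le_mul' (ENNReal.ofReal_le_ofReal h2) h1)
  rw [← ENNReal.ofReal_mul hΔ.le]
  refine ENNReal.ofReal_le_ofReal (le_of_eq ?_)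
  ring

/-- Level set iteration: a point with small defect is surrounded by many points with small
defect. -/
lemma exists_density (d : ℕ) (s p : ℝ) (hγ : 0 < 2 - p * (1 - s)) :
    ∃ ν, 0 < ν ∧ ∀ {R β : ℝ} {u : EuclideanSpace ℝ (Fin d) → ℝ}, CoreSol s p R β u → 1 ≤ d →
    0 < s → s < 1 → 2 ≤ p → 0 ≤ β →
    ∀ {M r h h₀ : ℝ}, 0 ≤ M → 2 * (M + 2) ≤ r → r + M + 3 ≤ R →
    ∀ {e x₀ : EuclideanSpace ℝ (Fin d)}, ‖e‖ = 1 → ‖x₀‖ ≤ M →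
    0 < h → h ≤ 1 → 128 * h ≤ h₀ → ∀ {κ : ℝ}, 0 < κ → κ ≤ 1 / 4 →
    farConst d s p * (farMass d (2 - p * (1 - s)) r + β) ≤ κ →
    (∀ y ∈ ball x₀ 1, defect h e u y ≤ 1 / 4 →
      ∀ t, 0 < t → t ≤ h₀ → ∃ z, ‖z - y‖ ≤ t ∧ t / 16 ≤ |u z - u y|) →
    defect h e u x₀ < κ / 2 →
    ENNReal.ofReal ν ≤ volume (belowCone κ (κ / 4) h x₀ e u) := by
  set γ := 2 - p * (1 - s) with hγdef
  set mc := massConst d s p with hmc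
  have hmc0 : 0 < mc := massConst_pos d s p
  -- The radii shrink so that `ρ j ^ (-γ)` grows like `4^j` and compensates the loss `4^(-j)` in `Δ
  -- j ^ 2`.
  set q : ℝ := (1 / 4 : ℝ) ^ (1 / γ) with hq
  have hq0 : 0 < q := by positivity
  have hq1 : q ≤ 1 := Real.rpow_le_one (by norm_num) (by norm_num) (by positivity)
  have hqγ : q ^ γ = 1 / 4 := by
    rw [hq, ← Real.rpow_mul (by norm_num), one_div_mul_cancel hγ.ne', Real.rpow_one]
  -- Large enough for each step to gain the factor `q ^ d`, which is the ratio of the consecutive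
  -- volumes `ρ j ^ d`.
  set K : ℝ := max 1 (energyConst d s p * 256 / (mc * q ^ d)) with hK
  have hK1 : 1 ≤ K := le_max_left _ _
  have hK0 : 0 < K := by linarith
  set ρ₀ : ℝ := K ^ (-(1 / γ)) with hρ₀
  have hρ₀0 : 0 < ρ₀ := by positivity
  have hρ₀1 : ρ₀ ≤ 1 := Real.rpow_le_one_of_one_le_of_nonpos hK1 (by
    have : 0 < 1 / γ := by positivity
    linarith)
  have hρ₀γ : ρ₀ ^ (-γ) = K := by
    rw [hρ₀, ← Real.rpow_mul hK0.le, neg_mul_neg, one_div_mul_cancel hγ.ne', Real.rpow_one]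
  have hdc := densConst_pos d
  refine ⟨densConst d * ρ₀ ^ d, by positivity, ?_⟩
  intro R β u hu hd hs0 hs1 hp2 hβ M r h h₀ hM hr hR e x₀ he hx₀ hh0 hh1 hhh κ hκ hκ4 hfar hN hdef
  by_contra hcon
  rw [not_le] at hcon
  -- Levels increase from `κ / 4` to `κ / 2`; each step is twice `Δ j`.
  set l : ℕ → ℝ := fun j => κ / 2 - κ / 4 * (1 / 2) ^ j with hl
  set Δ : ℕ → ℝ := fun j => κ / 16 * (1 / 2) ^ j with hΔ
  set ρ : ℕ → ℝ := fun j => q ^ j * ρ₀ with hρ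
  have pow_half : ∀ j : ℕ, ((1 : ℝ) / 2) ^ j ≤ 1 := fun j => pow_le_one₀ (by norm_num) (by norm_num)
  have pow_half0 : ∀ j : ℕ, 0 < ((1 : ℝ) / 2) ^ j := fun j => by positivity
  have hsucc : ∀ j, l j + 2 * Δ j = l (j + 1) := fun j => by simp only [hl, hΔ, pow_succ]; ring
  have hρ0 : ∀ j, 0 < ρ j := fun j => by simp only [hρ]; positivity
  have hρ1 : ∀ j, ρ j ≤ 1 := fun j =>
    mul_le_one₀ (pow_le_one₀ hq0.le hq1) hρ₀0.le hρ₀1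
  have decay : ∀ j, volume (belowCone κ (l j) h x₀ e u)
      ≤ ENNReal.ofReal (densConst d * ρ j ^ d) := by
    intro j
    induction j with
    | zero =>
      have : l 0 = κ / 4 := by simp only [hl, pow_zero]; ring
      rw [this]; simpa [hρ] using hcon.le
    | succ j ih =>
      have hj1 := mul_le_mul_of_nonneg_left (pow_half j) hκ.le
      have hj0 := mul_pos hκ (pow_half0 j)
      have step := hu.volume_belowCone_step hd hs0 hs1 hp2 hβ hγ hM hr hR he hx₀ hh0 hh1 hhh hκ.le
        hκ4 hfar hN (l := l j) (Δ := Δ j) (ρ := ρ j) (by simp only [hl]; linarith)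
        (by simp only [hΔ]; positivity) (by simp only [hl, hΔ]; linarith) (hρ0 j) (hρ1 j) ih
      rw [hsucc] at step
      -- The constant is proportional to `κ ^ 2`, like the right side of the energy inequality, so
      -- `ν` does not depend on `κ`.
      have ha : Δ j ^ 2 * massConst d s p * ρ j ^ (-γ) = κ ^ 2 / 256 * mc * K := by
        have e1 : ρ j ^ (-γ) = 4 ^ j * K := by
          simp only [hρ]
          rw [Real.mul_rpow (by positivity) hρ₀0.le, hρ₀γ, Real.rpow_neg (by positivity),
            ← Real.rpow_natCast q j, ← Real.rpow_mul hq0.le, mul_comm (j : ℝ), Real.rpow_mul hq0.le,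
            hqγ, Real.rpow_natCast, ← inv_pow]
          norm_num
        rw [e1]
        simp only [hΔ]
        have e2 : ((1 : ℝ) / 2) ^ j * (1 / 2) ^ j * 4 ^ j = 1 := by
          rw [← mul_pow, ← mul_pow]; norm_num
        calc _ = κ ^ 2 / 256 * mc * K * (((1 : ℝ) / 2) ^ j * (1 / 2) ^ j * 4 ^ j) := by ring
          _ = _ := by rw [e2, mul_one]
      rw [ha] at step
      set a := κ ^ 2 / 256 * mc * K with hadef
      have ha0 : 0 < a := by positivity
      have h1 : ENNReal.ofReal a * volume (belowCone κ (l (j + 1)) h x₀ e u)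
          ≤ ENNReal.ofReal a * ENNReal.ofReal (densConst d * ρ (j + 1) ^ d) := by
        refine step.trans ((mul_le_mul_right ih _).trans ?_)
        have hdρ : 0 ≤ densConst d * ρ j ^ d := by have := hρ0 j; positivity
        rw [← ENNReal.ofReal_mul' hdρ, ← ENNReal.ofReal_mul ha0.le]
        refine ENNReal.ofReal_le_ofReal ?_
        have e3 : densConst d * ρ (j + 1) ^ d = q ^ d * (densConst d * ρ j ^ d) := by
          simp only [hρ, pow_succ]; ring
        rw [e3, ← mul_assoc a]
        refine mul_le_mul_of_nonneg_right ?_ hdρ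
        have h3 : energyConst d s p * 256 ≤ K * (mc * q ^ d) := by
          rw [← div_le_iff₀ (by positivity)]; exact le_max_right _ _
        rw [hadef]
        nlinarith [mul_le_mul_of_nonneg_right h3 (sq_nonneg κ)]
      exact (ENNReal.mul_le_mul_iff_right (by simpa using ha0) ENNReal.ofReal_ne_top).1 h1
  have hzero : volume (belowCone κ (κ / 2) h x₀ e u) = 0 := by
    by_cases hq1' : q < 1
    · have lim : Tendsto (fun j => ENNReal.ofReal (densConst d * ρ j ^ d)) atTop (𝓝 0) := by
        have h1 : Tendsto ρ atTop (𝓝 (0 * ρ₀)) :=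
          (tendsto_pow_atTop_nhds_zero_of_lt_one hq0.le hq1').mul_const _
        have h2 := ENNReal.tendsto_ofReal ((h1.pow d).const_mul (densConst d))
        rwa [zero_mul, zero_pow (by omega), mul_zero, ENNReal.ofReal_zero] at h2
      refine le_antisymm (ge_of_tendsto' lim fun j => ?_) zero_le
      refine (measure_mono (belowCone_subset ?_ x₀ e)).trans (decay j)
      have := mul_pos hκ (pow_half0 j)
      simp only [hl]; linarith
    · exact absurd (Real.rpow_lt_one (by norm_num) (by norm_num) (by positivity)) hq1'
  have hcont : ContinuousAt (defect h e u) x₀ := by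
    have hRpos : M + 3 < R := by linarith
    have c1 : ContinuousAt u x₀ := (hu.differentiableAt (by linarith)).continuousAt
    have c2 : ContinuousAt u (x₀ + h • e) := by
      refine (hu.differentiableAt ?_).continuousAt
      have := norm_add_le x₀ (h • e)
      rw [norm_smul_unit he, abs_of_pos hh0] at this
      linarith
    have c3 : ContinuousAt (fun x => u (x + h • e)) x₀ :=
      ContinuousAt.comp (f := fun x => x + h • e) c2 (by fun_prop)
    unfold defect
    fun_prop
  -- The cone equals `κ` at its vertex `x₀`, so by continuity a whole neighbourhood lies below the
  -- cone lowered by `κ / 2`, against the vanishing measure.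
  have hev : ∀ᶠ x in 𝓝 x₀, x ∈ belowCone κ (κ / 2) h x₀ e u := by
    have hlt : defect h e u x₀ < cone κ x₀ x₀ - κ / 2 := by
      simp only [cone, sub_self, norm_zero, sub_zero]
      rw [max_eq_left zero_le_one]; linarith
    have := hcont.eventually_lt ((continuous_cone κ x₀).continuousAt.sub_const (κ / 2)) hlt
    filter_upwards [this, ball_mem_nhds x₀ one_pos] with x h1 h2 using ⟨h2, h1⟩
  obtain ⟨t, ht0, ht⟩ := Metric.eventually_nhds_iff_ball.1 hev
  exact ((measure_ball_pos volume x₀ ht0).trans_le (measure_mono ht)).ne' hzero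

end

/-! ### Consequences of an almost maximal slope. -/

section
variable {d : ℕ} {s p R β : ℝ} {u : EuclideanSpace ℝ (Fin d) → ℝ}

lemma CoreSol.exists_defect_lt (hu : CoreSol s p R β u) {κ h₀ : ℝ} (hκ : 0 < κ) (hh₀ : 0 < h₀)
    {x₀ e : EuclideanSpace ℝ (Fin d)} (he : ‖e‖ = 1) (hx₀ : ‖x₀‖ + 1 < R)
    (hgrad : 1 - κ / 4 < fderiv ℝ u x₀ e) : ∃ h, 0 < h ∧ h ≤ h₀ ∧ defect h e u x₀ < κ / 2 := by
  obtain ⟨η, hη0, -, hη⟩ := hu.exists_taylor hx₀ (by positivity : 0 < κ / 8)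
  refine ⟨min η h₀, by positivity, min_le_right _ _, ?_⟩
  have hpos : 0 < min η h₀ := by positivity
  have := hη x₀ (x₀ + min η h₀ • e) le_rfl
    (by rw [add_sub_cancel_left, norm_smul_unit he, abs_of_pos hpos]; exact min_le_left _ _)
  rw [add_sub_cancel_left, norm_smul_unit he, abs_of_pos hpos, map_smul, smul_eq_mul] at this
  have h1 := (abs_le.1 this).1
  have h2 := mul_lt_mul_of_pos_left hgrad hpos
  unfold defect
  rw [sub_lt_comm, lt_div_iff₀ hpos]
  nlinarith [mul_pos hκ hpos]

/-- Where `u` stays away from `u y` the kernel is bounded below, so the cross mass controls the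
integral of `(w - cone)₊`; replacing this by `w` costs at most `κ` per unit volume. -/
lemma CoreSol.lintegral_defect_le (hu : CoreSol s p R β u) (hp2 : 2 ≤ p) {D r κ h : ℝ}
    (hD : 1 ≤ D) (hr : 0 < r) (hκ : 0 ≤ κ) {c : ℝ} {x₀ e y : EuclideanSpace ℝ (Fin d)}
    (hcross : crossMass p D r κ 0 h x₀ e u y ≤ ENNReal.ofReal c)
    {A B a : ℝ} (hA : 0 < A) (hB : 0 < B) (ha : 0 < a) (hBr : B ≤ r / 2)
    {z : EuclideanSpace ℝ (Fin d)} (hz : ∀ x ∈ ball z a, A ≤ |u x - u y| ∧ ‖x - y‖ ≤ B) :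
    ∫⁻ x in ball z a, ENNReal.ofReal (defect h e u x)
      ≤ ENNReal.ofReal (c / (1 / 4 * A ^ (p - 2) * (B ^ D)⁻¹))
        + ENNReal.ofReal (κ * (a ^ d * unitVol d)) := by
  set k := 1 / 4 * A ^ (p - 2) * (B ^ D)⁻¹ with hk
  have hk0 : 0 < k := by positivity
  have hdm := measurable_defect hu.meas h e
  have hcm := (continuous_cone (d := d) κ x₀).measurable
  have h1 : ENNReal.ofReal k * ∫⁻ x in ball z a, ENNReal.ofReal (max (defect h e u x
      - cone κ x₀ x + 0) 0) ≤ ENNReal.ofReal c := by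
    refine le_trans ?_ hcross
    rw [← lintegral_const_mul _ (by fun_prop)]
    refine le_trans ?_ (setLIntegral_le_lintegral (ball z a) _)
    refine setLIntegral_mono' measurableSet_ball fun x hx => ?_
    rw [← ENNReal.ofReal_mul hk0.le]
    exact ENNReal.ofReal_le_ofReal (mul_le_mul_of_nonneg_right
      (pairKer_ge_of_le hp2 hD hr h hA (hz x hx).1 (hz x hx).2 hBr) (le_max_right _ _))
  have h2 : ∫⁻ x in ball z a, ENNReal.ofReal (max (defect h e u x - cone κ x₀ x + 0) 0)
      ≤ ENNReal.ofReal (c / k) := by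
    rw [ENNReal.ofReal_div_of_pos hk0, ENNReal.le_div_iff_mul_le
      (Or.inl (by simpa using hk0)) (Or.inl ENNReal.ofReal_ne_top), mul_comm]
    exact h1
  calc ∫⁻ x in ball z a, ENNReal.ofReal (defect h e u x)
      ≤ ∫⁻ x in ball z a, (ENNReal.ofReal (max (defect h e u x - cone κ x₀ x + 0) 0)
          + ENNReal.ofReal κ) := by
        refine lintegral_mono fun x => ?_
        rw [← ENNReal.ofReal_add (le_max_right _ _) hκ]
        refine ENNReal.ofReal_le_ofReal ?_
        have := le_max_left (defect h e u x - cone κ x₀ x + 0) 0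
        linarith [cone_le hκ x₀ x]
    _ = _ := by rw [lintegral_add_right _ measurable_const, setLIntegral_const]
    _ ≤ _ := by
      refine add_le_add h2 (le_of_eq ?_)
      rw [volume_ball_eq _ ha, ← ENNReal.ofReal_mul hκ]

/-- If the slope of `u` is nearly maximal at `x₀`, then the defect of some difference quotient is
small around a point `y` near `x₀`, in the weighted sense measured by `crossMass`. -/
lemma exists_evaluation (d : ℕ) (s p : ℝ) (hγ : 0 < 2 - p * (1 - s)) :
    ∃ C κ₀ : ℝ, 0 < C ∧ 0 < κ₀ ∧ ∀ {R β : ℝ} {u : EuclideanSpace ℝ (Fin d) → ℝ},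
    CoreSol s p R β u → 1 ≤ d → 0 < s → s < 1 → 2 ≤ p → 0 ≤ β →
    ∀ {M : ℝ}, 0 ≤ M → 4 * (M + 2) ≤ R →
    ∀ {κ : ℝ}, 0 < κ → κ ≤ κ₀ →
    farConst d s p * (farMass d (2 - p * (1 - s)) (R / 2) + β) ≤ κ →
    ∀ {e x₀ : EuclideanSpace ℝ (Fin d)}, ‖e‖ = 1 → ‖x₀‖ ≤ M → 1 - κ / 4 < fderiv ℝ u x₀ e →
    ∃ (h : ℝ) (y : EuclideanSpace ℝ (Fin d)), 0 < h ∧ h ≤ κ ∧ h ≤ 1 ∧ ‖y - x₀‖ ≤ 1 ∧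
      (∃ x, ‖x - y‖ ≤ 1 ∧ 1 / 16 ≤ |u x - u y|) ∧
      crossMass p ((d : ℝ) + s * p) (R / 2) κ 0 h x₀ e u y ≤ ENNReal.ofReal (C * κ) := by
  obtain ⟨ν, hν, hdens⟩ := exists_density d s p hγ
  have hV := unitVol_pos d
  have hfl := flatConst_pos d s p
  set E := energyConst d s p with hE
  -- If the cross mass exceeded `C κ` throughout `S`, where the test function is at least `κ / 4`
  -- and whose measure is at least `ν`, the energy inequality at level zero would fail. The `+ 1`
  -- makes the contradiction strict.
  set C := 4 * (|E| + 1) * unitVol d / ν with hC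
  have hC0 : 0 < C := by positivity
  refine ⟨C, min (1 / 4) (flatConst d s p / (2 * C)), hC0, by positivity, ?_⟩
  intro R β u hu hd hs0 hs1 hp2 hβ M hM hR κ hκ0 hκ hfar e x₀ he hx₀ hgrad
  have hκ4 : κ ≤ 1 / 4 := hκ.trans (min_le_left _ _)
  have hκC : C * κ < flatConst d s p := by
    have : κ ≤ flatConst d s p / (2 * C) := hκ.trans (min_le_right _ _)
    rw [le_div_iff₀ (by positivity)] at this
    linarith
  obtain ⟨h₀, hh₀, hscale⟩ := hu.exists_nondegenerate_scale (M := M + 1) (by linarith)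
  obtain ⟨h, hh0, hhle, hdef⟩ := hu.exists_defect_lt hκ0
    (by positivity : 0 < min κ (h₀ / 128)) he (by linarith) hgrad
  have hhκ : h ≤ κ := hhle.trans (min_le_left _ _)
  have hhh : 128 * h ≤ h₀ := by linarith [hhle.trans (min_le_right _ _)]
  have hh1 : h ≤ 1 := by linarith
  have hN : ∀ y ∈ ball x₀ 1, defect h e u y ≤ 1 / 4 →
      ∀ t, 0 < t → t ≤ h₀ → ∃ z, ‖z - y‖ ≤ t ∧ t / 16 ≤ |u z - u y| := fun y hy hdy =>
    hscale h hh0 (by linarith) e he y (norm_lt_add_one_of_mem_ball hx₀ hy).le hdy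
  have hr : 2 * (M + 2) ≤ R / 2 := by linarith
  have hR' : R / 2 + M + 3 ≤ R := by linarith
  have hvol := hdens hu hd hs0 hs1 hp2 hβ hM hr hR' he hx₀ hh0 hh1 hhh hκ0 hκ4 hfar hN hdef
  set S := belowCone κ (κ / 4) h x₀ e u with hS
  have hSm : MeasurableSet S := measurableSet_belowCone hu.meas _ _ _ _ _
  have hex : ∃ y ∈ S, crossMass p ((d : ℝ) + s * p) (R / 2) κ 0 h x₀ e u y
      ≤ ENNReal.ofReal (C * κ) := by
    by_contra hcon
    push Not at hcon
    have en := hu.energy hd hs0 hs1 hp2 hβ hγ hM hr hR' he hx₀ hh0 hh1 hκ0.le le_rfl hfar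
    have up : volume (belowCone κ 0 h x₀ e u) ≤ ENNReal.ofReal (unitVol d) := by
      refine (measure_mono fun _ hx => hx.1 : _ ≤ volume (ball x₀ 1)).trans (le_of_eq ?_)
      rw [volume_ball_eq _ one_pos, one_pow, one_mul]
    have low : ENNReal.ofReal (κ / 4 * (C * κ)) * ENNReal.ofReal ν
        ≤ ENNReal.ofReal (E * κ ^ 2) * ENNReal.ofReal (unitVol d) := by
      refine le_trans ?_ (en.trans (mul_le_mul_right up _))
      refine (mul_le_mul_right hvol _).trans ?_
      rw [← setLIntegral_const]
      refine le_trans ?_ (setLIntegral_le_lintegral S _)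
      refine setLIntegral_mono' hSm fun y hy => ?_
      rw [ENNReal.ofReal_mul (by positivity)]
      refine mul_le_mul' (ENNReal.ofReal_le_ofReal ?_) (hcon y hy).le
      rw [coneTest, indicator_of_mem hy.1]
      exact le_trans (by linarith [hy.2]) (le_max_left _ _)
    rw [← ENNReal.ofReal_mul (by positivity), ← ENNReal.ofReal_mul' hV.le] at low
    have e1 : κ / 4 * (C * κ) * ν = (|E| + 1) * κ ^ 2 * unitVol d := by
      rw [hC]; field_simp
    rw [e1] at low
    have h3 : E * κ ^ 2 * unitVol d < (|E| + 1) * κ ^ 2 * unitVol d := by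
      have := le_abs_self E
      gcongr; linarith
    exact absurd ((ENNReal.ofReal_lt_ofReal_iff (by positivity)).2 h3) (not_lt.2 low)
  obtain ⟨y, hy, hcross⟩ := hex
  refine ⟨h, y, hh0, hhκ, hh1, ?_, ?_, hcross⟩
  · have := hy.1
    rw [mem_ball, dist_eq_norm] at this
    exact this.le
  -- If `u` were flat around `y` at unit scale, the cross mass would be at least `flatConst d s p`,
  -- which exceeds `C * κ` by the choice of `κ₀`.
  · by_contra hcon
    push Not at hcon
    have hdy : defect h e u y ≤ 1 / 4 := by linarith [cone_le hκ0.le x₀ y, hy.2]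
    have := hu.crossMass_ge_of_flat hd hs0 hp2 hγ hM hr hR' he hx₀ hh0 hhh hκ0.le hκ4 le_rfl
      one_pos le_rfl hy.1 (hN y hy.1 hdy) (fun z hz => hcon z hz)
    rw [Real.one_rpow, mul_one] at this
    have h4 := this.trans hcross
    rw [ENNReal.ofReal_le_ofReal_iff (by positivity)] at h4
    linarith

/-- Summation of the defect along arithmetic progressions. -/
lemma sum_defect {h : ℝ} (hh : h ≠ 0) (e x : EuclideanSpace ℝ (Fin d)) (n : ℕ) :
    ∑ j ∈ Finset.range n, h * defect h e u (x + ((j : ℝ) * h) • e)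
      = n * h - (u (x + ((n : ℝ) * h) • e) - u x) := by
  induction n with
  | zero => simp
  | succ n ih =>
    rw [Finset.sum_range_succ, ih, defect,
      show x + ((n : ℝ) * h) • e + h • e = x + (((n + 1 : ℕ) : ℝ) * h) • e by push_cast; module]
    push_cast
    field_simp
    ring

lemma CoreSol.ofReal_sum_defect (hu : CoreSol s p R β u) {h : ℝ} (hh0 : 0 < h) (hh1 : h ≤ 1)
    {e x : EuclideanSpace ℝ (Fin d)} (he : ‖e‖ = 1) {n : ℕ} (hx : ‖x‖ + n * h + 1 < R) :
    ENNReal.ofReal (n * h - (u (x + ((n : ℝ) * h) • e) - u x))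
      = ∑ j ∈ Finset.range n,
        ENNReal.ofReal h * ENNReal.ofReal (defect h e u (x + ((j : ℝ) * h) • e)) := by
  rw [← sum_defect hh0.ne', ENNReal.ofReal_sum_of_nonneg]
  · exact Finset.sum_congr rfl fun j _ => ENNReal.ofReal_mul hh0.le
  · intro j hj
    refine mul_nonneg hh0.le (hu.defect_mem hh0 hh1 he ?_).1
    have h1 := norm_add_le x (((j : ℝ) * h) • e)
    rw [norm_smul_unit he, abs_of_nonneg (by positivity)] at h1
    have h2 : (j : ℝ) * h ≤ n * h :=
      mul_le_mul_of_nonneg_right (Nat.cast_le.2 (Finset.mem_range.1 hj).le) hh0.le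
    linarith

lemma lintegral_ball_add_le {f : EuclideanSpace ℝ (Fin d) → ENNReal}
    {z w v : EuclideanSpace ℝ (Fin d)} {ε a : ℝ} (hsub : ∀ x ∈ ball z ε, x + v ∈ ball w a) :
    ∫⁻ x in ball z ε, f (x + v) ≤ ∫⁻ x in ball w a, f x := by
  rw [← lintegral_indicator measurableSet_ball, ← lintegral_indicator measurableSet_ball,
    ← lintegral_add_right_eq_self (fun x => indicator (ball w a) f x) v]
  refine lintegral_mono fun x => ?_
  by_cases hx : x ∈ ball z ε
  · rw [indicator_of_mem hx, indicator_of_mem (hsub x hx)]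
  · rw [indicator_of_notMem hx]; exact zero_le

lemma CoreSol.lintegral_sum_defect_le (hu : CoreSol s p R β u) {h : ℝ} (hh0 : 0 < h) (hh1 : h ≤ 1)
    {e z w : EuclideanSpace ℝ (Fin d)} (he : ‖e‖ = 1) {n : ℕ} {ε a : ℝ}
    (hz : ‖z‖ + ε + n * h + 1 < R)
    (hsub : ‖z - w‖ + ε + n * h ≤ a) :
    ∫⁻ x in ball z ε, ENNReal.ofReal (n * h - (u (x + ((n : ℝ) * h) • e) - u x))
      ≤ ENNReal.ofReal (n * h) * ∫⁻ x in ball w a, ENNReal.ofReal (defect h e u x) := by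
  have hdm := measurable_defect hu.meas h e
  have hmem : ∀ x ∈ ball z ε, ‖x - z‖ < ε := fun x hx => by simpa [dist_eq_norm] using hx
  calc ∫⁻ x in ball z ε, ENNReal.ofReal (n * h - (u (x + ((n : ℝ) * h) • e) - u x))
      = ∫⁻ x in ball z ε, ∑ j ∈ Finset.range n,
        ENNReal.ofReal h * ENNReal.ofReal (defect h e u (x + ((j : ℝ) * h) • e)) := by
        refine setLIntegral_congr_fun measurableSet_ball fun x hx => ?_
        have := norm_add_le z (x - z)
        rw [add_sub_cancel] at this
        exact hu.ofReal_sum_defect hh0 hh1 he (by linarith [hmem x hx])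
    _ = ∑ j ∈ Finset.range n, ENNReal.ofReal h *
        ∫⁻ x in ball z ε, ENNReal.ofReal (defect h e u (x + ((j : ℝ) * h) • e)) := by
        rw [lintegral_finsetSum _ fun j _ => by fun_prop]
        exact Finset.sum_congr rfl fun j _ => lintegral_const_mul _ (by fun_prop)
    _ ≤ ∑ j ∈ Finset.range n, ENNReal.ofReal h *
        ∫⁻ x in ball w a, ENNReal.ofReal (defect h e u x) := by
        refine Finset.sum_le_sum fun j hj => mul_le_mul_right (lintegral_ball_add_le
          (f := fun x => ENNReal.ofReal (defect h e u x)) fun x hx => ?_) _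
        have h2 : (j : ℝ) * h ≤ n * h :=
          mul_le_mul_of_nonneg_right (Nat.cast_le.2 (Finset.mem_range.1 hj).le) hh0.le
        rw [mem_ball, dist_eq_norm, show x + ((j : ℝ) * h) • e - w
          = (x - z) + (z - w) + ((j : ℝ) * h) • e by abel]
        have a1 := norm_add_le ((x - z) + (z - w)) (((j : ℝ) * h) • e)
        have a2 := norm_add_le (x - z) (z - w)
        rw [norm_smul_unit he, abs_of_nonneg (by positivity)] at a1
        linarith [hmem x hx]
    _ = _ := by
        rw [Finset.sum_const, Finset.card_range, nsmul_eq_mul, ← mul_assoc,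
          ENNReal.ofReal_mul (by positivity), ENNReal.ofReal_natCast]

end

section
variable {d : ℕ} {s p R β : ℝ} {u : EuclideanSpace ℝ (Fin d) → ℝ}

/-- The displacement `τ • e'` is replaced by `n` steps `h • e` with `n = ⌊τ / h⌋`. The telescoped
defects are then averaged over `ball z' ε`. The error `2 * ε` comes from moving the base and end
points, `2 * h` from rounding, and `τ * ‖e - e'‖` from changing the direction. -/
lemma CoreSol.slope_ge (hu : CoreSol s p R β u) {h : ℝ} (hh0 : 0 < h) (hh1 : h ≤ 1)
    {e e' z z' : EuclideanSpace ℝ (Fin d)} (he : ‖e‖ = 1) (he' : ‖e'‖ = 1) {τ ε a J : ℝ}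
    (hτ : 0 ≤ τ) (hε : 0 < ε)
    (hJ : 0 ≤ J) (hz' : ‖z'‖ + ε + τ + 1 < R) (ha : ‖z' - z‖ + ε + τ ≤ a)
    (hI : ∫⁻ x in ball z a, ENNReal.ofReal (defect h e u x) ≤ ENNReal.ofReal J) :
    (τ - (u (z' + τ • e') - u z') - 2 * ε - 2 * h - τ * ‖e - e'‖) * (ε ^ d * unitVol d)
      ≤ τ * J := by
  set n := ⌊τ / h⌋₊ with hn
  have n1 : n * h ≤ τ := by
    have := Nat.floor_le (by positivity : 0 ≤ τ / h)
    rwa [le_div_iff₀ hh0] at this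
  have n2 : τ - h ≤ n * h := by
    have := (Nat.lt_floor_add_one (τ / h)).le
    rw [div_le_iff₀ hh0] at this
    linarith
  have hnh : (0 : ℝ) ≤ n * h := by positivity
  have key := hu.lintegral_sum_defect_le hh0 hh1 (z := z') (w := z) (n := n) (ε := ε) (a := a) he
    (by linarith) (by linarith)
  have hinB : ∀ w : EuclideanSpace ℝ (Fin d), ‖w - z'‖ ≤ ε + τ →
      w ∈ ball (0 : EuclideanSpace ℝ (Fin d)) R := by
    intro w hw
    have := norm_add_le z' (w - z')
    rw [add_sub_cancel] at this
    rw [mem_ball_zero_iff]; linarith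
  have hshift : ‖((n : ℝ) * h) • e - τ • e'‖ ≤ h + τ * ‖e - e'‖ := by
    rw [show ((n : ℝ) * h) • e - τ • e' = ((n : ℝ) * h - τ) • e + τ • (e - e') by module]
    refine (norm_add_le _ _).trans (add_le_add ?_ ?_)
    · rw [norm_smul_unit he, abs_le]; constructor <;> linarith
    · rw [norm_smul, Real.norm_of_nonneg hτ]
  have low : ∫⁻ _ in ball z' ε, ENNReal.ofReal
      (τ - (u (z' + τ • e') - u z') - 2 * ε - 2 * h - τ * ‖e - e'‖)
      ≤ ∫⁻ x in ball z' ε, ENNReal.ofReal (n * h - (u (x + ((n : ℝ) * h) • e) - u x)) := by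
    refine setLIntegral_mono' measurableSet_ball fun x hx => ENNReal.ofReal_le_ofReal ?_
    have hx' : ‖x - z'‖ < ε := by simpa [dist_eq_norm] using hx
    have b1 := hu.lip x (hinB x (by linarith)) z' (hinB z' (by simpa using by linarith))
    have b2 := hu.lip (x + ((n : ℝ) * h) • e) (hinB _ (by
      rw [add_sub_right_comm]
      refine (norm_add_le _ _).trans ?_
      rw [norm_smul_unit he, abs_of_nonneg hnh]; linarith)) (z' + τ • e') (hinB _ (by
      rw [add_sub_cancel_left, norm_smul_unit he', abs_of_nonneg hτ]; linarith))
    have b3 : ‖x + ((n : ℝ) * h) • e - (z' + τ • e')‖ ≤ ε + (h + τ * ‖e - e'‖) := by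
      rw [show x + ((n : ℝ) * h) • e - (z' + τ • e')
        = (x - z') + (((n : ℝ) * h) • e - τ • e') by abel]
      exact (norm_add_le _ _).trans (add_le_add hx'.le hshift)
    have b4 := abs_le.1 b1
    have b5 := abs_le.1 b2
    linarith [b4.1, b5.2]
  rw [setLIntegral_const, volume_ball_eq _ hε] at low
  have hV := unitVol_pos d
  have fin := low.trans (key.trans (mul_le_mul' (ENNReal.ofReal_le_ofReal n1) hI))
  rw [← ENNReal.ofReal_mul' (by positivity), ← ENNReal.ofReal_mul hτ] at fin
  exact (ENNReal.ofReal_le_ofReal_iff (by positivity)).1 fin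

end

/-! ### Limits along an ultrafilter. -/

lemma Ultrafilter.exists_tendsto_of_isCompact {X : Type*} [TopologicalSpace X] {K : Set X}
    (hK : IsCompact K) (𝓕 : Ultrafilter ℕ) {f : ℕ → X} (hf : ∀ᶠ m in (𝓕 : Filter ℕ), f m ∈ K) :
    ∃ x ∈ K, Tendsto f 𝓕 (𝓝 x) := hK.ultrafilter_le_nhds' (𝓕.map f) hf

section
variable {d : ℕ} {s p : ℝ} {β : ℕ → ℝ} {u : ℕ → EuclideanSpace ℝ (Fin d) → ℝ}
  {U : EuclideanSpace ℝ (Fin d) → ℝ} {𝓕 : Ultrafilter ℕ}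

lemma eventually_lt_two_pow (h𝓕 : (𝓕 : Filter ℕ) ≤ atTop) (c : ℝ) :
    ∀ᶠ m in (𝓕 : Filter ℕ), c < 2 ^ m :=
  h𝓕 ((tendsto_pow_atTop_atTop_of_one_lt (by norm_num : (1 : ℝ) < 2)).eventually_gt_atTop c)

lemma tendsto_ultralimit_apply (h𝓕 : (𝓕 : Filter ℕ) ≤ atTop)
    (hu : ∀ m, CoreSol s p (2 ^ m) (β m) (u m)) (hU : ∀ x, Tendsto (fun m => u m x) 𝓕 (𝓝 (U x)))
    {x : ℕ → EuclideanSpace ℝ (Fin d)} {x₀ : EuclideanSpace ℝ (Fin d)}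
    (hx : Tendsto x 𝓕 (𝓝 x₀)) : Tendsto (fun m => u m (x m)) 𝓕 (𝓝 (U x₀)) := by
  have h1 : Tendsto (fun m => ‖x m - x₀‖) 𝓕 (𝓝 0) := tendsto_iff_norm_sub_tendsto_zero.1 hx
  have h2 : Tendsto (fun m => u m (x m) - u m x₀) 𝓕 (𝓝 0) := by
    refine squeeze_zero_norm' ?_ h1
    filter_upwards [eventually_lt_two_pow h𝓕 (‖x₀‖ + 1), h1.eventually_lt_const one_pos]
      with m hm1 hm2
    have := norm_add_le x₀ (x m - x₀)
    rw [add_sub_cancel] at this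
    exact (hu m).lip _ (by rw [mem_ball_zero_iff]; linarith) _ (by rw [mem_ball_zero_iff]; linarith)
  simpa using h2.add (hU x₀)

lemma ultralimit_lip (h𝓕 : (𝓕 : Filter ℕ) ≤ atTop)
    (hu : ∀ m, CoreSol s p (2 ^ m) (β m) (u m)) (hU : ∀ x, Tendsto (fun m => u m x) 𝓕 (𝓝 (U x)))
    (x y : EuclideanSpace ℝ (Fin d)) : |U x - U y| ≤ ‖x - y‖ := by
  refine le_of_tendsto ((hU x).sub (hU y)).abs ?_
  filter_upwards [eventually_lt_two_pow h𝓕 ‖x‖, eventually_lt_two_pow h𝓕 ‖y‖] with m hx hy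
  exact (hu m).lip _ (by simpa using hx) _ (by simpa using hy)

/-- Around a point where the slope is asymptotically maximal, the limit has slope one wherever it
does not take the value `U y`, for a suitable `y`. -/
lemma exists_slope_point (h𝓕 : (𝓕 : Filter ℕ) ≤ atTop) (hd : 1 ≤ d) (hs0 : 0 < s) (hs1 : s < 1)
    (hp2 : 2 ≤ p) (hγ : 0 < 2 - p * (1 - s))
    (hu : ∀ m, CoreSol s p (2 ^ m) (β m) (u m)) (hβ : ∀ m, 0 ≤ β m) (hβ0 : Tendsto β atTop (𝓝 0))
    (hU : ∀ x, Tendsto (fun m => u m x) 𝓕 (𝓝 (U x)))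
    {e : ℕ → EuclideanSpace ℝ (Fin d)} {e₀ : EuclideanSpace ℝ (Fin d)} (he : ∀ m, ‖e m‖ = 1)
    (he₀ : Tendsto e 𝓕 (𝓝 e₀))
    {x : ℕ → EuclideanSpace ℝ (Fin d)} {x₀ : EuclideanSpace ℝ (Fin d)} (hx : Tendsto x 𝓕 (𝓝 x₀))
    (hslope : Tendsto (fun m => fderiv ℝ (u m) (x m) (e m)) 𝓕 (𝓝 1)) :
    ∃ y, ‖y - x₀‖ ≤ 1 ∧ (∃ x, 1 / 16 ≤ |U x - U y|) ∧
      ∀ z, U z ≠ U y → ∃ a, 0 < a ∧ ∀ z', ‖z' - z‖ < a → ∀ τ, 0 ≤ τ → τ < a →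
        U (z' + τ • e₀) = U z' + τ := by
  have he₀1 : ‖e₀‖ = 1 := tendsto_nhds_unique he₀.norm (by simp [he])
  obtain ⟨C, κ₀, hC, hκ₀, hev⟩ := exists_evaluation d s p hγ
  set F : ℕ → ℝ := fun m =>
    farConst d s p * (farMass d (2 - p * (1 - s)) ((2 : ℝ) ^ m / 2) + β m) with hF
  -- A positive null sequence dominating both the long range error and four times the deficit of the
  -- slope.
  set κ : ℕ → ℝ := fun m => 5 * |1 - fderiv ℝ (u m) (x m) (e m)| + |F m| + 1 / ((m : ℝ) + 1)
    with hκdef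
  have hF0 : Tendsto F 𝓕 (𝓝 0) := by
    have h1 : Tendsto (fun m : ℕ => (2 : ℝ) ^ m / 2) atTop atTop :=
      (tendsto_pow_atTop_atTop_of_one_lt (by norm_num : (1 : ℝ) < 2)).atTop_div_const two_pos
    have h2 := ((((tendsto_farMass (d := d) hγ).comp h1).add hβ0).const_mul (farConst d s p))
    rw [add_zero, mul_zero] at h2
    exact h2.mono_left h𝓕
  have hκ0 : Tendsto κ 𝓕 (𝓝 0) := by
    have h1 := (((tendsto_const_nhds (x := (1 : ℝ))).sub hslope).abs.const_mul 5).add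
      (hF0.abs) |>.add ((tendsto_one_div_add_atTop_nhds_zero_nat (𝕜 := ℝ)).mono_left h𝓕)
    simp only [sub_self, abs_zero, mul_zero, add_zero] at h1
    exact h1
  have hκpos : ∀ m, 0 < κ m := fun m => by positivity
  set M := ‖x₀‖ + 1 with hM
  have hM0 : 0 ≤ M := by positivity
  have hxM : ∀ᶠ m in (𝓕 : Filter ℕ), ‖x m‖ < M := hx.norm.eventually_lt_const (by linarith)
  have main : ∀ᶠ m in (𝓕 : Filter ℕ), ∃ q : ℝ × EuclideanSpace ℝ (Fin d) × EuclideanSpace ℝ (Fin d),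
      0 < q.1 ∧ q.1 ≤ κ m ∧ q.1 ≤ 1 ∧ ‖q.2.1 - x m‖ ≤ 1 ∧
      (‖q.2.2 - q.2.1‖ ≤ 1 ∧ 1 / 16 ≤ |u m q.2.2 - u m q.2.1|) ∧
      crossMass p ((d : ℝ) + s * p) ((2 : ℝ) ^ m / 2) (κ m) 0 q.1 (x m) (e m) (u m) q.2.1
        ≤ ENNReal.ofReal (C * κ m) := by
    filter_upwards [hxM, eventually_lt_two_pow h𝓕 (4 * (M + 2)), hκ0.eventually_lt_const hκ₀]
      with m h1 h2 h3
    have hfar : F m ≤ κ m := by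
      have a1 := le_abs_self (F m)
      have a2 := abs_nonneg (1 - fderiv ℝ (u m) (x m) (e m))
      have a3 : (0 : ℝ) < 1 / ((m : ℝ) + 1) := by positivity
      simp only [hκdef]; linarith
    have hgr : 1 - κ m / 4 < fderiv ℝ (u m) (x m) (e m) := by
      have a1 := abs_nonneg (F m)
      have a2 := abs_nonneg (1 - fderiv ℝ (u m) (x m) (e m))
      have a4 := le_abs_self (1 - fderiv ℝ (u m) (x m) (e m))
      have a3 : (0 : ℝ) < 1 / ((m : ℝ) + 1) := by positivity
      simp only [hκdef]; linarith
    obtain ⟨h, y, q1, q2, q3, q4, ⟨x', q5⟩, q6⟩ := hev (hu m) hd hs0 hs1 hp2 (hβ m) hM0 h2.le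
      (hκpos m) h3.le hfar (he m) h1.le hgr
    exact ⟨(h, y, x'), q1, q2, q3, q4, q5, q6⟩
  obtain ⟨q, hq⟩ := main.choice
  have hyK : ∀ᶠ m in (𝓕 : Filter ℕ), (q m).2.1 ∈ closedBall (0 : EuclideanSpace ℝ (Fin d)) (M + 1) := by
    filter_upwards [hq, hxM] with m h1 h2
    have := norm_add_le (x m) ((q m).2.1 - x m)
    rw [add_sub_cancel] at this
    rw [mem_closedBall_zero_iff]; linarith [h1.2.2.2.1]
  have hwK : ∀ᶠ m in (𝓕 : Filter ℕ), (q m).2.2 ∈ closedBall (0 : EuclideanSpace ℝ (Fin d)) (M + 2) := by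
    filter_upwards [hq, hyK] with m h1 h2
    have := norm_add_le (q m).2.1 ((q m).2.2 - (q m).2.1)
    rw [add_sub_cancel] at this
    rw [mem_closedBall_zero_iff] at h2 ⊢; linarith [h1.2.2.2.2.1.1]
  obtain ⟨y, hyM, hy⟩ := Ultrafilter.exists_tendsto_of_isCompact (isCompact_closedBall _ _) 𝓕 hyK
  obtain ⟨w, -, hw⟩ := Ultrafilter.exists_tendsto_of_isCompact (isCompact_closedBall _ _) 𝓕 hwK
  have huy := tendsto_ultralimit_apply h𝓕 hu hU hy
  have huw := tendsto_ultralimit_apply h𝓕 hu hU hw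
  have hh0 : Tendsto (fun m => (q m).1) 𝓕 (𝓝 0) := by
    refine squeeze_zero' ?_ ?_ hκ0
    · filter_upwards [hq] with m h1 using h1.1.le
    · filter_upwards [hq] with m h1 using h1.2.1
  refine ⟨y, ?_, ⟨w, ?_⟩, fun z hz => ?_⟩
  · refine le_of_tendsto (hy.sub hx).norm ?_
    filter_upwards [hq] with m h1 using h1.2.2.2.1
  · refine ge_of_tendsto (huw.sub huy).abs ?_
    filter_upwards [hq] with m h1 using h1.2.2.2.2.1.2
  set A := |U z - U y| with hA
  have hA0 : 0 < A := abs_pos.2 (sub_ne_zero.2 hz)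
  -- Within distance `a` of `z`, the function `u m` differs from its value at the chosen point by at
  -- least `7/8 A - a > A / 2`.
  set a := A / 8 with ha
  have ha0 : 0 < a := by positivity
  set B := ‖z‖ + a + M + 2 with hB
  have hB0 : 0 < B := by positivity
  have hd' : (1 : ℝ) ≤ d := by exact_mod_cast hd
  have hsp : 0 < s * p := mul_pos hs0 (by linarith)
  set k : ℝ := 1 / 4 * (A / 2) ^ (p - 2) * (B ^ ((d : ℝ) + s * p))⁻¹ with hk
  have hk0 : 0 < k := by positivity
  have hV := unitVol_pos d
  set J : ℕ → ℝ := fun m => C * κ m / k + κ m * (a ^ d * unitVol d) with hJ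
  have hJpos : ∀ m, 0 ≤ J m := fun m => by have := hκpos m; simp only [hJ]; positivity
  have hJ0 : Tendsto J 𝓕 (𝓝 0) := by
    have := ((hκ0.const_mul C).div_const k).add (hκ0.mul_const (a ^ d * unitVol d))
    simpa using this
  have hmass : ∀ᶠ m in (𝓕 : Filter ℕ), ∫⁻ x in ball z a,
      ENNReal.ofReal (defect (q m).1 (e m) (u m) x) ≤ ENNReal.ofReal (J m) := by
    have hdiff : Tendsto (fun m => |u m z - u m (q m).2.1|) 𝓕 (𝓝 A) := ((hU z).sub huy).abs
    filter_upwards [hq, hyK, hdiff.eventually_const_lt (by linarith : 7 / 8 * A < A),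
      eventually_lt_two_pow h𝓕 (4 * B)] with m h1 h2 h3 h4
    have := (hu m).lintegral_defect_le hp2 (D := (d : ℝ) + s * p) (by linarith) (by linarith)
      (hκpos m).le h1.2.2.2.2.2 (A := A / 2) (B := B) (a := a) (z := z) (by positivity) hB0 ha0
      (by linarith) ?_
    · rw [← hk, ← ENNReal.ofReal_add (by have := hκpos m; positivity)
        (by have := hκpos m; positivity)] at this
      exact this
    intro x hx
    have hx' : ‖x - z‖ < a := by simpa [dist_eq_norm] using hx
    have hxz := norm_add_le z (x - z)
    rw [add_sub_cancel] at hxz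
    have hlip := (hu m).lip x (by rw [mem_ball_zero_iff]; linarith) z
      (by rw [mem_ball_zero_iff]; linarith)
    rw [mem_closedBall_zero_iff] at h2
    refine ⟨?_, ?_⟩
    · have := abs_sub_abs_le_abs_sub (u m z - u m (q m).2.1) (u m z - u m x)
      rw [sub_sub_sub_cancel_left, abs_sub_comm (u m z) (u m x)] at this
      linarith
    · have := norm_sub_le x (q m).2.1
      linarith
  refine ⟨a / 4, by positivity, fun z' hz' τ hτ0 hτ => ?_⟩
  have up := (abs_le.1 (ultralimit_lip h𝓕 hu hU (z' + τ • e₀) z')).2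
  rw [add_sub_cancel_left, norm_smul_unit he₀1, abs_of_nonneg hτ0] at up
  have low : ∀ ε, 0 < ε → ε ≤ a / 4 → τ - (U (z' + τ • e₀) - U z') - 2 * ε ≤ 0 := by
    intro ε hε hεa
    have hvol : 0 < ε ^ d * unitVol d := by positivity
    have hne : Tendsto (fun m => ‖e m - e₀‖) 𝓕 (𝓝 0) := tendsto_iff_norm_sub_tendsto_zero.1 he₀
    have T1 : Tendsto (fun m => (τ - (u m (z' + τ • e₀) - u m z') - 2 * ε - 2 * (q m).1
        - τ * ‖e m - e₀‖) * (ε ^ d * unitVol d)) 𝓕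
        (𝓝 ((τ - (U (z' + τ • e₀) - U z') - 2 * ε - 2 * 0 - τ * 0) * (ε ^ d * unitVol d))) :=
      (((((tendsto_const_nhds.sub ((hU _).sub (hU _))).sub_const _).sub
        (hh0.const_mul 2)).sub (hne.const_mul τ)).mul_const _)
    have T2 : Tendsto (fun m => τ * J m) 𝓕 (𝓝 (τ * 0)) := hJ0.const_mul τ
    have fin := le_of_tendsto_of_tendsto T1 T2 ?_
    · simp only [mul_zero, sub_zero] at fin
      by_contra hc
      exact absurd fin (not_le.2 (mul_pos (not_le.1 hc) hvol))
    filter_upwards [hq, hmass, eventually_lt_two_pow h𝓕 (‖z'‖ + ε + τ + 1)] with m h1 h2 h3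
    exact (hu m).slope_ge h1.1 h1.2.2.1 (he m) he₀1 hτ0 hε (hJpos m) h3 (by linarith) h2
  refine le_antisymm (by linarith) ?_
  by_contra hc
  have hc' : 0 < τ - (U (z' + τ • e₀) - U z') := by linarith [not_le.1 hc]
  have := low (min (a / 4) ((τ - (U (z' + τ • e₀) - U z')) / 4)) (by positivity) (min_le_left _ _)
  have := min_le_right (a / 4) ((τ - (U (z' + τ • e₀) - U z')) / 4)
  linarith

end

/-! ### Rigidity of 1-Lipschitz functions with slope one. -/

section
variable {d : ℕ} {s p R : ℝ} {U : EuclideanSpace ℝ (Fin d) → ℝ} {e₀ : EuclideanSpace ℝ (Fin d)}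

/-- Forward along the ray `U` increases away from `c`, so the exceptional level is never met and the
local property continues from `0` to `τ` by an open and closed argument. -/
lemma slope_ray (hlip : ∀ x y, |U x - U y| ≤ ‖x - y‖) {c : ℝ}
    (hP : ∀ z, U z ≠ c → ∃ a, 0 < a ∧ ∀ z', ‖z' - z‖ < a → ∀ τ, 0 ≤ τ → τ < a →
      U (z' + τ • e₀) = U z' + τ) {z : EuclideanSpace ℝ (Fin d)} (hz : c < U z) {τ : ℝ}
    (hτ : 0 ≤ τ) : U (z + τ • e₀) = U z + τ := by
  have hcont : Continuous U := by
    refine (LipschitzWith.of_dist_le_mul (K := 1) fun x y => ?_).continuous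
    rw [Real.dist_eq, dist_eq_norm, NNReal.coe_one, one_mul]
    exact hlip x y
  have key : Icc 0 τ ⊆ {σ : ℝ | U (z + σ • e₀) = U z + σ} := by
    refine IsClosed.Icc_subset_of_forall_exists_gt ?_ (by simp) ?_
    · refine IsClosed.inter (isClosed_eq ?_ (by fun_prop)) isClosed_Icc
      exact hcont.comp (by fun_prop)
    · rintro σ ⟨hσ, hσ0, -⟩ b (hb : σ < b)
      have hσ : U (z + σ • e₀) = U z + σ := hσ
      obtain ⟨a, ha, hPa⟩ := hP (z + σ • e₀) (by rw [hσ]; linarith)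
      have hm : 0 < min (a / 2) (b - σ) := lt_min (by positivity) (by linarith)
      refine ⟨σ + min (a / 2) (b - σ), ?_, by linarith, by linarith [min_le_right (a / 2) (b - σ)]⟩
      have := hPa (z + σ • e₀) (by simpa using ha) (min (a / 2) (b - σ)) hm.le
        (by linarith [min_le_left (a / 2) (b - σ)])
      rw [mem_ofPred_eq, add_smul, ← add_assoc, this, hσ]; ring
  exact key ⟨hτ, le_rfl⟩

/-- The forward statement applied to `-U`, `-e₀` and `-c`. The radius is halved because the local
property is used at the base point moved back by `σ • e₀`. -/
lemma slope_ray_neg (hlip : ∀ x y, |U x - U y| ≤ ‖x - y‖) {c : ℝ}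
    (hP : ∀ z, U z ≠ c → ∃ a, 0 < a ∧ ∀ z', ‖z' - z‖ < a → ∀ τ, 0 ≤ τ → τ < a →
      U (z' + τ • e₀) = U z' + τ) (he₀ : ‖e₀‖ = 1) {z : EuclideanSpace ℝ (Fin d)} (hz : U z < c)
    {τ : ℝ} (hτ : 0 ≤ τ) : U (z - τ • e₀) = U z - τ := by
  have key := slope_ray (U := fun x => -U x) (e₀ := -e₀) (c := -c) (z := z) ?_ ?_ (by simpa) hτ
  · simp only [smul_neg, ← sub_eq_add_neg] at key
    linarith
  · intro x y
    rw [neg_sub_neg, abs_sub_comm]; exact hlip x y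
  · intro z hz
    obtain ⟨a, ha, hPa⟩ := hP z (by simpa using hz)
    refine ⟨a / 2, by positivity, fun z' hz' σ hσ0 hσ => ?_⟩
    have := hPa (z' - σ • e₀) ?_ σ hσ0 (by linarith)
    · rw [sub_add_cancel] at this
      simp only [smul_neg, ← sub_eq_add_neg]
      linarith
    · rw [sub_right_comm]
      refine (norm_sub_le _ _).trans_lt ?_
      rw [norm_smul_unit he₀, abs_of_nonneg hσ0]; linarith

/-- A 1-Lipschitz function with slope one in the direction of a unit vector is affine. -/
lemma eq_inner_of_slope_one (hlip : ∀ x y, |U x - U y| ≤ ‖x - y‖) (he₀ : ‖e₀‖ = 1)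
    (hslope : ∀ z, ∀ τ : ℝ, 0 ≤ τ → U (z + τ • e₀) = U z + τ) (x y : EuclideanSpace ℝ (Fin d)) :
    U x - U y = inner ℝ e₀ (x - y) := by
  have half : ∀ x y, U x - U y ≤ inner ℝ e₀ (x - y) := by
    intro x y
    set v := x - y with hv
    set a := U x - U y with ha
    by_contra hc
    have hc : 0 < a - inner ℝ e₀ v := by linarith [not_le.1 hc]
    -- Squaring `a + τ ≤ ‖v + τ • e₀‖`: the terms `τ²` cancel and the linear ones remain, which is
    -- impossible for large `τ` if `a` exceeds the inner product.
    have key : ∀ τ : ℝ, 0 ≤ τ → 0 ≤ a + τ → 2 * τ * (a - inner ℝ e₀ v) ≤ ‖v‖ ^ 2 := by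
      intro τ hτ haτ
      have h1 := (abs_le.1 (hlip (x + τ • e₀) y)).2
      rw [hslope x τ hτ, add_sub_right_comm x, ← hv] at h1
      have h2 : (a + τ) ^ 2 ≤ ‖v + τ • e₀‖ ^ 2 := pow_le_pow_left₀ haτ (by linarith) 2
      rw [norm_add_sq_real, norm_smul_unit he₀, sq_abs, inner_smul_right,
        real_inner_comm] at h2
      nlinarith [sq_nonneg a]
    have h3 := key (|a| + ‖v‖ ^ 2 / (a - inner ℝ e₀ v) + 1) (by positivity)
      (by have := neg_abs_le a; have : 0 ≤ ‖v‖ ^ 2 / (a - inner ℝ e₀ v) := by positivity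
          linarith)
    have h4 : ‖v‖ ^ 2 / (a - inner ℝ e₀ v) * (a - inner ℝ e₀ v) = ‖v‖ ^ 2 :=
      div_mul_cancel₀ _ hc.ne'
    nlinarith [mul_nonneg (abs_nonneg a) hc.le, sq_nonneg ‖v‖]
  refine le_antisymm (half x y) ?_
  have := half y x
  rw [← neg_sub x y, inner_neg_right] at this
  linarith

end

section
variable {d : ℕ} {s p : ℝ} {β : ℕ → ℝ} {u : ℕ → EuclideanSpace ℝ (Fin d) → ℝ}
  {U : EuclideanSpace ℝ (Fin d) → ℝ} {𝓕 : Ultrafilter ℕ}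

lemma CoreSol.exists_fderiv_eq {R β : ℝ} {u : EuclideanSpace ℝ (Fin d) → ℝ}
    (hu : CoreSol s p R β u) {e w : EuclideanSpace ℝ (Fin d)} (he : ‖e‖ = 1) (hw : ‖w‖ + 1 < R) :
    ∃ t : ℝ, 0 ≤ t ∧ t ≤ 1 ∧ fderiv ℝ u (w + t • e) e = u (w + e) - u w := by
  have hd : ∀ t ∈ Icc (0 : ℝ) 1,
      HasDerivAt (fun t : ℝ => u (w + t • e)) (fderiv ℝ u (w + t • e) e) t := by
    intro t ht
    have h1 : DifferentiableAt ℝ u (w + t • e) := by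
      refine hu.differentiableAt ((norm_add_le _ _).trans_lt ?_)
      rw [norm_smul_unit he, abs_of_nonneg ht.1]; linarith [ht.2]
    have h2 : HasDerivAt (fun t : ℝ => w + t • e) e t := by
      simpa using ((hasDerivAt_id t).smul_const e).const_add w
    exact h1.hasFDerivAt.comp_hasDerivAt t h2
  obtain ⟨t, ht, hteq⟩ := exists_hasDerivAt_eq_slope (fun t : ℝ => u (w + t • e))
    (fun t => fderiv ℝ u (w + t • e) e) one_pos
    (fun t ht => (hd t ht).continuousAt.continuousWithinAt)
    (fun t ht => hd t ⟨ht.1.le, ht.2.le⟩)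
  refine ⟨t, ht.1.le, ht.2.le, ?_⟩
  simpa using hteq

/-- Limits of normalized solutions with asymptotically maximal slope at some points are linear. -/
lemma ultralimit_linear (h𝓕 : (𝓕 : Filter ℕ) ≤ atTop) (hd : 1 ≤ d) (hs0 : 0 < s) (hs1 : s < 1)
    (hp2 : 2 ≤ p) (hγ : 0 < 2 - p * (1 - s))
    (hu : ∀ m, CoreSol s p (2 ^ m) (β m) (u m)) (hβ : ∀ m, 0 ≤ β m) (hβ0 : Tendsto β atTop (𝓝 0))
    (hU : ∀ x, Tendsto (fun m => u m x) 𝓕 (𝓝 (U x)))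
    {e : ℕ → EuclideanSpace ℝ (Fin d)} {e₀ : EuclideanSpace ℝ (Fin d)} (he : ∀ m, ‖e m‖ = 1)
    (he₀ : Tendsto e 𝓕 (𝓝 e₀))
    {x : ℕ → EuclideanSpace ℝ (Fin d)} {x₀ : EuclideanSpace ℝ (Fin d)} (hx : Tendsto x 𝓕 (𝓝 x₀))
    (hslope : Tendsto (fun m => fderiv ℝ (u m) (x m) (e m)) 𝓕 (𝓝 1))
    (a b : EuclideanSpace ℝ (Fin d)) : U a - U b = inner ℝ e₀ (a - b) := by
  have he₀1 : ‖e₀‖ = 1 := tendsto_nhds_unique he₀.norm (by simp [he])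
  have hlip := ultralimit_lip h𝓕 hu hU
  obtain ⟨y, -, ⟨x₁, hx₁⟩, hP⟩ :=
    exists_slope_point h𝓕 hd hs0 hs1 hp2 hγ hu hβ hβ0 hU he he₀ hx hslope
  -- Far along a ray there is a unit segment in direction `e₀` on which `U` has slope one and stays
  -- at distance at least `2` from the level `U y`.
  obtain ⟨w, hw1, hw2⟩ : ∃ w, (∀ t : ℝ, 0 ≤ t → t ≤ 1 → 2 ≤ |U (w + t • e₀) - U y|) ∧
      U (w + e₀) - U w = 1 := by
    rcases lt_or_ge (U y) (U x₁) with hc | hc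
    · have ray := fun {τ} h => slope_ray (τ := τ) hlip hP hc h
      refine ⟨x₁ + (2 : ℝ) • e₀, fun t ht _ => ?_, ?_⟩
      · rw [add_assoc, ← add_smul, ray (by linarith)]
        exact le_trans (by linarith) (le_abs_self _)
      · have h1 := ray (by norm_num : (0 : ℝ) ≤ 3)
        have h2 := ray (by norm_num : (0 : ℝ) ≤ 2)
        rw [show x₁ + (2 : ℝ) • e₀ + e₀ = x₁ + (3 : ℝ) • e₀ by module, h1, h2]; ring
    · have hc : U x₁ < U y := by
        refine lt_of_le_of_ne hc fun h => ?_
        rw [h, sub_self, abs_zero] at hx₁; norm_num at hx₁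
      have ray := fun {τ} h => slope_ray_neg (τ := τ) hlip hP he₀1 hc h
      refine ⟨x₁ - (3 : ℝ) • e₀, fun t _ ht => ?_, ?_⟩
      · rw [show x₁ - (3 : ℝ) • e₀ + t • e₀ = x₁ - (3 - t) • e₀ by module, ray (by linarith)]
        exact le_trans (by linarith) (neg_le_abs _)
      · have h1 := ray (by norm_num : (0 : ℝ) ≤ 3)
        have h2 := ray (by norm_num : (0 : ℝ) ≤ 2)
        rw [show x₁ - (3 : ℝ) • e₀ + e₀ = x₁ - (2 : ℝ) • e₀ by module, h1, h2]; ring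
  -- The mean value theorem gives points close to this segment at which the slopes of the `u m` tend
  -- to one, so that the argument can be repeated there.
  have mvt : ∀ᶠ m in (𝓕 : Filter ℕ), ∃ t : ℝ, 0 ≤ t ∧ t ≤ 1 ∧
      fderiv ℝ (u m) (w + t • e m) (e m) = u m (w + e m) - u m w := by
    filter_upwards [eventually_lt_two_pow h𝓕 (‖w‖ + 1)] with m hm
    exact (hu m).exists_fderiv_eq (he m) hm
  obtain ⟨t, ht⟩ := mvt.choice
  obtain ⟨t₀, ht₀, htt⟩ := Ultrafilter.exists_tendsto_of_isCompact (isCompact_Icc (a := (0 : ℝ))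
    (b := 1)) 𝓕 (f := t) (by filter_upwards [ht] with m hm using ⟨hm.1, hm.2.1⟩)
  have hx' : Tendsto (fun m => w + t m • e m) 𝓕 (𝓝 (w + t₀ • e₀)) := (htt.smul he₀).const_add w
  have hslope' : Tendsto (fun m => fderiv ℝ (u m) (w + t m • e m) (e m)) 𝓕 (𝓝 1) := by
    have h1 := (tendsto_ultralimit_apply h𝓕 hu hU (he₀.const_add w)).sub (hU w)
    rw [hw2] at h1
    refine h1.congr' ?_
    filter_upwards [ht] with m hm using hm.2.2.symm
  obtain ⟨y', hy', -, hP'⟩ :=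
    exists_slope_point h𝓕 hd hs0 hs1 hp2 hγ hu hβ hβ0 hU he he₀ hx' hslope'
  -- The point `y'` is within distance one of the segment and `U` is 1-Lipschitz. The two
  -- exceptional levels therefore differ, and no point lies on both.
  have hne : U y' ≠ U y := by
    intro h
    have h1 := hw1 t₀ ht₀.1 ht₀.2
    have h2 := hlip y' (w + t₀ • e₀)
    rw [h, abs_sub_comm] at h2
    linarith
  have all : ∀ z, ∃ a, 0 < a ∧ ∀ z', ‖z' - z‖ < a → ∀ τ, 0 ≤ τ → τ < a →
      U (z' + τ • e₀) = U z' + τ := by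
    intro z
    by_cases hz : U z = U y
    · exact hP' z (fun h => hne (by rw [← h, hz]))
    · exact hP z hz
  exact eq_inner_of_slope_one hlip he₀1
    (fun z τ hτ => slope_ray hlip (c := U z - 1) (fun z _ => all z) (by linarith) hτ) a b

end

/-! ### From closeness of increments to closeness of gradients. -/

section
variable {d : ℕ} {s p R β : ℝ} {u : EuclideanSpace ℝ (Fin d) → ℝ}

lemma inner_gradient_eq (x v : EuclideanSpace ℝ (Fin d)) :
    inner ℝ (gradient u x) v = fderiv ℝ u x v := by
  rw [gradient, InnerProductSpace.toDual_symm_apply]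

lemma norm_gradient_eq (x : EuclideanSpace ℝ (Fin d)) : ‖gradient u x‖ = ‖fderiv ℝ u x‖ :=
  LinearIsometryEquiv.norm_map _ _

lemma CoreSol.norm_fderiv_le (hu : CoreSol s p R β u) {x : EuclideanSpace ℝ (Fin d)}
    (hx : ‖x‖ < R) : ‖fderiv ℝ u x‖ ≤ 1 := by
  refine (hu.differentiableAt hx).hasFDerivAt.le_of_lip' zero_le_one ?_
  have hx' : x ∈ ball (0 : EuclideanSpace ℝ (Fin d)) R := by simpa using hx
  filter_upwards [isOpen_ball.mem_nhds hx'] with y hy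
  rw [one_mul]
  exact hu.lip y hy x hx'

/-- The unit increment is the average of `n + 1` increments of step `1 / (n + 1)`, shifted by at
most one, so `ball 0 2` contains every shifted copy of `ball 0 1`. Fatou's lemma lets the step tend
to zero. -/
lemma CoreSol.lintegral_one_sub_fderiv_le (hu : CoreSol s p R β u) (hR : 4 < R)
    {e : EuclideanSpace ℝ (Fin d)} (he : ‖e‖ = 1) :
    ∫⁻ x in ball 0 1, ENNReal.ofReal (1 - fderiv ℝ u x e)
      ≤ ∫⁻ x in ball 0 2, ENNReal.ofReal (1 - (u (x + e) - u x)) := by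
  set h : ℕ → ℝ := fun n => 1 / ((n : ℝ) + 1) with hh
  have hdm := fun n => measurable_defect hu.meas (h n) e
  have disc : ∀ n, ∫⁻ x in ball 0 1, ENNReal.ofReal (defect (h n) e u x)
      ≤ ∫⁻ x in ball 0 2, ENNReal.ofReal (1 - (u (x + e) - u x)) := by
    intro n
    have hn0 : 0 < h n := by simp only [hh]; positivity
    have hn1 : h n ≤ 1 := by
      simp only [hh]; rw [div_le_one (by positivity)]; linarith [n.cast_nonneg (α := ℝ)]
    have hnn : ((n + 1 : ℕ) : ℝ) * h n = 1 := by
      simp only [hh]; push_cast; field_simp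
    have hsum : ∫⁻ x in ball 0 2, ENNReal.ofReal (1 - (u (x + e) - u x))
        = ∑ j ∈ Finset.range (n + 1), ENNReal.ofReal (h n) *
          ∫⁻ x in ball 0 2, ENNReal.ofReal (defect (h n) e u (x + ((j : ℝ) * h n) • e)) := by
      have hcalc : ∀ x ∈ ball (0 : EuclideanSpace ℝ (Fin d)) 2,
          ENNReal.ofReal (1 - (u (x + e) - u x)) = ∑ j ∈ Finset.range (n + 1),
            ENNReal.ofReal (h n)
              * ENNReal.ofReal (defect (h n) e u (x + ((j : ℝ) * h n) • e)) := by
        intro x hx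
        rw [mem_ball_zero_iff] at hx
        have := hu.ofReal_sum_defect hn0 hn1 (x := x) (n := n + 1) he (by rw [hnn]; linarith)
        rwa [hnn, one_smul] at this
      rw [setLIntegral_congr_fun measurableSet_ball hcalc, lintegral_finsetSum _
        fun j _ => by have := hdm n; fun_prop]
      exact Finset.sum_congr rfl fun j _ => lintegral_const_mul _ (by have := hdm n; fun_prop)
    rw [hsum]
    have each : ∀ j ∈ Finset.range (n + 1),
        ENNReal.ofReal (h n) * ∫⁻ x in ball 0 1, ENNReal.ofReal (defect (h n) e u x)
        ≤ ENNReal.ofReal (h n) *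
          ∫⁻ x in ball 0 2, ENNReal.ofReal (defect (h n) e u (x + ((j : ℝ) * h n) • e)) := by
      intro j hj
      refine mul_le_mul_right ?_ _
      have := lintegral_ball_add_le (z := (0 : EuclideanSpace ℝ (Fin d))) (w := 0) (ε := 1) (a := 2)
        (v := -(((j : ℝ) * h n) • e))
        (f := fun x => ENNReal.ofReal (defect (h n) e u (x + ((j : ℝ) * h n) • e))) ?_
      · simpa only [neg_add_cancel_right] using this
      · intro x hx
        rw [mem_ball_zero_iff] at hx ⊢
        refine (norm_add_le _ _).trans_lt ?_
        rw [norm_neg, norm_smul_unit he, abs_of_nonneg (by positivity)]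
        have : (j : ℝ) * h n ≤ ((n + 1 : ℕ) : ℝ) * h n :=
          mul_le_mul_of_nonneg_right (Nat.cast_le.2 (Finset.mem_range.1 hj).le) hn0.le
        linarith
    refine le_trans (le_of_eq ?_) (Finset.sum_le_sum each)
    rw [Finset.sum_const, Finset.card_range, nsmul_eq_mul, ← mul_assoc, ← ENNReal.ofReal_natCast,
      ← ENNReal.ofReal_mul (by positivity), hnn, ENNReal.ofReal_one, one_mul]
  have lim : ∀ x ∈ ball (0 : EuclideanSpace ℝ (Fin d)) 1, ENNReal.ofReal (1 - fderiv ℝ u x e)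
      = liminf (fun n => ENNReal.ofReal (defect (h n) e u x)) atTop := by
    intro x hx
    rw [mem_ball_zero_iff] at hx
    refine (Tendsto.liminf_eq (ENNReal.tendsto_ofReal ?_)).symm
    have h1 := ((hu.differentiableAt (by linarith : ‖x‖ < R)).hasFDerivAt.lim_real e).comp
      (tendsto_atTop_add_const_right atTop (1 : ℝ) tendsto_natCast_atTop_atTop)
    refine (h1.const_sub 1).congr fun n => ?_
    simp only [defect, hh, Function.comp, one_div, smul_eq_mul]
    rw [div_inv_eq_mul, mul_comm]
  rw [setLIntegral_congr_fun measurableSet_ball lim]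
  refine (lintegral_liminf_le fun n => (hdm n).ennreal_ofReal).trans ?_
  exact liminf_le_of_le (by isBoundedDefault) fun b hb => by
    obtain ⟨n, hn⟩ := hb.exists
    exact hn.trans (disc n)

/-- As `‖∇u‖ ≤ 1`, one has `‖∇u - e‖² ≤ 2 (1 - ∂ₑu)`, and Markov's inequality bounds the bad set.
The factor `2 ^ d` is the ratio of the volumes of the two balls. -/
lemma CoreSol.volume_gradient_close (hu : CoreSol s p R β u) (hR : 4 < R) {r μ : ℝ} (hr : 0 < r)
    {e : EuclideanSpace ℝ (Fin d)} (he : ‖e‖ = 1) (hμ : 0 ≤ μ)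
    (hclose : ∀ x ∈ ball (0 : EuclideanSpace ℝ (Fin d)) 2,
      1 - (u (x + e) - u x) ≤ μ * (r ^ 2 / 2) / 2 ^ d) :
    ENNReal.ofReal (1 - μ) * volume (ball (0 : EuclideanSpace ℝ (Fin d)) 1)
      ≤ volume {x ∈ ball (0 : EuclideanSpace ℝ (Fin d)) 1 | ‖gradient u x - e‖ ≤ r} := by
  have hV := unitVol_pos d
  set G := {x ∈ ball (0 : EuclideanSpace ℝ (Fin d)) 1 | ‖gradient u x - e‖ ≤ r} with hG
  set W := {x | ENNReal.ofReal (r ^ 2 / 2) ≤ ENNReal.ofReal (1 - fderiv ℝ u x e)} with hW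
  have hfm : Measurable fun x => ENNReal.ofReal (1 - fderiv ℝ u x e) :=
    ((measurable_fderiv_apply_const ℝ u e).const_sub 1).ennreal_ofReal
  have hWm : MeasurableSet W := measurableSet_le measurable_const hfm
  have hr2 : ENNReal.ofReal (r ^ 2 / 2) ≠ 0 := by simpa using by positivity
  have markov := mul_meas_ge_le_lintegral (μ := volume.restrict (ball 0 1)) hfm
    (ENNReal.ofReal (r ^ 2 / 2))
  rw [Measure.restrict_apply hWm] at markov
  have bound : ENNReal.ofReal (r ^ 2 / 2) * volume (W ∩ ball 0 1)
      ≤ ENNReal.ofReal (r ^ 2 / 2) * ENNReal.ofReal (μ * unitVol d) := by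
    refine markov.trans ((hu.lintegral_one_sub_fderiv_le hR he).trans ?_)
    refine (setLIntegral_mono' measurableSet_ball fun x hx =>
      ENNReal.ofReal_le_ofReal (hclose x hx)).trans ?_
    rw [setLIntegral_const, volume_ball_eq _ two_pos, ← ENNReal.ofReal_mul (by positivity),
      ← ENNReal.ofReal_mul (by positivity)]
    refine ENNReal.ofReal_le_ofReal (le_of_eq ?_)
    field_simp
  have hbad := (ENNReal.mul_le_mul_iff_right hr2 ENNReal.ofReal_ne_top).1 bound
  have cover : ball (0 : EuclideanSpace ℝ (Fin d)) 1 ⊆ G ∪ (W ∩ ball 0 1) := by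
    intro x hx
    by_cases hg : ‖gradient u x - e‖ ≤ r
    · exact Or.inl ⟨hx, hg⟩
    · refine Or.inr ⟨ENNReal.ofReal_le_ofReal ?_, hx⟩
      rw [mem_ball_zero_iff] at hx
      have h1 : r ^ 2 ≤ ‖gradient u x - e‖ ^ 2 := pow_le_pow_left₀ hr.le (not_le.1 hg).le 2
      have h2 : ‖gradient u x‖ ^ 2 ≤ 1 := by
        rw [norm_gradient_eq]
        exact pow_le_one₀ (norm_nonneg _) (hu.norm_fderiv_le (by linarith))
      rw [norm_sub_sq_real, he, inner_gradient_eq] at h1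
      linarith
  have total := (measure_mono cover).trans (measure_union_le (μ := volume) G (W ∩ ball 0 1))
  rw [volume_ball_eq _ one_pos, one_pow, one_mul] at total ⊢
  rw [← ENNReal.ofReal_mul' hV.le, sub_mul, one_mul, ENNReal.ofReal_sub _ (by positivity)]
  exact tsub_le_iff_right.2 (total.trans (add_le_add_right hbad _))

/-- Normalized solutions with nearly maximal slope at some point have gradient close to a fixed
unit vector in most of the unit ball. -/
theorem exists_gradient_close (hd : 1 ≤ d) (hs0 : 0 < s) (hs1 : s < 1)
    (hp2 : 2 ≤ p) (hγ : 0 < 2 - p * (1 - s)) {r μ : ℝ} (hr : 0 < r) (hμ : 0 < μ)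
    {β : ℕ → ℝ} (hβ : ∀ m, 0 ≤ β m) (hβ0 : Tendsto β atTop (𝓝 0)) :
    ∃ m : ℕ, ∀ (u : EuclideanSpace ℝ (Fin d) → ℝ) (x₀ : EuclideanSpace ℝ (Fin d)),
      CoreSol s p (2 ^ m) (β m) u → ‖x₀‖ < 1 → 1 - (1 / 2) ^ m ≤ ‖gradient u x₀‖ →
      ∃ e : EuclideanSpace ℝ (Fin d), ‖e‖ = 1 ∧
        ENNReal.ofReal (1 - μ) * volume (ball (0 : EuclideanSpace ℝ (Fin d)) 1)
          ≤ volume {x ∈ ball (0 : EuclideanSpace ℝ (Fin d)) 1 | ‖gradient u x - e‖ ≤ r} := by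
  by_contra hcon
  push Not at hcon
  choose u x hu hx hgrad hsmall using hcon
  set 𝓕 := hyperfilter ℕ with h𝓕def
  have h𝓕 : (𝓕 : Filter ℕ) ≤ atTop := Nat.hyperfilter_le_atTop
  -- Default direction where the gradient vanishes; the formula `hfd` holds there too.
  set e₁ : EuclideanSpace ℝ (Fin d) := EuclideanSpace.single ⟨0, hd⟩ 1 with he₁
  set e : ℕ → EuclideanSpace ℝ (Fin d) := fun m =>
    if gradient (u m) (x m) = 0 then e₁ else ‖gradient (u m) (x m)‖⁻¹ • gradient (u m) (x m) with he
  have he1 : ∀ m, ‖e m‖ = 1 := by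
    intro m
    simp only [he]
    split_ifs with h
    · simp [he₁]
    · rw [norm_smul, norm_inv, norm_norm, inv_mul_cancel₀ (norm_ne_zero_iff.2 h)]
  have hfd : ∀ m, fderiv ℝ (u m) (x m) (e m) = ‖gradient (u m) (x m)‖ := by
    intro m
    rw [← inner_gradient_eq]
    simp only [he]
    split_ifs with h
    · rw [h, inner_zero_left, norm_zero]
    · rw [inner_smul_right, real_inner_self_eq_norm_sq, sq, inv_mul_cancel_left₀]
      exact norm_ne_zero_iff.2 h
  have hhalf : Tendsto (fun m : ℕ => 1 - ((1 : ℝ) / 2) ^ m) 𝓕 (𝓝 1) := by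
    have := (tendsto_pow_atTop_nhds_zero_of_lt_one (by norm_num : (0 : ℝ) ≤ 1 / 2)
      (by norm_num)).const_sub 1
    rw [sub_zero] at this
    exact this.mono_left h𝓕
  have hslope : Tendsto (fun m => fderiv ℝ (u m) (x m) (e m)) 𝓕 (𝓝 1) := by
    refine tendsto_of_tendsto_of_tendsto_of_le_of_le' hhalf tendsto_const_nhds ?_ ?_
    · exact Eventually.of_forall fun m => by rw [hfd]; exact hgrad m
    · refine Eventually.of_forall fun m => ?_
      rw [hfd, norm_gradient_eq]
      exact (hu m).norm_fderiv_le ((hx m).trans_le (one_le_pow₀ (by norm_num)))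
  obtain ⟨e₀, -, he₀⟩ := Ultrafilter.exists_tendsto_of_isCompact
    (isCompact_closedBall (0 : EuclideanSpace ℝ (Fin d)) 1) 𝓕 (f := e)
    (Eventually.of_forall fun m => by simp [he1])
  obtain ⟨x₀, -, hx₀⟩ := Ultrafilter.exists_tendsto_of_isCompact
    (isCompact_closedBall (0 : EuclideanSpace ℝ (Fin d)) 1) 𝓕 (f := x)
    (Eventually.of_forall fun m => by simpa using (hx m).le)
  have hUex : ∀ z, ∃ v, Tendsto (fun m => u m z) 𝓕 (𝓝 v) := by
    intro z
    obtain ⟨v, -, hv⟩ := Ultrafilter.exists_tendsto_of_isCompact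
      (isCompact_Icc (a := -‖z‖) (b := ‖z‖)) 𝓕 (f := fun m => u m z) (by
        filter_upwards [eventually_lt_two_pow h𝓕 ‖z‖] with m hm
        exact abs_le.1 ((hu m).abs_le_norm hm))
    exact ⟨v, hv⟩
  choose U hU using hUex
  have hlin := ultralimit_linear h𝓕 hd hs0 hs1 hp2 hγ hu hβ hβ0 hU he1 he₀ hx₀ hslope
  have he₀1 : ‖e₀‖ = 1 := tendsto_nhds_unique he₀.norm (by simp [he1])
  set ε := μ * (r ^ 2 / 2) / 2 ^ d with hε
  have hε0 : 0 < ε := by positivity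
  -- Pointwise convergence on a finite net suffices: the 1-Lipschitz bound costs `ε / 4` at each of
  -- the two end points.
  obtain ⟨T, -, hTfin, hT⟩ := (isCompact_closedBall (0 : EuclideanSpace ℝ (Fin d)) 2).finite_cover_balls
    (by positivity : 0 < ε / 4)
  have hev : ∀ᶠ m in (𝓕 : Filter ℕ), ∀ t ∈ T, 1 - ε / 2 < u m (t + e₀) - u m t := by
    rw [eventually_all_finite hTfin]
    intro t _
    have h1 := (hU (t + e₀)).sub (hU t)
    rw [hlin, add_sub_cancel_left, real_inner_self_eq_norm_sq, he₀1, one_pow] at h1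
    exact h1.eventually_const_lt (by linarith)
  obtain ⟨m, hm1, hm2, hm3⟩ := (hev.and ((eventually_lt_two_pow h𝓕 4).and
    (eventually_lt_two_pow h𝓕 (3 + ε)))).exists
  refine absurd ((hu m).volume_gradient_close hm2 hr he₀1 hμ.le fun x hx => ?_)
    (not_le.2 (hsmall m e₀ he₀1))
  obtain ⟨t, htT, hxt⟩ := mem_iUnion₂.1 (hT (ball_subset_closedBall hx))
  rw [mem_ball_zero_iff] at hx
  have hxt' : ‖x - t‖ < ε / 4 := by simpa [dist_eq_norm] using hxt
  have htn : ‖t‖ < 2 + ε / 4 := by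
    have := norm_sub_le x (x - t)
    rw [sub_sub_cancel] at this
    linarith
  have b1 := (hu m).lip x (by rw [mem_ball_zero_iff]; linarith) t (by rw [mem_ball_zero_iff]; linarith)
  have b2 := (hu m).lip (x + e₀) (by
      rw [mem_ball_zero_iff]; have := norm_add_le x e₀; linarith) (t + e₀) (by
      rw [mem_ball_zero_iff]; have := norm_add_le t e₀; linarith)
  rw [add_sub_add_right_eq_sub] at b2
  have := hm1 t htT
  have b3 := abs_le.1 b1
  have b4 := abs_le.1 b2
  linarith [b3.2, b4.1]

end

/-! ### Rescaling. -/

section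
variable {d : ℕ} {s p : ℝ} {u : EuclideanSpace ℝ (Fin d) → ℝ}

lemma lintegral_comp_smul {f : EuclideanSpace ℝ (Fin d) → ENNReal} (hf : Measurable f) {c : ℝ}
    (hc : 0 < c) : ∫⁻ x, f (c • x) = ENNReal.ofReal ((c ^ d)⁻¹) * ∫⁻ x, f x := by
  have h1 := Measure.map_addHaar_smul (volume : Measure (EuclideanSpace ℝ (Fin d))) hc.ne'
  rw [← lintegral_map hf (measurable_const_smul c), h1, lintegral_smul_measure,
    finrank_euclideanSpace, Fintype.card_fin, abs_of_pos (by positivity), smul_eq_mul]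

lemma setLIntegral_comp_smul {f : EuclideanSpace ℝ (Fin d) → ENNReal} (hf : Measurable f)
    {S T : Set (EuclideanSpace ℝ (Fin d))} (hS : MeasurableSet S) (hT : MeasurableSet T) {c : ℝ}
    (hc : 0 < c) (hST : ∀ x, x ∈ S ↔ c • x ∈ T) :
    ∫⁻ x in S, f (c • x) = ENNReal.ofReal ((c ^ d)⁻¹) * ∫⁻ x in T, f x := by
  rw [← lintegral_indicator hS, ← lintegral_indicator hT,
    ← lintegral_comp_smul (hf.indicator hT) hc]
  congr 1; ext x
  by_cases hx : x ∈ S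
  · rw [indicator_of_mem hx, indicator_of_mem ((hST x).1 hx)]
  · rw [indicator_of_notMem hx, indicator_of_notMem (fun h => hx ((hST x).2 h))]

/-- Only the vanishing of the form is transported, so the value of `k` is irrelevant. -/
lemma fracPLapForm_comp_smul (hp2 : 2 ≤ p) {c t : ℝ} (hc : 0 ≤ c) (ht : 0 < t)
    (φ : EuclideanSpace ℝ (Fin d) → ℝ) :
    ∃ k : ℝ, fracPLapForm s p (fun x => c * u (t • x)) φ
      = k * fracPLapForm s p u (fun x => φ (t⁻¹ • x)) := by
  set f : EuclideanSpace ℝ (Fin d) × EuclideanSpace ℝ (Fin d) → ℝ := fun z =>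
    |u z.1 - u z.2| ^ (p - 2) * (u z.1 - u z.2) * (φ (t⁻¹ • z.1) - φ (t⁻¹ • z.2))
      / ‖z.1 - z.2‖ ^ ((d : ℝ) + s * p) with hf
  have h1 := Measure.integral_comp_smul
    ((volume : Measure (EuclideanSpace ℝ (Fin d))).prod volume) f t
  refine ⟨c ^ (p - 1) * t ^ ((d : ℝ) + s * p) *
    |(t ^ Module.finrank ℝ (EuclideanSpace ℝ (Fin d) × EuclideanSpace ℝ (Fin d)))⁻¹|, ?_⟩
  have h2 : fracPLapForm s p u (fun x => φ (t⁻¹ • x)) = ∫ z, f z ∂(volume.prod volume) := rfl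
  rw [h2, mul_assoc, ← smul_eq_mul |_|, ← h1, fracPLapForm, ← integral_const_mul]
  congr 1; ext z
  have e1 : |c * u (t • z.1) - c * u (t • z.2)| ^ (p - 2) * (c * u (t • z.1) - c * u (t • z.2))
      = c ^ (p - 1) * (|u (t • z.1) - u (t • z.2)| ^ (p - 2) * (u (t • z.1) - u (t • z.2))) := by
    have := signPow_mul hc hp2 (u (t • z.1) - u (t • z.2))
    unfold signPow at this
    rw [← mul_sub]; exact this
  have e2 : ‖t • z.1 - t • z.2‖ ^ ((d : ℝ) + s * p)
      = t ^ ((d : ℝ) + s * p) * ‖z.1 - z.2‖ ^ ((d : ℝ) + s * p) := by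
    rw [← smul_sub, norm_smul, Real.norm_of_nonneg ht.le, Real.mul_rpow ht.le (norm_nonneg _)]
  have ht' : 0 < t ^ ((d : ℝ) + s * p) := by positivity
  simp only [hf, Prod.smul_fst, Prod.smul_snd, inv_smul_smul₀ ht.ne']
  rw [e1, e2]
  rcases eq_or_ne (‖z.1 - z.2‖ ^ ((d : ℝ) + s * p)) 0 with h0 | h0
  · rw [h0, div_zero, mul_zero, div_zero, mul_zero]
  · field_simp

lemma abs_sub_le_of_fderiv_le {ρ b : ℝ} (hu : ContDiffOn ℝ 1 u (ball 0 ρ))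
    (hb : ∀ x ∈ ball (0 : EuclideanSpace ℝ (Fin d)) ρ, ‖fderiv ℝ u x‖ ≤ b)
    {x y : EuclideanSpace ℝ (Fin d)} (hx : x ∈ ball (0 : EuclideanSpace ℝ (Fin d)) ρ)
    (hy : y ∈ ball (0 : EuclideanSpace ℝ (Fin d)) ρ) : |u x - u y| ≤ b * ‖x - y‖ :=
  (convex_ball 0 ρ).norm_image_sub_le_of_norm_fderiv_le
    (fun z hz => (hu.contDiffAt (isOpen_ball.mem_nhds hz)).differentiableAt (by norm_num)) hb hy hx

/-- Rescaled solutions are normalized. -/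
lemma coreSol_comp_smul (hp2 : 2 ≤ p) (hs0 : 0 < s) {R R' β c t : ℝ} (hc : 0 < c) (ht : 0 < t)
    (ht1 : t ≤ 1) (htR : t * R ≤ R') (hum : Measurable u) (hdiff : ContDiffOn ℝ 1 u (ball 0 R'))
    (hgrad : ∀ x ∈ ball (0 : EuclideanSpace ℝ (Fin d)) (t * R), ‖fderiv ℝ u x‖ ≤ 1 / (c * t))
    (h0 : u 0 = 0)
    (htail : ∫⁻ y, ENNReal.ofReal (|u y| ^ (p - 1) / (1 + ‖y‖) ^ ((d : ℝ) + s * p)) < ⊤)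
    (hweak : ∀ φ, IsNonnegTest (ball 0 R') φ → fracPLapForm s p u φ = 0)
    (hβ : ∫⁻ y in (ball 0 R)ᶜ, ENNReal.ofReal (|c * u (t • y)| ^ (p - 1)
      / ‖y‖ ^ ((d : ℝ) + s * p + 1)) ≤ ENNReal.ofReal β) :
    CoreSol s p R β (fun x => c * u (t • x)) := by
  have hmem : ∀ {x : EuclideanSpace ℝ (Fin d)}, x ∈ ball (0 : EuclideanSpace ℝ (Fin d)) R →
      t • x ∈ ball (0 : EuclideanSpace ℝ (Fin d)) (t * R) := by
    intro x hx
    rw [mem_ball_zero_iff] at hx ⊢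
    rw [norm_smul, Real.norm_of_nonneg ht.le]
    exact mul_lt_mul_of_pos_left hx ht
  have hsub := ball_subset_ball (x := (0 : EuclideanSpace ℝ (Fin d))) htR
  refine ⟨by fun_prop, ?_, ?_, by simp [h0], ?_, hβ, ?_⟩
  · refine contDiffOn_const.mul (hdiff.comp (contDiff_const_smul t).contDiffOn ?_)
    exact fun x hx => hsub (hmem hx)
  · intro x hx y hy
    have := abs_sub_le_of_fderiv_le (hdiff.mono hsub) hgrad (hmem hx) (hmem hy)
    rw [← smul_sub, norm_smul, Real.norm_of_nonneg ht.le] at this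
    rw [← mul_sub, abs_mul, abs_of_pos hc]
    refine (mul_le_mul_of_nonneg_left this hc.le).trans (le_of_eq ?_)
    field_simp
  · have hm : Measurable fun y => ENNReal.ofReal (c ^ (p - 1) * (|u y| ^ (p - 1)
        / (1 + ‖y‖) ^ ((d : ℝ) + s * p))) := by fun_prop
    have h1 := lintegral_comp_smul hm ht
    refine lt_of_le_of_lt (b := ∫⁻ y, ENNReal.ofReal (c ^ (p - 1) * (|u (t • y)| ^ (p - 1)
        / (1 + ‖t • y‖) ^ ((d : ℝ) + s * p)))) (lintegral_mono fun y => ?_) ?_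
    · refine ENNReal.ofReal_le_ofReal ?_
      rw [abs_mul, abs_of_pos hc, Real.mul_rpow hc.le (abs_nonneg _), mul_div_assoc]
      have : ‖t • y‖ ≤ ‖y‖ := by
        rw [norm_smul, Real.norm_of_nonneg ht.le]
        exact mul_le_of_le_one_left (norm_nonneg _) ht1
      gcongr
    · rw [h1]
      refine ENNReal.mul_lt_top ENNReal.ofReal_lt_top ?_
      have : ∀ y, ENNReal.ofReal (c ^ (p - 1) * (|u y| ^ (p - 1)
        / (1 + ‖y‖) ^ ((d : ℝ) + s * p))) = ENNReal.ofReal (c ^ (p - 1)) *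
          ENNReal.ofReal (|u y| ^ (p - 1) / (1 + ‖y‖) ^ ((d : ℝ) + s * p)) := fun y =>
        ENNReal.ofReal_mul (by positivity)
      simp_rw [this]
      rw [lintegral_const_mul _ (by fun_prop)]
      exact ENNReal.mul_lt_top ENNReal.ofReal_lt_top htail
  · intro φ hφ
    obtain ⟨k, hk⟩ := fracPLapForm_comp_smul (s := s) (u := u) hp2 hc.le ht φ
    rw [hk, hweak _ ?_, mul_zero]
    obtain ⟨h1, h2, h3, h4⟩ := hφ
    have hemb : (fun x => φ (t⁻¹ • x)) = φ ∘ (Homeomorph.smulOfNeZero t⁻¹ (inv_ne_zero ht.ne')) := rfl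
    refine ⟨h1.comp (contDiff_const_smul _), ?_, ?_, fun x => h4 _⟩
    · rw [hemb]; exact h2.comp_homeomorph _
    · rw [hemb, tsupport_comp_eq_preimage]
      intro x hx
      have := hmem (h3 hx)
      rw [Homeomorph.smulOfNeZero_apply, smul_inv_smul₀ ht.ne'] at this
      exact hsub this

lemma setLIntegral_rpow_le_farMass {γ r k : ℝ} (hγ : 0 < γ) (hr : 1 ≤ r) (hk : 0 ≤ k) :
    ∫⁻ y in (ball (0 : EuclideanSpace ℝ (Fin d)) r)ᶜ,
      ENNReal.ofReal (k * (‖y‖ ^ ((d : ℝ) + γ))⁻¹) ≤ ENNReal.ofReal (k * farMass d γ r) := by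
  have hint := (integrable_max_rpow (d := d) hγ hr).const_mul k
  rw [farMass, ← integral_const_mul, ofReal_integral_eq_lintegral_ofReal hint
    (ae_of_all _ fun y => by
      have : 0 < max ‖y‖ r := lt_of_lt_of_le (by linarith) (le_max_right _ _)
      positivity)]
  refine le_trans ?_ (setLIntegral_le_lintegral (ball (0 : EuclideanSpace ℝ (Fin d)) r)ᶜ _)
  refine setLIntegral_mono' measurableSet_ball.compl fun y hy => ENNReal.ofReal_le_ofReal ?_
  rw [mem_compl_iff, mem_ball_zero_iff, not_lt] at hy
  rw [max_eq_left hy]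

end

section
variable {d : ℕ} {s p : ℝ} {u : EuclideanSpace ℝ (Fin d) → ℝ}

/-- Tail estimate for the rescaled solutions. -/
lemma lintegral_rescaled_tail_le (hp2 : 2 ≤ p) {α q η : ℝ} {n m K₀ : ℕ} (hα0 : 0 ≤ α)
    (hα1 : α ≤ 1) (hα : 0 < 2 - p * (1 - s) - α * (p - 1)) (hq0 : 0 < q) (hq1 : q ≤ 1)
    (hqα : q⁻¹ ≤ 2 ^ α) (hum : Measurable u)
    (hdiff : ContDiffOn ℝ 1 u (ball 0 (2 ^ (K₀ + 1)))) (h0 : u 0 = 0)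
    (hgrad : ∀ k : ℕ, k ≤ K₀ + n → ∀ x : EuclideanSpace ℝ (Fin d), ‖x‖ < 2 ^ k * ((2 : ℝ) ^ n)⁻¹ →
      ‖fderiv ℝ u x‖ ≤ q ^ n / q ^ k)
    (htail : ∫⁻ y in (ball (0 : EuclideanSpace ℝ (Fin d)) (2 ^ K₀))ᶜ,
      ENNReal.ofReal (|u y| ^ (p - 1) / ‖y‖ ^ ((d : ℝ) + s * p + 1)) ≤ ENNReal.ofReal η) :
    ∫⁻ y in (ball (0 : EuclideanSpace ℝ (Fin d)) (2 ^ m))ᶜ,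
      ENNReal.ofReal (|q ^ m / q ^ n * 2 ^ n * u (((2 : ℝ) ^ n)⁻¹ • y)| ^ (p - 1)
        / ‖y‖ ^ ((d : ℝ) + s * p + 1))
      ≤ ENNReal.ofReal (2 ^ (p - 1) * farMass d (2 - p * (1 - s) - α * (p - 1)) (2 ^ m))
        + ENNReal.ofReal η := by
  set D : ℝ := (d : ℝ) + s * p + 1 with hD
  set t : ℝ := ((2 : ℝ) ^ n)⁻¹ with ht
  set c : ℝ := q ^ m / q ^ n * 2 ^ n with hc
  have ht0 : 0 < t := by positivity
  have hc0 : 0 < c := by positivity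
  have hct : c * t = q ^ m / q ^ n := by rw [hc, ht, mul_inv_cancel_right₀ (by positivity)]
  have hqi : 1 ≤ q⁻¹ := (one_le_inv₀ hq0).2 hq1
  -- With `2^k ≤ ‖y‖ < 2^(k+1)`, the gradient bound at scale `k + 1` gives growth `q^(-(k+1)) ‖y‖`,
  -- and `q⁻¹ ≤ 2^α` turns the power of `q` into `2 ‖y‖^α`.
  have growth : ∀ y : EuclideanSpace ℝ (Fin d), 1 ≤ ‖y‖ → ‖y‖ < 2 ^ (K₀ + n) →
      |c * u (t • y)| ≤ 2 * ‖y‖ ^ (1 + α) := by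
    intro y hy1 hy2
    have hy0 : 0 < ‖y‖ := by linarith
    obtain ⟨k, hk1, hk2⟩ := exists_nat_pow_near hy1 (one_lt_two (α := ℝ))
    have hk : k + 1 ≤ K₀ + n := by
      have := (pow_lt_pow_iff_right₀ (one_lt_two (α := ℝ))).1 (hk1.trans_lt hy2)
      omega
    have hρ : (2 : ℝ) ^ (k + 1) * t ≤ 2 ^ (K₀ + 1) := by
      have : (2 : ℝ) ^ (k + 1) ≤ 2 ^ (K₀ + n) := pow_le_pow_right₀ one_le_two hk
      calc (2 : ℝ) ^ (k + 1) * t ≤ 2 ^ (K₀ + n) * t := by gcongr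
        _ = 2 ^ K₀ := by rw [pow_add, mul_assoc, ht, mul_inv_cancel₀ (by positivity), mul_one]
        _ ≤ 2 ^ (K₀ + 1) := pow_le_pow_right₀ one_le_two (by omega)
    have hty : ‖t • y‖ = t * ‖y‖ := by rw [norm_smul, Real.norm_of_nonneg ht0.le]
    have h1 := abs_sub_le_of_fderiv_le (hdiff.mono (ball_subset_ball hρ))
      (fun x hx => hgrad (k + 1) hk x (by simpa using hx)) (x := t • y) (y := 0)
      (by rw [mem_ball_zero_iff, hty, mul_comm]; gcongr)
      (mem_ball_self (by positivity))
    rw [h0, sub_zero, sub_zero, hty] at h1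
    have h2 : c * (q ^ n / q ^ (k + 1) * (t * ‖y‖)) ≤ (q⁻¹) ^ (k + 1) * ‖y‖ := by
      have : c * (q ^ n / q ^ (k + 1) * (t * ‖y‖)) = (c * t) * (q ^ n / q ^ (k + 1)) * ‖y‖ := by ring
      rw [this, hct]
      have e : q ^ m / q ^ n * (q ^ n / q ^ (k + 1)) = q ^ m * (q⁻¹) ^ (k + 1) := by
        rw [inv_pow]; field_simp
      rw [e]
      have := pow_le_one₀ (n := m) hq0.le hq1
      gcongr
      exact mul_le_of_le_one_left (by positivity) this
    have h3 : (q⁻¹) ^ (k + 1) ≤ 2 * ‖y‖ ^ α := by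
      calc (q⁻¹) ^ (k + 1) ≤ ((2 : ℝ) ^ α) ^ (k + 1) := by gcongr
        _ = ((2 : ℝ) ^ (k + 1)) ^ α := by
          rw [← Real.rpow_natCast, ← Real.rpow_natCast, ← Real.rpow_mul (by norm_num),
            ← Real.rpow_mul (by norm_num), mul_comm]
        _ ≤ (2 * ‖y‖) ^ α := by
          refine Real.rpow_le_rpow (by positivity) ?_ hα0
          rw [pow_succ]; linarith
        _ = 2 ^ α * ‖y‖ ^ α := Real.mul_rpow (by norm_num) hy0.le
        _ ≤ 2 ^ (1 : ℝ) * ‖y‖ ^ α := by gcongr; norm_num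
        _ = _ := by rw [Real.rpow_one]
    rw [abs_mul, abs_of_pos hc0]
    calc c * |u (t • y)| ≤ c * (q ^ n / q ^ (k + 1) * (t * ‖y‖)) := by gcongr
      _ ≤ (q⁻¹) ^ (k + 1) * ‖y‖ := h2
      _ ≤ 2 * ‖y‖ ^ α * ‖y‖ := by gcongr
      _ = _ := by rw [Real.rpow_add hy0, Real.rpow_one]; ring
  have hm : Measurable fun y => ENNReal.ofReal (c ^ (p - 1) * t ^ D * (|u y| ^ (p - 1)
      / ‖y‖ ^ D)) := by fun_prop
  have outer : ∫⁻ y in (ball (0 : EuclideanSpace ℝ (Fin d)) (2 ^ (K₀ + n)))ᶜ,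
      ENNReal.ofReal (|c * u (t • y)| ^ (p - 1) / ‖y‖ ^ D) ≤ ENNReal.ofReal η := by
    have h1 : ∀ y ∈ (ball (0 : EuclideanSpace ℝ (Fin d)) (2 ^ (K₀ + n)))ᶜ,
        ENNReal.ofReal (|c * u (t • y)| ^ (p - 1) / ‖y‖ ^ D)
        = ENNReal.ofReal (c ^ (p - 1) * t ^ D * (|u (t • y)| ^ (p - 1) / ‖t • y‖ ^ D)) := by
      intro y _
      congr 1
      have : 0 < t ^ D := by positivity
      rw [abs_mul, abs_of_pos hc0, Real.mul_rpow hc0.le (abs_nonneg _), norm_smul,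
        Real.norm_of_nonneg ht0.le, Real.mul_rpow ht0.le (norm_nonneg _)]
      field_simp
    rw [setLIntegral_congr_fun measurableSet_ball.compl h1, setLIntegral_comp_smul hm
      measurableSet_ball.compl (T := (ball (0 : EuclideanSpace ℝ (Fin d)) (2 ^ K₀))ᶜ)
      measurableSet_ball.compl ht0]
    · have h2 : ∀ y, ENNReal.ofReal (c ^ (p - 1) * t ^ D * (|u y| ^ (p - 1) / ‖y‖ ^ D))
          = ENNReal.ofReal (c ^ (p - 1) * t ^ D) *
            ENNReal.ofReal (|u y| ^ (p - 1) / ‖y‖ ^ D) := fun y =>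
        ENNReal.ofReal_mul (by positivity)
      simp_rw [h2]
      rw [lintegral_const_mul _ (by fun_prop), ← mul_assoc, ← ENNReal.ofReal_mul (by positivity)]
      -- Rescaling does not increase the contribution from outside the original ball: the factor is
      -- at most `2^(-n (γ - α (p-1)))`, with positive bracket.
      suffices hle : (t ^ d)⁻¹ * (c ^ (p - 1) * t ^ D) ≤ 1 by
        refine (mul_le_mul' (ENNReal.ofReal_le_ofReal hle) htail).trans (le_of_eq ?_)
        rw [ENNReal.ofReal_one, one_mul]
      have e1 : (t ^ d)⁻¹ * (c ^ (p - 1) * t ^ D) = (c * t) ^ (p - 1) * t ^ (2 - p * (1 - s)) := by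
        rw [Real.mul_rpow hc0.le ht0.le, ← Real.rpow_natCast, ← Real.rpow_neg ht0.le,
          show t ^ (-(d : ℝ)) * (c ^ (p - 1) * t ^ D) = c ^ (p - 1) * (t ^ (-(d : ℝ)) * t ^ D) by ring,
          ← Real.rpow_add ht0, mul_assoc, ← Real.rpow_add ht0]
        congr 2; rw [hD]; ring
      have h3 : c * t ≤ 2 ^ (α * n) := by
        rw [hct]
        calc q ^ m / q ^ n ≤ 1 / q ^ n := by gcongr; exact pow_le_one₀ hq0.le hq1
          _ = (q⁻¹) ^ n := by rw [inv_pow, one_div]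
          _ ≤ ((2 : ℝ) ^ α) ^ n := by gcongr
          _ = _ := by rw [← Real.rpow_natCast, ← Real.rpow_mul (by norm_num)]
      have h4 : t ^ (2 - p * (1 - s)) = 2 ^ (-(n * (2 - p * (1 - s)))) := by
        rw [ht, Real.inv_rpow (by positivity), ← Real.rpow_natCast, ← Real.rpow_mul (by norm_num),
          ← Real.rpow_neg (by norm_num)]
      rw [e1, h4]
      calc (c * t) ^ (p - 1) * 2 ^ (-(n * (2 - p * (1 - s))))
          ≤ ((2 : ℝ) ^ (α * n)) ^ (p - 1) * 2 ^ (-(n * (2 - p * (1 - s)))) := by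
            gcongr; linarith
        _ = 2 ^ (-(n * (2 - p * (1 - s) - α * (p - 1)))) := by
            rw [← Real.rpow_mul (by norm_num), ← Real.rpow_add (by norm_num)]; congr 1; ring
        _ ≤ 1 := Real.rpow_le_one_of_one_le_of_nonpos one_le_two (by
            have : 0 ≤ n * (2 - p * (1 - s) - α * (p - 1)) := by positivity
            linarith)
    · intro y
      rw [mem_compl_iff, mem_compl_iff, mem_ball_zero_iff, mem_ball_zero_iff, norm_smul,
        Real.norm_of_nonneg ht0.le, ht, inv_mul_lt_iff₀ (by positivity), pow_add, mul_comm]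
  have inner : ∫⁻ y in (ball (0 : EuclideanSpace ℝ (Fin d)) (2 ^ m))ᶜ ∩ ball 0 (2 ^ (K₀ + n)),
      ENNReal.ofReal (|c * u (t • y)| ^ (p - 1) / ‖y‖ ^ D)
      ≤ ENNReal.ofReal (2 ^ (p - 1) * farMass d (2 - p * (1 - s) - α * (p - 1)) (2 ^ m)) := by
    have hm1 : (1 : ℝ) ≤ 2 ^ m := one_le_pow₀ one_le_two
    refine le_trans ?_ (setLIntegral_rpow_le_farMass hα hm1 (by positivity : (0 : ℝ) ≤ 2 ^ (p - 1)))
    refine le_trans ?_ (lintegral_mono_set (inter_subset_left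
      (s := (ball (0 : EuclideanSpace ℝ (Fin d)) (2 ^ m))ᶜ) (t := ball 0 (2 ^ (K₀ + n)))))
    refine setLIntegral_mono' (measurableSet_ball.compl.inter measurableSet_ball) fun y hy =>
      ENNReal.ofReal_le_ofReal ?_
    have hy1 : (2 : ℝ) ^ m ≤ ‖y‖ := by simpa using hy.1
    have hy0 : 0 < ‖y‖ := by linarith
    have h1 := growth y (by linarith) (by simpa using hy.2)
    calc |c * u (t • y)| ^ (p - 1) / ‖y‖ ^ D ≤ (2 * ‖y‖ ^ (1 + α)) ^ (p - 1) / ‖y‖ ^ D := by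
          gcongr; linarith
      _ = _ := by
          rw [Real.mul_rpow (by norm_num) (by positivity), ← Real.rpow_mul hy0.le, mul_div_assoc,
            ← Real.rpow_sub hy0, ← Real.rpow_neg hy0.le]
          congr 2; rw [hD]; ring
  have hsplit : (ball (0 : EuclideanSpace ℝ (Fin d)) (2 ^ m))ᶜ ⊆
      ((ball (0 : EuclideanSpace ℝ (Fin d)) (2 ^ m))ᶜ ∩ ball 0 (2 ^ (K₀ + n)))
        ∪ (ball (0 : EuclideanSpace ℝ (Fin d)) (2 ^ (K₀ + n)))ᶜ := by
    intro y hy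
    by_cases h : y ∈ ball (0 : EuclideanSpace ℝ (Fin d)) (2 ^ (K₀ + n))
    · exact Or.inl ⟨hy, h⟩
    · exact Or.inr h
  exact (lintegral_mono_set hsplit).trans ((lintegral_union_le _ _ _).trans (add_le_add inner outer))

lemma gradient_comp_smul {c t : ℝ} {x : EuclideanSpace ℝ (Fin d)}
    (hx : DifferentiableAt ℝ u (t • x)) :
    gradient (fun x => c * u (t • x)) x = (c * t) • gradient u (t • x) := by
  have h1 : DifferentiableAt ℝ (fun x => u (t • x)) x :=
    DifferentiableAt.comp (f := fun x => t • x) x hx (by fun_prop)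
  refine ext_inner_right ℝ fun v => ?_
  rw [inner_gradient_eq, inner_smul_left, inner_gradient_eq, fderiv_const_mul h1, fderiv_comp_smul]
  simp [mul_assoc]

open scoped Pointwise

/-- One step of the iteration over dyadic scales. -/
lemma gradient_close_or_decay (hp2 : 2 ≤ p) (hs0 : 0 < s) {α q η r μ : ℝ} {n m K₀ : ℕ}
    (hα0 : 0 ≤ α) (hα1 : α ≤ 1) (hα : 0 < 2 - p * (1 - s) - α * (p - 1)) (hq0 : 0 < q)
    (hq1 : q ≤ 1) (hqα : q⁻¹ ≤ 2 ^ α) (hr : 0 < r) (hmK : m ≤ K₀) (hη : 0 ≤ η)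
    (hqhalf : 1 / 2 ≤ q ^ m) (hqr : 1 ≤ q ^ m * (1 + r / 2)) (hqm : 1 - (1 / 2) ^ m ≤ q ^ (m + 1))
    (core : ∀ (v : EuclideanSpace ℝ (Fin d) → ℝ) (x₀ : EuclideanSpace ℝ (Fin d)),
      CoreSol s p (2 ^ m) (2 ^ (p - 1) * farMass d (2 - p * (1 - s) - α * (p - 1)) (2 ^ m) + η) v →
      ‖x₀‖ < 1 → 1 - (1 / 2) ^ m ≤ ‖gradient v x₀‖ →
      ∃ e : EuclideanSpace ℝ (Fin d), ‖e‖ = 1 ∧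
        ENNReal.ofReal (1 - μ) * volume (ball (0 : EuclideanSpace ℝ (Fin d)) 1)
          ≤ volume {x ∈ ball (0 : EuclideanSpace ℝ (Fin d)) 1 | ‖gradient v x - e‖ ≤ r / 4})
    (hum : Measurable u)
    (hdiff : ContDiffOn ℝ 1 u (ball 0 (2 ^ (K₀ + 1)))) (h0 : u 0 = 0)
    (hgrad : ∀ k : ℕ, k ≤ K₀ + n → ∀ x : EuclideanSpace ℝ (Fin d), ‖x‖ < 2 ^ k * ((2 : ℝ) ^ n)⁻¹ →
      ‖fderiv ℝ u x‖ ≤ q ^ n / q ^ k)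
    (htailspace : ∫⁻ y, ENNReal.ofReal (|u y| ^ (p - 1) / (1 + ‖y‖) ^ ((d : ℝ) + s * p)) < ⊤)
    (htail : ∫⁻ y in (ball (0 : EuclideanSpace ℝ (Fin d)) (2 ^ K₀))ᶜ,
      ENNReal.ofReal (|u y| ^ (p - 1) / ‖y‖ ^ ((d : ℝ) + s * p + 1)) ≤ ENNReal.ofReal η)
    (hweak : ∀ φ, IsNonnegTest (ball 0 (2 ^ (K₀ + 1))) φ → fracPLapForm s p u φ = 0) :
    (∃ e : EuclideanSpace ℝ (Fin d), ‖e‖ = 1 ∧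
      ENNReal.ofReal (1 - μ) * volume (ball (0 : EuclideanSpace ℝ (Fin d)) ((2 : ℝ) ^ n)⁻¹)
        ≤ volume {x ∈ ball (0 : EuclideanSpace ℝ (Fin d)) ((2 : ℝ) ^ n)⁻¹ |
          ‖gradient u x - q ^ n • e‖ ≤ r * q ^ n}) ∨
    ∀ x ∈ ball (0 : EuclideanSpace ℝ (Fin d)) ((2 : ℝ) ^ (n + 1))⁻¹,
      ‖gradient u x‖ ≤ q ^ (n + 1) := by
  have htail' := lintegral_rescaled_tail_le (m := m) hp2 hα0 hα1 hα hq0 hq1 hqα hum hdiff h0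
    hgrad htail
  set t : ℝ := ((2 : ℝ) ^ n)⁻¹ with ht
  -- The gradient of `u` is at most `q^n / q^m` at radius `2^m t`; the extra factor `q^m`, close to
  -- one, makes the rescaled gradient at most one on the whole of `ball 0 (2^m)`.
  set c : ℝ := q ^ m / q ^ n * 2 ^ n with hc
  have ht0 : 0 < t := by positivity
  have ht1 : t ≤ 1 := inv_le_one_of_one_le₀ (one_le_pow₀ one_le_two)
  have hc0 : 0 < c := by positivity
  have hct : c * t = q ^ m / q ^ n := by rw [hc, ht, mul_inv_cancel_right₀ (by positivity)]
  have htm : t * 2 ^ m ≤ 2 ^ (K₀ + 1) :=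
    (mul_le_of_le_one_left (by positivity) ht1).trans (pow_le_pow_right₀ one_le_two (by omega))
  have hfar : 0 ≤ farMass d (2 - p * (1 - s) - α * (p - 1)) (2 ^ m) :=
    integral_nonneg fun y => by positivity
  rw [← ENNReal.ofReal_add (by positivity) hη] at htail'
  have hv := coreSol_comp_smul hp2 hs0 hc0 ht0 ht1 htm hum hdiff (fun x hx => by
    rw [hct, one_div_div]
    exact hgrad m (by omega) x (by rw [mul_comm]; simpa using hx)) h0 htailspace hweak htail'
  have hone : (1 : ℝ) ≤ 2 ^ m := one_le_pow₀ one_le_two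
  have hgr : ∀ x : EuclideanSpace ℝ (Fin d), ‖x‖ < 1 →
      gradient (fun x => c * u (t • x)) x = (q ^ m / q ^ n) • gradient u (t • x) := by
    intro x hx
    rw [← hct]
    refine gradient_comp_smul ((hdiff.contDiffAt (isOpen_ball.mem_nhds ?_)).differentiableAt
      (by norm_num))
    rw [mem_ball_zero_iff, norm_smul, Real.norm_of_nonneg ht0.le]
    exact lt_of_lt_of_le (mul_lt_mul_of_pos_left (hx.trans_le hone) ht0) htm
  have hqn : 0 < q ^ n := by positivity
  have hqm0 : 0 < q ^ m := by positivity
  by_cases hbig : ∃ x₀ : EuclideanSpace ℝ (Fin d), ‖x₀‖ < 1 ∧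
      1 - (1 / 2) ^ m ≤ ‖gradient (fun x => c * u (t • x)) x₀‖
  · left
    obtain ⟨x₀, hx₀, hx₀'⟩ := hbig
    obtain ⟨e, he, hvol⟩ := core _ x₀ hv hx₀ hx₀'
    refine ⟨e, he, ?_⟩
    set S := {x ∈ ball (0 : EuclideanSpace ℝ (Fin d)) 1 |
      ‖gradient (fun x => c * u (t • x)) x - e‖ ≤ r / 4} with hS
    have hsub : t • S ⊆ {x ∈ ball (0 : EuclideanSpace ℝ (Fin d)) t |
        ‖gradient u x - q ^ n • e‖ ≤ r * q ^ n} := by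
      rintro _ ⟨x, ⟨hx1, hx2⟩, rfl⟩
      have hx1' : ‖x‖ < 1 := by simpa using hx1
      refine ⟨?_, ?_⟩
      · show t • x ∈ _
        rw [mem_ball_zero_iff, norm_smul, Real.norm_of_nonneg ht0.le]
        nlinarith
      · show ‖gradient u (t • x) - q ^ n • e‖ ≤ r * q ^ n
        rw [hgr x hx1'] at hx2
        -- Removing the factor `q^m` costs `1 - q^m ≤ r q^m / 2` by `hqr`, and `r / 4 ≤ r q^m / 2`
        -- by `hqhalf`, which is why the closeness is required with `r / 4`.
        have e1 : gradient u (t • x) - q ^ n • e = (q ^ n / q ^ m) •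
            (((q ^ m / q ^ n) • gradient u (t • x) - e) + (1 - q ^ m) • e) := by
          rw [sub_smul, one_smul, sub_add_sub_cancel, smul_sub, smul_smul, smul_smul]
          congr 1
          · rw [div_mul_div_cancel₀ hqm0.ne', div_self hqn.ne', one_smul]
          · rw [div_mul_cancel₀ _ hqm0.ne']
        rw [e1, norm_smul, Real.norm_of_nonneg (by positivity)]
        have h2 := norm_add_le ((q ^ m / q ^ n) • gradient u (t • x) - e) ((1 - q ^ m) • e)
        have hq1m : q ^ m ≤ 1 := pow_le_one₀ hq0.le hq1
        rw [norm_smul_unit he, abs_of_nonneg (by linarith)] at h2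
        have h3 : ‖(q ^ m / q ^ n) • gradient u (t • x) - e + (1 - q ^ m) • e‖ ≤ r * q ^ m := by
          nlinarith
        calc _ ≤ q ^ n / q ^ m * (r * q ^ m) := by gcongr
          _ = r * q ^ n := by field_simp
    refine le_trans ?_ (measure_mono hsub)
    rw [Measure.addHaar_smul, Measure.addHaar_ball_of_pos _ _ ht0, abs_of_pos (by positivity),
      ← mul_assoc, mul_comm (ENNReal.ofReal (1 - μ)), mul_assoc]
    exact mul_le_mul_right hvol _
  · right
    push Not at hbig
    intro y hy
    have hyt : ‖y‖ < t := by
      rw [mem_ball_zero_iff] at hy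
      refine hy.trans_le ?_
      rw [ht]
      exact inv_anti₀ (by positivity) (pow_le_pow_right₀ one_le_two (by omega))
    have hx : ‖t⁻¹ • y‖ < 1 := by
      rw [norm_smul, norm_inv, Real.norm_of_nonneg ht0.le, inv_mul_lt_iff₀ ht0, mul_one]
      exact hyt
    have h1 := (hbig _ hx).le.trans hqm
    rw [hgr _ hx, smul_inv_smul₀ ht0.ne', norm_smul, Real.norm_of_nonneg (by positivity)] at h1
    have h2 := mul_le_mul_of_nonneg_left h1 (by positivity : 0 ≤ q ^ n / q ^ m)
    rw [← mul_assoc, div_mul_div_cancel₀ hqm0.ne', div_self hqn.ne', one_mul] at h2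
    refine h2.trans (le_of_eq ?_)
    rw [pow_succ, pow_succ]; field_simp

end

/-! ### Preparation of the hypotheses and the dyadic iteration. -/

section
variable {d : ℕ} {s p : ℝ} {u : EuclideanSpace ℝ (Fin d) → ℝ}

/-- The set where the bound fails is open by continuity of the gradient, so being null it is empty.
-/
lemma norm_gradient_le_of_gradSupNorm_le {ρ b : ℝ} (hu : ContDiffOn ℝ 1 u (ball 0 ρ)) (hb : 0 ≤ b)
    (h : gradSupNorm u ρ ≤ ENNReal.ofReal b) :
    ∀ x ∈ ball (0 : EuclideanSpace ℝ (Fin d)) ρ, ‖gradient u x‖ ≤ b := by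
  have hae : ∀ᵐ x ∂volume.restrict (ball (0 : EuclideanSpace ℝ (Fin d)) ρ), ‖gradient u x‖ ≤ b := by
    have h1 : ∀ᵐ x ∂volume.restrict (ball (0 : EuclideanSpace ℝ (Fin d)) ρ),
        ‖gradient u x‖ₑ ≤ eLpNormEssSup (gradient u) (volume.restrict (ball 0 ρ)) :=
      ae_le_eLpNormEssSup
    filter_upwards [h1] with x hx
    have h2 := hx.trans (by simpa [gradSupNorm] using h)
    rw [← ofReal_norm] at h2
    exact (ENNReal.ofReal_le_ofReal_iff hb).1 h2
  rw [ae_restrict_iff' measurableSet_ball] at hae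
  have hcont : ContinuousOn (fun x => ‖gradient u x‖) (ball 0 ρ) := by
    simp_rw [norm_gradient_eq]
    exact (hu.continuousOn_fderiv_of_isOpen isOpen_ball le_rfl).norm
  have hopen : IsOpen (ball (0 : EuclideanSpace ℝ (Fin d)) ρ ∩ (fun x => ‖gradient u x‖) ⁻¹' Ioi b) :=
    hcont.isOpen_inter_preimage isOpen_ball isOpen_Ioi
  have hnull : volume (ball (0 : EuclideanSpace ℝ (Fin d)) ρ ∩
      (fun x => ‖gradient u x‖) ⁻¹' Ioi b) = 0 := by
    refine measure_mono_null (fun x hx => ?_) (ae_iff.1 hae)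
    exact fun hc => absurd (hc hx.1) (not_le.2 hx.2)
  have hempty := (hopen.measure_eq_zero_iff volume).1 hnull
  intro x hx
  by_contra hc
  have : x ∈ (∅ : Set (EuclideanSpace ℝ (Fin d))) := hempty ▸ ⟨hx, not_le.1 hc⟩
  exact this

lemma gradSupNorm_le {ρ b : ℝ} (h : ∀ x ∈ ball (0 : EuclideanSpace ℝ (Fin d)) ρ, ‖gradient u x‖ ≤ b) :
    gradSupNorm u ρ ≤ ENNReal.ofReal b := by
  rw [gradSupNorm, eLpNorm_exponent_top]
  exact eLpNormEssSup_le_of_ae_bound ((ae_restrict_iff' measurableSet_ball).2 (ae_of_all _ h))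

/-- A solution is only almost everywhere measurable outside the ball, whereas `CoreSol` asks for
measurability. Keeping `u` on the ball preserves its pointwise gradient there. -/
lemma exists_measurable_modification {q α ρ : ℝ} (hu : MemTailSpace q α u)
    (hc : ContinuousOn u (ball 0 ρ)) :
    ∃ v : EuclideanSpace ℝ (Fin d) → ℝ, Measurable v ∧ v =ᵐ[volume] u ∧ EqOn v u (ball 0 ρ) := by
  classical
  have hae : AEMeasurable u := by
    have h1 : ∀ n : ℕ, AEMeasurable u (volume.restrict (closedBall 0 (n : ℝ))) := fun n =>
      (hu.1 _ (isCompact_closedBall _ _)).1.aemeasurable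
    have h2 := aemeasurable_iUnion_iff.2 h1
    rwa [iUnion_closedBall_nat, Measure.restrict_univ] at h2
  refine ⟨(ball 0 ρ).piecewise u (hae.mk u), ?_, ?_, fun x hx => piecewise_eq_of_mem _ _ _ hx⟩
  · refine measurable_of_restrict_of_restrict_compl (s := ball 0 ρ) measurableSet_ball ?_ ?_
    · rw [domRestrict_piecewise]
      exact (continuousOn_iff_continuous_domRestrict.1 hc).measurable
    · rw [domRestrict_piecewise_compl]
      exact hae.measurable_mk.comp measurable_subtype_coe
  · filter_upwards [hae.ae_eq_mk] with x hx
    by_cases h : x ∈ ball (0 : EuclideanSpace ℝ (Fin d)) ρ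
    · rw [piecewise_eq_of_mem _ _ _ h]
    · rw [piecewise_eq_of_notMem _ _ _ h, hx]

lemma fracPLapForm_congr_ae {v : EuclideanSpace ℝ (Fin d) → ℝ} (h : v =ᵐ[volume] u)
    (φ : EuclideanSpace ℝ (Fin d) → ℝ) : fracPLapForm s p v φ = fracPLapForm s p u φ := by
  have h1 := (Measure.quasiMeasurePreserving_fst (μ := volume)
    (ν := (volume : Measure (EuclideanSpace ℝ (Fin d))))).ae_eq h
  have h2 := (Measure.quasiMeasurePreserving_snd (μ := (volume : Measure (EuclideanSpace ℝ (Fin d))))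
    (ν := volume)).ae_eq h
  refine integral_congr_ae ?_
  filter_upwards [h1, h2] with z hz1 hz2
  simp only [Function.comp] at hz1 hz2
  rw [hz1, hz2]

lemma lintegral_tail_le_of_tailFun_le {q α ρ ε : ℝ} (hq : 1 ≤ q) (hε0 : 0 ≤ ε) (hε1 : ε ≤ 1)
    (h : tailFun q α u ρ ≤ ENNReal.ofReal ε) :
    ∫⁻ y in (ball 0 ρ)ᶜ, ENNReal.ofReal (|u y| ^ q / ‖y‖ ^ ((d : ℝ) + α)) ≤ ENNReal.ofReal ε := by
  have hq0 : 0 < q := by linarith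
  have h1 := ENNReal.rpow_le_rpow h hq0.le
  rw [tailFun, ← ENNReal.rpow_mul, one_div_mul_cancel hq0.ne', ENNReal.rpow_one,
    ENNReal.ofReal_rpow_of_nonneg hε0 hq0.le] at h1
  refine h1.trans (ENNReal.ofReal_le_ofReal ?_)
  exact (Real.rpow_le_rpow_of_exponent_ge' hε0 hε1 zero_le_one hq).trans_eq (Real.rpow_one _)

/-- Dyadic geometric decay of the gradient gives a Hölder bound at the origin. -/
lemma holder_of_dyadic_decay {q : ℝ} (hq0 : 0 < q) (hq1 : q < 1)
    (h : ∀ n : ℕ, ∀ x ∈ ball (0 : EuclideanSpace ℝ (Fin d)) ((2 : ℝ) ^ n)⁻¹, ‖gradient u x‖ ≤ q ^ n) :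
    ∃ α₀ : ℝ, 0 < α₀ ∧ (2 : ℝ) ^ (-α₀) = q ∧
      ∀ x ∈ ball (0 : EuclideanSpace ℝ (Fin d)) 1, ‖gradient u x‖ ≤ q⁻¹ * ‖x‖ ^ α₀ := by
  have hα : 0 < -Real.logb 2 q := neg_pos.2 (Real.logb_neg one_lt_two hq0 hq1)
  have h2q : (2 : ℝ) ^ (-(-Real.logb 2 q)) = q := by
    rw [neg_neg, Real.rpow_logb two_pos (by norm_num) hq0]
  refine ⟨-Real.logb 2 q, hα, h2q, fun x hx => ?_⟩
  rw [mem_ball_zero_iff] at hx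
  -- At the origin the bounds of all scales apply, so the gradient vanishes.
  rcases eq_or_ne x 0 with rfl | hx0
  · rw [norm_zero, Real.zero_rpow hα.ne', mul_zero]
    refine ge_of_tendsto' (tendsto_pow_atTop_nhds_zero_of_lt_one hq0.le hq1) fun n => ?_
    exact h n 0 (mem_ball_self (by positivity))
  have hxpos : 0 < ‖x‖ := norm_pos_iff.2 hx0
  have hex : ∃ k : ℕ, ((2 : ℝ) ^ k)⁻¹ ≤ ‖x‖ := by
    obtain ⟨k, hk⟩ := exists_pow_lt_of_lt_one hxpos (by norm_num : (1 / 2 : ℝ) < 1)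
    exact ⟨k, by rw [one_div, inv_pow] at hk; exact hk.le⟩
  classical
  have hk0 : Nat.find hex ≠ 0 := by
    intro h0
    have := Nat.find_spec hex
    rw [h0, pow_zero, inv_one] at this
    linarith
  obtain ⟨n, hn⟩ := Nat.exists_eq_succ_of_ne_zero hk0
  have h1 : ((2 : ℝ) ^ (n + 1))⁻¹ ≤ ‖x‖ := by have := Nat.find_spec hex; rwa [hn] at this
  have h2 : ‖x‖ < ((2 : ℝ) ^ n)⁻¹ := not_le.1 (Nat.find_min hex (by omega))
  have h3 := h n x (by simpa using h2)
  refine h3.trans ?_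
  have h4 : q ^ (n + 1) ≤ ‖x‖ ^ (-Real.logb 2 q) := by
    refine le_trans (le_of_eq ?_) (Real.rpow_le_rpow (by positivity) h1 hα.le)
    rw [Real.inv_rpow (by positivity), ← Real.rpow_neg (by positivity), ← Real.rpow_natCast,
      ← Real.rpow_natCast, ← Real.rpow_mul (by norm_num), mul_comm, Real.rpow_mul (by norm_num), h2q]
  rw [le_inv_mul_iff₀ hq0, ← pow_succ']
  exact h4

/-- With `m` fixed beforehand, each condition other than `0 < δ` is a strict inequality at `δ = 0`,
hence holds for small positive `δ`. -/
lemma exists_small_step {α r τ : ℝ} (hα : 0 < α) (hr : 0 < r) (hτ : 0 < τ) (m : ℕ) :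
    ∃ δ : ℝ, 0 < δ ∧ δ < 1 ∧ δ < τ ∧ (1 - δ)⁻¹ ≤ 2 ^ α ∧ 1 / 2 ≤ (1 - δ) ^ m ∧
      1 ≤ (1 - δ) ^ m * (1 + r / 2) ∧ 1 - (1 / 2) ^ m ≤ (1 - δ) ^ (m + 1) := by
  have T0 : Tendsto (fun δ : ℝ => δ) (𝓝[>] 0) (𝓝 0) := tendsto_nhdsWithin_of_tendsto_nhds tendsto_id
  have T1 : Tendsto (fun δ : ℝ => 1 - δ) (𝓝[>] 0) (𝓝 1) := by simpa using T0.const_sub 1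
  have T2 : ∀ k : ℕ, Tendsto (fun δ : ℝ => (1 - δ) ^ k) (𝓝[>] 0) (𝓝 1) := fun k => by
    simpa using T1.pow k
  have T3 : Tendsto (fun δ : ℝ => (1 - δ)⁻¹) (𝓝[>] 0) (𝓝 1) := by simpa using T1.inv₀ one_ne_zero
  have T4 : Tendsto (fun δ : ℝ => (1 - δ) ^ m * (1 + r / 2)) (𝓝[>] 0) (𝓝 (1 + r / 2)) := by
    simpa using (T2 m).mul_const (1 + r / 2)
  have h2 : (1 : ℝ) < 2 ^ α := Real.one_lt_rpow one_lt_two hα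
  have hm : (1 : ℝ) - (1 / 2) ^ m < 1 := by
    have : (0 : ℝ) < (1 / 2) ^ m := by positivity
    linarith
  have T5 : ∀ᶠ δ : ℝ in 𝓝[>] 0, 0 < δ := self_mem_nhdsWithin
  obtain ⟨δ, h1, h2, h3, h4, h5, h6, h7⟩ := (T5.and
    ((T0.eventually_lt_const one_pos).and ((T0.eventually_lt_const hτ).and
    ((T3.eventually_lt_const h2).and (((T2 m).eventually_const_lt (by norm_num : (1 / 2 : ℝ) < 1)).and
    ((T4.eventually_const_lt (by linarith : (1 : ℝ) < 1 + r / 2)).and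
      ((T2 (m + 1)).eventually_const_lt hm))))))).exists
  exact ⟨δ, h1, h2, h3, h4.le, h5.le, h6.le, h7.le⟩

end

theorem lemma5p1 (d : ℕ) (hd : 1 ≤ d) (s p : ℝ) (hs0 : 0 < s) (hs1 : s < 1)
    (hp2 : 2 ≤ p) (hp : p < 2 / (1 - s)) (r μ : ℝ) (hr : 0 < r) (hμ : 0 < μ)
    (τ : ℝ) (hτ : 0 < τ) :
    ∃ (δ ε₁ : ℝ) (K₀ : ℕ), 0 < δ ∧ δ < 1 ∧ 0 < ε₁ ∧ 0 < K₀ ∧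
      -- smallness of `δ`, `ε₁` and largeness of `K₀`, to any prescribed degree
      δ < τ ∧ ε₁ < τ ∧ 1 / τ < (K₀ : ℝ) ∧
      ∀ u : EuclideanSpace ℝ (Fin d) → ℝ,
        IsQualitativelyRegular s p (ball 0 ((2 : ℝ) ^ (K₀ + 1))) u →
        IsWeakSolution s p (ball 0 ((2 : ℝ) ^ (K₀ + 1))) u →
        u 0 = 0 →
        (∀ n : ℕ, n ≤ K₀ →
          gradSupNorm u ((2 : ℝ) ^ n) ≤ ENNReal.ofReal (((1 - δ) ^ n)⁻¹)) →
        tailFun (p - 1) (s * p + 1) u ((2 : ℝ) ^ K₀) ≤ ENNReal.ofReal ε₁ →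
        (∃ N : ℕ,
          (∀ n : ℕ, n ≤ N →
            gradSupNorm u (((2 : ℝ) ^ n)⁻¹) ≤ ENNReal.ofReal ((1 - δ) ^ n)) ∧
          ∃ e : EuclideanSpace ℝ (Fin d), ‖e‖ = 1 ∧
            ENNReal.ofReal (1 - μ) *
                volume (ball (0 : EuclideanSpace ℝ (Fin d)) (((2 : ℝ) ^ N)⁻¹)) ≤
              volume {x ∈ ball (0 : EuclideanSpace ℝ (Fin d)) (((2 : ℝ) ^ N)⁻¹) |
                ‖gradient u x - (1 - δ) ^ N • e‖ ≤ r * (1 - δ) ^ N}) ∨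
        (∃ α₀ : ℝ, 0 < α₀ ∧ (2 : ℝ) ^ (-α₀) = 1 - δ ∧
          ∀ x ∈ ball (0 : EuclideanSpace ℝ (Fin d)) 1,
            ‖gradient u x‖ ≤ (1 - δ)⁻¹ * ‖x‖ ^ α₀) := by
  have hγ : 0 < 2 - p * (1 - s) := by
    rw [lt_div_iff₀ (by linarith)] at hp; linarith
  have hp1 : 0 < p - 1 := by linarith
  -- Admissible extra growth of the gradient: `α (p - 1) ≤ γ / 2` keeps the tail integral of
  -- `‖y‖^(1+α)` convergent.
  set α : ℝ := min 1 ((2 - p * (1 - s)) / (2 * (p - 1))) with hαdef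
  have hα0 : 0 < α := by positivity
  have hα1 : α ≤ 1 := min_le_left _ _
  have hα : 0 < 2 - p * (1 - s) - α * (p - 1) := by
    have : α ≤ (2 - p * (1 - s)) / (2 * (p - 1)) := min_le_right _ _
    rw [le_div_iff₀ (by positivity)] at this
    linarith
  -- Tail bound for the rescaled functions: the first term comes from the growth inside the original
  -- ball, the second from the tail hypothesis.
  set β : ℕ → ℝ := fun m =>
    2 ^ (p - 1) * farMass d (2 - p * (1 - s) - α * (p - 1)) (2 ^ m) + (1 / 2) ^ m with hβdef
  have hβ : ∀ m, 0 ≤ β m := fun m => by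
    have : 0 ≤ farMass d (2 - p * (1 - s) - α * (p - 1)) (2 ^ m) :=
      integral_nonneg fun y => by positivity
    simp only [hβdef]; positivity
  have hβ0 : Tendsto β atTop (𝓝 0) := by
    have h1 := ((tendsto_farMass (d := d) hα).comp
      (tendsto_pow_atTop_atTop_of_one_lt (one_lt_two (α := ℝ)))).const_mul (2 ^ (p - 1))
    have h2 := h1.add (tendsto_pow_atTop_nhds_zero_of_lt_one (by norm_num : (0 : ℝ) ≤ 1 / 2)
      (by norm_num))
    rw [mul_zero, add_zero] at h2
    exact h2
  -- Order of the choices: `m` by compactness, then `δ` small depending on `m`, then `K₀ ≥ m` and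
  -- `ε₁ ≤ 2^(-m)`.
  obtain ⟨m, core⟩ := exists_gradient_close (d := d) hd hs0 hs1 hp2 hγ
    (by positivity : 0 < r / 4) hμ hβ hβ0
  obtain ⟨δ, hδ0, hδ1, hδτ, hδα, hδhalf, hδr, hδm⟩ := exists_small_step hα0 hr hτ m
  have hm0 : (0 : ℝ) < (1 / 2) ^ m := by positivity
  obtain ⟨K, hK⟩ := exists_nat_gt (1 / τ)
  refine ⟨δ, min (τ / 2) ((1 / 2) ^ m), max m (K + 1), hδ0, hδ1, by positivity, by
    have := le_max_right m (K + 1); omega, hδτ, by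
    have := min_le_left (τ / 2) ((1 / 2 : ℝ) ^ m); linarith, ?_, ?_⟩
  · refine hK.trans_le ?_
    exact_mod_cast (Nat.le_succ K).trans (le_max_right m (K + 1))
  have hmK : m ≤ max m (K + 1) := le_max_left _ _
  have hε1 : min (τ / 2) ((1 / 2 : ℝ) ^ m) ≤ 1 :=
    (min_le_right _ _).trans (pow_le_one₀ (by norm_num) (by norm_num))
  have hεm : min (τ / 2) ((1 / 2 : ℝ) ^ m) ≤ (1 / 2) ^ m := min_le_right _ _
  have hε0 : 0 < min (τ / 2) ((1 / 2 : ℝ) ^ m) := by positivity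
  generalize min (τ / 2) ((1 / 2 : ℝ) ^ m) = ε₁ at hε1 hεm hε0
  generalize max m (K + 1) = K₀ at hmK
  intro u hreg hsol h0 hbound htail
  set q := 1 - δ with hq
  have hq0 : 0 < q := by linarith
  have hq1 : q < 1 := by linarith
  have hdiff := hreg.1
  obtain ⟨v, hvm, hvae, hveq⟩ := exists_measurable_modification hsol.1.2.1 hdiff.continuousOn
  have hone : (1 : ℝ) ≤ 2 ^ (K₀ + 1) := one_le_pow₀ one_le_two
  have hvloc : ∀ x ∈ ball (0 : EuclideanSpace ℝ (Fin d)) (2 ^ (K₀ + 1)), v =ᶠ[𝓝 x] u := fun x hx =>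
    hveq.eventuallyEq_of_mem (isOpen_ball.mem_nhds hx)
  have hvgrad : ∀ x ∈ ball (0 : EuclideanSpace ℝ (Fin d)) (2 ^ (K₀ + 1)),
      gradient v x = gradient u x := fun x hx => by
    rw [gradient, gradient, (hvloc x hx).fderiv_eq]
  have hvdiff : ContDiffOn ℝ 1 v (ball 0 (2 ^ (K₀ + 1))) := hdiff.congr hveq
  have hv0 : v 0 = 0 := by rw [hveq (mem_ball_self (by positivity)), h0]
  have hvweak : ∀ φ, IsNonnegTest (ball 0 (2 ^ (K₀ + 1))) φ → fracPLapForm s p v φ = 0 :=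
    fun φ hφ => by
      rw [fracPLapForm_congr_ae hvae]
      exact le_antisymm (hsol.1.2.2 φ hφ) (hsol.2.2.2 φ hφ)
  have hvspace : ∫⁻ y, ENNReal.ofReal (|v y| ^ (p - 1) / (1 + ‖y‖) ^ ((d : ℝ) + s * p)) < ⊤ := by
    refine lt_of_eq_of_lt (lintegral_congr_ae ?_) hsol.1.2.1.2
    filter_upwards [hvae] with y hy
    rw [hy]
  have hvtail : ∫⁻ y in (ball (0 : EuclideanSpace ℝ (Fin d)) (2 ^ K₀))ᶜ,
      ENNReal.ofReal (|v y| ^ (p - 1) / ‖y‖ ^ ((d : ℝ) + s * p + 1))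
        ≤ ENNReal.ofReal ((1 / 2) ^ m) := by
    refine le_trans (le_of_eq (lintegral_congr_ae ?_))
      ((lintegral_tail_le_of_tailFun_le (by linarith) hε0.le hε1 htail).trans
        (ENNReal.ofReal_le_ofReal hεm))
    filter_upwards [ae_restrict_of_ae hvae] with y hy
    rw [hy, add_assoc]
  by_cases hfirst : ∃ N : ℕ, (∀ n : ℕ, n ≤ N →
      gradSupNorm u (((2 : ℝ) ^ n)⁻¹) ≤ ENNReal.ofReal (q ^ n)) ∧
      ∃ e : EuclideanSpace ℝ (Fin d), ‖e‖ = 1 ∧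
        ENNReal.ofReal (1 - μ) * volume (ball (0 : EuclideanSpace ℝ (Fin d)) (((2 : ℝ) ^ N)⁻¹)) ≤
          volume {x ∈ ball (0 : EuclideanSpace ℝ (Fin d)) (((2 : ℝ) ^ N)⁻¹) |
            ‖gradient u x - q ^ N • e‖ ≤ r * q ^ N}
  · exact Or.inl hfirst
  right
  push Not at hfirst
  have hsmall : ∀ n : ℕ, ball (0 : EuclideanSpace ℝ (Fin d)) ((2 : ℝ) ^ n)⁻¹
      ⊆ ball 0 (2 ^ (K₀ + 1)) := fun n =>
    ball_subset_ball ((inv_le_one_of_one_le₀ (one_le_pow₀ one_le_two)).trans hone)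
  have large : ∀ k ≤ K₀, ∀ x ∈ ball (0 : EuclideanSpace ℝ (Fin d)) (2 ^ k),
      ‖gradient u x‖ ≤ (q ^ k)⁻¹ := fun k hk =>
    norm_gradient_le_of_gradSupNorm_le (hdiff.mono (ball_subset_ball
      (pow_le_pow_right₀ one_le_two (by omega)))) (by positivity) (hbound k hk)
  have decay : ∀ n : ℕ, ∀ x ∈ ball (0 : EuclideanSpace ℝ (Fin d)) ((2 : ℝ) ^ n)⁻¹,
      ‖gradient u x‖ ≤ q ^ n := by
    intro n
    induction n using Nat.strong_induction_on with
    | _ n ih =>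
      rcases n with _ | n
      · simpa using large 0 (by omega)
      have hgrad : ∀ k : ℕ, k ≤ K₀ + n → ∀ x : EuclideanSpace ℝ (Fin d),
          ‖x‖ < 2 ^ k * ((2 : ℝ) ^ n)⁻¹ → ‖fderiv ℝ v x‖ ≤ q ^ n / q ^ k := by
        intro k hk x hx
        rw [← norm_gradient_eq]
        -- Balls of radius at least one are covered by the hypothesis on `u`, smaller ones by the
        -- induction hypothesis.
        rcases le_or_gt n k with hnk | hnk
        · obtain ⟨j, rfl⟩ := Nat.exists_eq_add_of_le hnk
          have e1 : (2 : ℝ) ^ (n + j) * ((2 : ℝ) ^ n)⁻¹ = 2 ^ j := by rw [pow_add]; field_simp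
          have e2 : q ^ n / q ^ (n + j) = (q ^ j)⁻¹ := by rw [pow_add]; field_simp
          rw [e1] at hx
          rw [e2, hvgrad]
          · exact large j (by omega) x (by simpa using hx)
          · rw [mem_ball_zero_iff]
            exact hx.trans_le (pow_le_pow_right₀ one_le_two (by omega))
        · obtain ⟨j, rfl⟩ := Nat.exists_eq_add_of_lt hnk
          have e1 : (2 : ℝ) ^ k * ((2 : ℝ) ^ (k + j + 1))⁻¹ = ((2 : ℝ) ^ (j + 1))⁻¹ := by
            rw [add_assoc, pow_add]; field_simp
          have e2 : q ^ (k + j + 1) / q ^ k = q ^ (j + 1) := by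
            rw [add_assoc, pow_add]; field_simp
          rw [e1] at hx
          have hx' : x ∈ ball (0 : EuclideanSpace ℝ (Fin d)) ((2 : ℝ) ^ (j + 1))⁻¹ := by simpa using hx
          rw [e2, hvgrad x (hsmall _ hx')]
          exact ih (j + 1) (by omega) x hx'
      rcases gradient_close_or_decay hp2 hs0 hα0.le hα1 hα hq0 hq1.le hδα hr hmK hm0.le hδhalf hδr
        hδm (fun v x₀ => core v x₀) hvm hvdiff hv0 hgrad hvspace hvtail hvweak with hclose | hdec
      · obtain ⟨e, he, hvol⟩ := hclose
        have hset : {x ∈ ball (0 : EuclideanSpace ℝ (Fin d)) ((2 : ℝ) ^ n)⁻¹ |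
            ‖gradient v x - q ^ n • e‖ ≤ r * q ^ n} =
            {x ∈ ball (0 : EuclideanSpace ℝ (Fin d)) ((2 : ℝ) ^ n)⁻¹ |
            ‖gradient u x - q ^ n • e‖ ≤ r * q ^ n} := by
          ext x
          refine and_congr_right fun hx => ?_
          rw [hvgrad x (hsmall n hx)]
        rw [hset] at hvol
        -- The bounds at all scales up to `n` are available by induction, so closeness here would be
        -- the excluded first alternative with `N = n`.
        exact absurd hvol (not_le.2 (hfirst n (fun k hk => gradSupNorm_le (ih k (by omega))) e he))
      · intro x hx
        rw [← hvgrad x (hsmall (n + 1) hx)]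
        exact hdec x hx
  exact holder_of_dyadic_decay hq0 hq1 decay
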